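/- **Problem.** Let $m\ge1$, let $\mathcal X\subset\mathbb R^d$ be nonempty, closed and convex, and let $f^*=\inf\{f_0(x): x\in\mathcal X,\ f_i(x)\le r_i,\ i=1,\dots,m\}$ with $f_i(x)=\mathbb E[F_i(x,\xi_i)]$, where $F_i(\cdot,\xi_i)$ is convex and continuous on $\mathcal X$ for each realization. Assume that some $\tilde x\in\mathcal X$ satisfies $f_i(\tilde x)<r_i$ for $i=1,\dots,m$ and $f_0(\tilde x)>f^*$. Put $r_0:=r$ and $$\mathcal P(r,x)=\max_{0\le i\le m}(f_i(x)-r_i),\quad H(r)=\min_{x\in\mathcal X}\mathcal P(r,x),\quad \beta=-\frac{H(r^{(0)})}{r^{(0)}-f^*},$$ where $r^{(0)}>f^*$. Let $\mathcal Y\subset\mathbb R^{m+1}$ be the unit simplex, $\Phi(x,y,\xi)=\sum_{i=0}^m y_i(F_i(x,\xi_i)-r_i)$, $\phi=\mathbb E\,\Phi$, $G_x=\sum_{i=0}^m y_iF_i'(x,\xi_i)$ with subgradients $F_i'(x,\xi_i)\in\partial F_i(x,\xi_i)$, and $G_y=(F_i(x,\xi_i)-r_i)_{i=0}^m$. Let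 $\omega_x$ on $\mathcal X$ and $\omega_y$ on $\mathcal Y$ be distance-generating functions of moduli $\alpha_x,\alpha_y$ with respect to norms $\|\cdot\|_x,\|\cdot\|_y$, with finite diameters $D_x=\sqrt{\max\omega_x-\min\omega_x}$ and $D_y=\sqrt{\max\omega_y-\min\omega_y}$. Assume that there are constants $M_x,M_y,Q>0$ such that for all levels $r\in(f^*,r^{(0)}]$, all $x\in\mathcal X$ and all $y\in\mathcal Y$ $$\mathbb E\,e^{\|G_x\|_{*,x}^2/M_x^2}\le e,\qquad \mathbb E\,e^{\|G_y\|_{*,y}^2/M_y^2}\le e,\qquad \mathbb E\,e^{|\Phi-\phi|^2/Q^2}\le e .$$ Put $M=\sqrt{2D_x^2M_x^2/\alpha_x+2D_y^2M_y^2/\alpha_y}$, $\ \Omega(\delta)=\max\{\sqrt{12\ln(24/\delta)},\tfrac43\ln(24/\delta)\}$, $\ A_\delta=Q\Omega(\delta)+10M\Omega(\delta)+4.5M$, and $$T(\delta,\epsilon_{\mathcal A})=\max\Big\{6,\Big(\frac{16A_\delta}{\epsilon_{\mathcal A}}\ln\frac{8A_\delta}{\epsilon_{\mathcal A}}\Big)^2-2\Big\}.$$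 **Algorithms.** OVSMD at level $r$ with iteration limit $T'\in\mathbb N$ runs stochastic mirror descent on $\min_{x\in\mathcal X}\max_{y\in\mathcal Y}\phi(x,y)$ with $\omega_z=\omega_x/(2D_x^2)+\omega_y/(2D_y^2)$: it starts at $z^{(0)}=(x^{(0)},y^{(0)})=\operatorname{argmin}\omega_z$ and, for $t=0,\dots,T'$, draws a fresh independent sample $\xi^{(t)}$ and takes the prox step $z^{(t+1)}=P_{z^{(t)}}(\gamma_t(G_x,-G_y))$ with $\gamma_t=1/(M\sqrt{t+1})$, where $P_{z'}(\zeta)=\operatorname{argmin}_{z\in\mathcal X\times\mathcal Y}\{\zeta^\top(z-z')+V(z',z)\}$ and $V$ is the Bregman divergence of $\omega_z$. It returns the $\gamma$-weighted average $\bar x$ of $x^{(0)},\dots,x^{(T')}$ and the maximum $\hat u_*$ over $y\in\mathcal Y$ of the $\gamma$-weighted average of $\Phi(x^{(s)},y^{(s)},\xi^{(s)})+G_y(x^{(s)},y^{(s)},\xi^{(s)})^\top(y-y^{(s)})$, $0\le s\le T'$. Each $t$ is one gradient iteration. SFLS with inputs $r^{(0)},\epsilon_{\rm opt},\epsilon_{\mathcal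 A},\delta,\theta$ calls, in round $k=0,1,\dots$, the oracle at level $r^{(k)}$ with tolerance $\epsilon_{\mathcal A}$ and probability $\delta/2^k$, and obtains $U_k,x^{(k)}$; if $U_k\ge-\epsilon_{\rm opt}$ it halts and returns $x^{(k)}$, otherwise $r^{(k+1)}=r^{(k)}+U_k/(2\theta)$. **Claim.** Let $0<\epsilon\le1$, $\delta\in(0,1)$, $\theta>1$, $\epsilon_{\rm opt}=-\frac1\theta H(r^{(0)})\epsilon$ and $\epsilon_{\mathcal A}=-\frac{\theta-1}{2\theta^2(\theta+1)}H(r^{(0)})\epsilon$, and run SFLS with OVSMD as its oracle, where every call has an iteration limit at least $T(\delta,\epsilon_{\mathcal A})$. Let $K=\frac{2\theta^2}{\beta}\ln\frac{\theta^2}{\beta\epsilon}$. Then, with probability at least $1-\delta$, SFLS halts and returns a feasible point $x$ with $\dfrac{f_0(x)-f^*}{r^{(0)}-f^*}\le\epsilon$, having made at most $\lceil K\rceil+1$ OVSMD calls, and at most $K$ calls whenever $\frac{\theta^2}{\beta\epsilon}\ge e^4$ (in particular whenever $\epsilon\le e^{-4}$). Moreover, if every call has iteration limit $\lceil T(\delta,\epsilon_{\mathcal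 A})\rceil$, then on the same event the total number of gradient iterations is at most $$C\cdot\frac{\theta^2}{\beta\epsilon^2}\cdot\ln\Big(\frac{\theta^2}{\beta\epsilon}\Big)\cdot\ln^2\Big(\frac1\delta\Big)\cdot\ln^2\Big(\frac1\epsilon\Big)$$ for every $p\in\mathbb N$ and all $\epsilon\le\frac12$, $\delta\le\frac12$ with $\ln\frac1\delta\le\epsilon^{-p}$ (so, for each fixed $\delta\le\frac12$, for all small $\epsilon$), where $C$ depends only on $p,\theta,M,Q$ and $H(r^{(0)})$. -/

import Mathlib

open MeasureTheory ProbabilityTheory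

noncomputable section

/-- The Euclidean space `ℝⁿ`; `inner ℝ u v` is `uᵀ v`. -/
abbrev Vec (n : ℕ) : Type := EuclideanSpace ℝ (Fin n)

/-! ### The stochastic program with expectation constraints -/

/-- Data of `min f₀(x)` over `x ∈ X` subject to `fᵢ(x) ≤ rᵢ`, `i = 1, …, m`, where
`fᵢ(x) = E[Fᵢ(x, ξᵢ)]` for `i = 0, …, m`. `law` is the joint law of `ξ = (ξ₀, …, ξₘ)`, and
`rhs` is the vector `(r₁, …, rₘ)`. Only the values of `F i` on `X` matter. -/
structure SOEC (d m : ℕ) (Ξ : Fin (m + 1) → Type*) [∀ i, MeasurableSpace (Ξ i)] where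
  X : Set (Vec d)
  F : ∀ i, Vec d → Ξ i → ℝ
  rhs : Fin m → ℝ
  law : Measure (∀ i, Ξ i)

namespace SOEC

variable {d m : ℕ} {Ξ : Fin (m + 1) → Type*} [∀ i, MeasurableSpace (Ξ i)]

/-- Standing conditions: `X` is nonempty, closed and convex; `law` is a probability law; every
`Fᵢ` is measurable, continuous and convex in `x ∈ X` for each realization, and its expectation
exists. -/
structure Regular (P : SOEC d m Ξ) : Prop where
  nonempty : P.X.Nonempty
  closed : IsClosed P.X
  convex : Convex ℝ P.X
  prob : IsProbabilityMeasure P.law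
  measurable : ∀ i, Measurable (Function.uncurry (P.F i))
  continuousOn : ∀ i (ζ : Ξ i), ContinuousOn (fun x => P.F i x ζ) P.X
  convexOn : ∀ i (ζ : Ξ i), ConvexOn ℝ P.X (fun x => P.F i x ζ)
  integrable : ∀ i, ∀ x ∈ P.X, Integrable (fun ξ : ∀ i, Ξ i => P.F i x (ξ i)) P.law

/-- `fᵢ(x) = E[Fᵢ(x, ξᵢ)]`. -/
def f (P : SOEC d m Ξ) (i : Fin (m + 1)) (x : Vec d) : ℝ :=
  ∫ ξ, P.F i x (ξ i) ∂P.law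

/-- `x` is feasible: `x ∈ X` and `fᵢ(x) ≤ rᵢ` for `i = 1, …, m`. -/
def Feasible (P : SOEC d m Ξ) (x : Vec d) : Prop :=
  x ∈ P.X ∧ ∀ i : Fin m, P.f i.succ x ≤ P.rhs i

/-- The optimal value `f*`. -/
def fstar (P : SOEC d m Ξ) : ℝ := sInf (P.f 0 '' {x | P.Feasible x})

/-- Some strictly feasible point is not optimal. -/
def StrictlyFeasible (P : SOEC d m Ξ) : Prop :=
  ∃ x ∈ P.X, (∀ i : Fin m, P.f i.succ x < P.rhs i) ∧ P.fstar < P.f 0 x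

/-- The vector `(r, r₁, …, rₘ)`, that is, `r₀ := r`. -/
def levels (P : SOEC d m Ξ) (r : ℝ) : Fin (m + 1) → ℝ := Fin.cons r P.rhs

/-- `𝒫(r, x) = max {f₀(x) - r, f₁(x) - r₁, …, fₘ(x) - rₘ}`. -/
def maxGap (P : SOEC d m Ξ) (r : ℝ) (x : Vec d) : ℝ := ⨆ i, (P.f i x - P.levels r i)

/-- The level-set function `H(r) = min_{x ∈ X} 𝒫(r, x)`. -/
def H (P : SOEC d m Ξ) (r : ℝ) : ℝ := sInf (P.maxGap r '' P.X)

/-- The condition measure `β = - H(r⁽⁰⁾) / (r⁽⁰⁾ - f*)`. -/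
def beta (P : SOEC d m Ξ) (r0 : ℝ) : ℝ := -P.H r0 / (r0 - P.fstar)

/-- `Φ(x, y, ξ) = ∑ᵢ yᵢ (Fᵢ(x, ξᵢ) - rᵢ)` at level `r`. -/
def Phi (P : SOEC d m Ξ) (r : ℝ) (x : Vec d) (y : Vec (m + 1)) (ξ : ∀ i, Ξ i) : ℝ :=
  ∑ i, y i * (P.F i x (ξ i) - P.levels r i)

/-- `φ(x, y) = E[Φ(x, y, ξ)]` at level `r`. -/
def phi (P : SOEC d m Ξ) (r : ℝ) (x : Vec d) (y : Vec (m + 1)) : ℝ :=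
  ∫ ξ, P.Phi r x y ξ ∂P.law

/-- `G_y(x, y, ξ) = (F₀(x, ξ₀) - r, F₁(x, ξ₁) - r₁, …, Fₘ(x, ξₘ) - rₘ)`. -/
def Gy (P : SOEC d m Ξ) (r : ℝ) (x : Vec d) (ξ : ∀ i, Ξ i) : Vec (m + 1) :=
  WithLp.toLp 2 (fun i => P.F i x (ξ i) - P.levels r i)

end SOEC

/-! ### Mirror descent -/

/-- Subdifferential at `x` of a function on the set `S`. -/
def subdiffOn {n : ℕ} (S : Set (Vec n)) (f : Vec n → ℝ) (x : Vec n) : Set (Vec n) :=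
  {g | ∀ y ∈ S, f x + inner ℝ g (y - x) ≤ f y}

/-- The set `Sᵒ` of points of `S` where the subdifferential is nonempty. -/
def subdiffDom {n : ℕ} (S : Set (Vec n)) (f : Vec n → ℝ) : Set (Vec n) :=
  {x ∈ S | (subdiffOn S f x).Nonempty}

/-- The dual norm `‖ζ‖_* = max {ζᵀ v | ‖v‖ ≤ 1}`. -/
def dualNorm {n : ℕ} (N : Seminorm ℝ (Vec n)) (ζ : Vec n) : ℝ :=
  sSup ((fun v => inner ℝ ζ v) '' {v | N v ≤ 1})

/-- `ω` is a distance-generating function on `S`, of modulus `α` with respect to the norm `N`,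
with gradient `gradω`: it is continuous and `α`-strongly convex on `S`, and continuously
differentiable on `Sᵒ`. -/
structure IsDGF {n : ℕ} (S : Set (Vec n)) (N : Seminorm ℝ (Vec n)) (α : ℝ)
    (ω : Vec n → ℝ) (gradω : Vec n → Vec n) : Prop where
  norm_definite : ∀ v, N v = 0 → v = 0
  modulus_pos : 0 < α
  continuousOn : ContinuousOn ω S
  strongConvex : ∀ x ∈ S, ∀ y ∈ S, ∀ a b : ℝ, 0 ≤ a → 0 ≤ b → a + b = 1 →
    ω (a • x + b • y) ≤ a * ω x + b * ω y - a * b * (α / 2 * N (x - y) ^ 2)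
  hasGradient : ∀ x ∈ subdiffDom S ω, HasGradientWithinAt ω (gradω x) S x
  gradient_continuousOn : ContinuousOn gradω (subdiffDom S ω)

/-- The diameter `√(max_S ω - min_S ω)`. -/
def dgfDiam {n : ℕ} (S : Set (Vec n)) (ω : Vec n → ℝ) : ℝ :=
  √(sSup (ω '' S) - sInf (ω '' S))

/-- A minimizer of `g` on `S` (all those used below exist and are unique). -/
def argminOn {α : Type*} [Nonempty α] (g : α → ℝ) (S : Set α) : α :=
  Classical.epsilon (fun z => z ∈ S ∧ IsMinOn g S z)

/-- The simplex `𝒴 = {y ∈ ℝᵐ⁺¹ | ∑ yᵢ = 1, yᵢ ≥ 0}`. -/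
def simplexSet (m : ℕ) : Set (Vec (m + 1)) := {y | y.ofLp ∈ stdSimplex ℝ (Fin (m + 1))}

/-- `Ω(δ) = max {√(12 ln (24/δ)), (4/3) ln (24/δ)}`. -/
def OmegaFun (δ : ℝ) : ℝ := max (√(12 * Real.log (24 / δ))) (4 / 3 * Real.log (24 / δ))

/-- What mirror descent needs to know about a problem: a choice `subgrad i x ξᵢ` of stochastic
subgradients `Fᵢ'(x, ξᵢ)`, the norms on `ℝᵈ` and `ℝᵐ⁺¹`, the distance-generating functions
with their gradients and moduli, and the constants `M_x`, `M_y`, `Q`. -/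
structure MirrorSetup {d m : ℕ} {Ξ : Fin (m + 1) → Type*} [∀ i, MeasurableSpace (Ξ i)]
    (P : SOEC d m Ξ) where
  subgrad : ∀ i, Vec d → Ξ i → Vec d
  normX : Seminorm ℝ (Vec d)
  normY : Seminorm ℝ (Vec (m + 1))
  ωx : Vec d → ℝ
  gradωx : Vec d → Vec d
  αx : ℝ
  ωy : Vec (m + 1) → ℝ
  gradωy : Vec (m + 1) → Vec (m + 1)
  αy : ℝ
  Mx : ℝ
  My : ℝ
  Q : ℝ

namespace MirrorSetup

variable {d m : ℕ} {Ξ : Fin (m + 1) → Type*} [∀ i, MeasurableSpace (Ξ i)] {P : SOEC d m Ξ}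

/-- `G_x(x, y, ξ) = ∑ᵢ yᵢ Fᵢ'(x, ξᵢ)`. -/
def Gx (S : MirrorSetup P) (x : Vec d) (y : Vec (m + 1)) (ξ : ∀ i, Ξ i) : Vec d :=
  ∑ i, y i • S.subgrad i x (ξ i)

def Dx (S : MirrorSetup P) : ℝ := dgfDiam P.X S.ωx

def Dy (S : MirrorSetup P) : ℝ := dgfDiam (simplexSet m) S.ωy

/-- `M = √(2 D_x² M_x² / α_x + 2 D_y² M_y² / α_y)`. -/
def M (S : MirrorSetup P) : ℝ :=
  √(2 * S.Dx ^ 2 / S.αx * S.Mx ^ 2 + 2 * S.Dy ^ 2 / S.αy * S.My ^ 2)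

/-- `ωx` and `ωy` are distance-generating functions on `X` and `𝒴`; as the diameter `D_x` has to
be finite, `ωx` is bounded above on `X`. -/
structure ValidDGF (S : MirrorSetup P) : Prop where
  dgf_x : IsDGF P.X S.normX S.αx S.ωx S.gradωx
  bddAbove_x : BddAbove (S.ωx '' P.X)
  dgf_y : IsDGF (simplexSet m) S.normY S.αy S.ωy S.gradωy

/-- `Fᵢ'(x, ξᵢ)` is a (measurable) subgradient of `Fᵢ(·, ξᵢ)`, and the stochastic subgradients
and function values are light-tailed with constants `M_x`, `M_y`, `Q` that do not depend on the
level `r ∈ (f*, r⁽⁰⁾]`. -/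
structure LightTail (S : MirrorSetup P) (r0 : ℝ) : Prop where
  Mx_pos : 0 < S.Mx
  My_pos : 0 < S.My
  Q_pos : 0 < S.Q
  measurable_subgrad : ∀ i, Measurable (Function.uncurry (S.subgrad i))
  subgrad_mem : ∀ i, ∀ x ∈ P.X, ∀ ζ : Ξ i,
    S.subgrad i x ζ ∈ subdiffOn P.X (fun x' => P.F i x' ζ) x
  tail_x : ∀ x ∈ P.X, ∀ y ∈ simplexSet m,
    ∫⁻ ξ, ENNReal.ofReal (Real.exp (dualNorm S.normX (S.Gx x y ξ) ^ 2 / S.Mx ^ 2)) ∂P.law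
      ≤ ENNReal.ofReal (Real.exp 1)
  tail_y : ∀ r ∈ Set.Ioc P.fstar r0, ∀ x ∈ P.X,
    ∫⁻ ξ, ENNReal.ofReal (Real.exp (dualNorm S.normY (P.Gy r x ξ) ^ 2 / S.My ^ 2)) ∂P.law
      ≤ ENNReal.ofReal (Real.exp 1)
  tail_obj : ∀ r ∈ Set.Ioc P.fstar r0, ∀ x ∈ P.X, ∀ y ∈ simplexSet m,
    ∫⁻ ξ, ENNReal.ofReal (Real.exp (|P.Phi r x y ξ - P.phi r x y| ^ 2 / S.Q ^ 2)) ∂P.law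
      ≤ ENNReal.ofReal (Real.exp 1)

/-- `ω_z(z) = ω_x(x) / (2 D_x²) + ω_y(y) / (2 D_y²)`. -/
def ωz (S : MirrorSetup P) (z : Vec d × Vec (m + 1)) : ℝ :=
  S.ωx z.1 / (2 * S.Dx ^ 2) + S.ωy z.2 / (2 * S.Dy ^ 2)

/-- The Bregman divergence `V(z', z) = ω_z(z) - [ω_z(z') + ∇ω_z(z')ᵀ (z - z')]`. -/
def bregman (S : MirrorSetup P) (z' z : Vec d × Vec (m + 1)) : ℝ :=
  S.ωz z - (S.ωz z' + (inner ℝ (S.gradωx z'.1) (z.1 - z'.1) / (2 * S.Dx ^ 2)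
    + inner ℝ (S.gradωy z'.2) (z.2 - z'.2) / (2 * S.Dy ^ 2)))

/-- The prox-mapping `P_{z'}(ζ) = argmin_{z ∈ X × 𝒴} {ζᵀ (z - z') + V(z', z)}`. -/
def prox (S : MirrorSetup P) (z' ζ : Vec d × Vec (m + 1)) : Vec d × Vec (m + 1) :=
  argminOn (fun z => inner ℝ ζ.1 (z.1 - z'.1) + inner ℝ ζ.2 (z.2 - z'.2) + S.bregman z' z)
    (P.X ×ˢ simplexSet m)

/-- The step lengths `γ_t = 1 / (M √(t + 1))`. -/
def gamma (S : MirrorSetup P) (t : ℕ) : ℝ := 1 / (S.M * √((t : ℝ) + 1))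

/-- The iterates `z⁽ᵗ⁾ = (x⁽ᵗ⁾, y⁽ᵗ⁾)` of stochastic mirror descent at level `r`, with samples
`ξ⁽⁰⁾, ξ⁽¹⁾, …`. -/
def iter (S : MirrorSetup P) (r : ℝ) (ξ : ℕ → ∀ i, Ξ i) : ℕ → Vec d × Vec (m + 1)
  | 0 => argminOn S.ωz (P.X ×ˢ simplexSet m)
  | t + 1 =>
    let z := iter S r ξ t
    S.prox z (S.gamma t • (S.Gx z.1 z.2 (ξ t), -P.Gy r z.1 (ξ t)))

/-- The weighted average `x̄⁽ᵗ⁾`. -/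
def xbar (S : MirrorSetup P) (r : ℝ) (ξ : ℕ → ∀ i, Ξ i) (t : ℕ) : Vec d :=
  (∑ s ∈ Finset.range (t + 1), S.gamma s)⁻¹ •
    ∑ s ∈ Finset.range (t + 1), S.gamma s • (S.iter r ξ s).1

/-- The online upper bound `û_*⁽ᵗ⁾`, the maximum over `y ∈ 𝒴` of the weighted average of
`Φ(x⁽ˢ⁾, y⁽ˢ⁾, ξ⁽ˢ⁾) + G_y(x⁽ˢ⁾, y⁽ˢ⁾, ξ⁽ˢ⁾)ᵀ (y - y⁽ˢ⁾)`. -/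
def uhat (S : MirrorSetup P) (r : ℝ) (ξ : ℕ → ∀ i, Ξ i) (t : ℕ) : ℝ :=
  sSup ((fun y : Vec (m + 1) =>
    (∑ s ∈ Finset.range (t + 1), S.gamma s)⁻¹ *
      ∑ s ∈ Finset.range (t + 1), S.gamma s *
        (P.Phi r (S.iter r ξ s).1 (S.iter r ξ s).2 (ξ s)
          + inner ℝ (P.Gy r (S.iter r ξ s).1 (ξ s)) (y - (S.iter r ξ s).2))) '' simplexSet m)

/-- The iteration limit `T(δ, ε)` as a real number. -/
def iterLimit (S : MirrorSetup P) (δ ε : ℝ) : ℝ :=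
  let A := S.Q * OmegaFun δ + 10 * S.M * OmegaFun δ + 4.5 * S.M
  max 6 ((16 * A / ε * Real.log (8 * A / ε)) ^ 2 - 2)

end MirrorSetup

/-! ### Oracles and the level-set method -/

/-- What one oracle call returns: a value `U`, a point `x`, and the number of gradient iterations
that the call performed. -/
structure OracleOutput (d : ℕ) where
  U : ℝ
  x : Vec d
  gradIters : ℕ

/-- Online validation based stochastic mirror descent, run for `t = 0, 1, …, limit δ ε`, as an
oracle with inputs level `r`, tolerance `ε`, probability `δ`, and a stream `ξ` of samples. -/
def OVSMD {d m : ℕ} {Ξ : Fin (m + 1) → Type*} [∀ i, MeasurableSpace (Ξ i)] {P : SOEC d m Ξ}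
    (S : MirrorSetup P) (limit : ℝ → ℝ → ℕ) (r ε δ : ℝ) (ξ : ℕ → ∀ i, Ξ i) : OracleOutput d where
  U := S.uhat r ξ (limit δ ε)
  x := S.xbar r ξ (limit δ ε)
  gradIters := limit δ ε + 1

namespace SFLS

variable {d : ℕ} {σ : Type*}

/-- The levels `r⁽ᵏ⁾` of the stochastic feasible level-set method with oracle `A`, where the
`k`-th oracle call has probability parameter `δ⁽ᵏ⁾ = δ / 2ᵏ` and randomness `s k`:
`r⁽ᵏ⁺¹⁾ = r⁽ᵏ⁾ + U(r⁽ᵏ⁾) / (2θ)`. -/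
def level (A : ℝ → ℝ → ℝ → σ → OracleOutput d) (r0 εA δ θ : ℝ) (s : ℕ → σ) : ℕ → ℝ
  | 0 => r0
  | k + 1 => level A r0 εA δ θ s k
      + (A (level A r0 εA δ θ s k) εA (δ / 2 ^ k) (s k)).U / (2 * θ)

/-- The output `(U(r⁽ᵏ⁾), x⁽ᵏ⁾)` of the `k`-th oracle call, `k = 0, 1, …`. -/
def output (A : ℝ → ℝ → ℝ → σ → OracleOutput d) (r0 εA δ θ : ℝ) (s : ℕ → σ) (k : ℕ) :
    OracleOutput d :=
  A (level A r0 εA δ θ s k) εA (δ / 2 ^ k) (s k)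

/-- The method halts in round `k` (and then returns `x⁽ᵏ⁾`, after `k + 1` oracle calls): `k` is
the first index with `U(r⁽ᵏ⁾) ≥ - ε_opt`. -/
def HaltsAt (A : ℝ → ℝ → ℝ → σ → OracleOutput d) (r0 εopt εA δ θ : ℝ) (s : ℕ → σ) (k : ℕ) :
    Prop :=
  -εopt ≤ (output A r0 εA δ θ s k).U ∧ ∀ j < k, (output A r0 εA δ θ s j).U < -εopt

/-- The number of gradient iterations in the oracle calls of rounds `0, …, k`. -/
def totalGradIters (A : ℝ → ℝ → ℝ → σ → OracleOutput d) (r0 εA δ θ : ℝ) (s : ℕ → σ) (k : ℕ) :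
    ℕ :=
  ∑ j ∈ Finset.range (k + 1), (output A r0 εA δ θ s j).gradIters

end SFLS

end

/-! ### Norms and dual norms -/

/-! One oracle call. The prox step splits into a mirror descent step on `X` and one on the simplex,
and the usual regret bound controls, for every sample path, the weighted sum of `⟨G_x, x_s - x⟩ -
⟨G_y, y_s - y⟩` with weights `w_s = 1/√(s+1)`. The online bound `uhat` is the largest coordinate of
the averaged `G_y`. It hardly exceeds `𝒫(r, x)` for a comparison point `x` of `X` (`Valid.uhat_le`):
the subgradient inequality, used sample by sample, bounds `Φ(x_s, y_s, ξ_s) + ⟨G_x, x - x_s⟩` by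
`Φ(x, y_s, ξ_s)`, whose mean is at most `𝒫(r, x)`. Conversely `𝒫(r, xbar)` hardly exceeds `uhat`
(`Valid.maxGap_xbar_le`). By convexity only the noise of the averaged `G_y` has to be bounded, in
all coordinates at once. A fictitious mirror descent `auxIter` driven by this noise does that:
tested against `auxIter - y` the noise is bounded by regret, and tested against `auxIter` it is a
martingale.

Probability. Two martingale sums and a sum of squared norms remain. The exponential moment of each
increment is at most `exp (w_s²)`, so each sum exceeds `∑ w_s² + λ` with probability at most
`e^{-λ}` (`SampleFiltration.measure_sum_ge_le`). The level of a call is random but determined by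
earlier rounds, and a measurable choice of near minimizers makes the comparison point so as well. As
`∑ w_s² ≤ 1 + log n` and `∑ w_s ≥ √n`, the error past the iteration limit is at most `ε_A / 4`.

Levels. Between `f*` and `r⁽⁰⁾`, `H(r)` lies between `-(r - f*)` and `-β (r - f*)`, and lowering the
level by `a` raises `H` by at most `a`. With an accurate oracle, a round that does not halt
multiplies `r - f*` by at most `1 - β/(2θ²)`, keeps `r > f*`, and keeps `H(r) ≤ -ε_A`, which makes
the returned point feasible (`levelSet_halts`).

Union bound. Each of the first `⌈K⌉ + 1` calls gets the same share of `δ`. The logarithm of their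
number is absorbed by the iteration limit because `A_δ / ε_A ≥ 30 θ²/(βε)`, which rests on `r⁽⁰⁾ -
f* ≤ 4M` (`LightTail.sub_fstar_le`). -/

section DualNorm

variable {n : ℕ} {N : Seminorm ℝ (Vec n)}

lemma Seminorm.continuous_vec (N : Seminorm ℝ (Vec n)) : Continuous N :=
  continuousOn_univ.1 (N.convexOn.continuousOn isOpen_univ)

lemma exists_pos_mul_norm_le (hN : ∀ v, N v = 0 → v = 0) :
    ∃ c > 0, ∀ v, c * ‖v‖ ≤ N v := by
  by_cases hne : (Metric.sphere (0 : Vec n) 1).Nonempty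
  · obtain ⟨u, hu, hmin⟩ := (isCompact_sphere (0 : Vec n) 1).exists_isMinOn hne
      N.continuous_vec.continuousOn
    have hu1 : ‖u‖ = 1 := by simpa using hu
    have hpos : 0 < N u := by
      refine lt_of_le_of_ne (apply_nonneg N u) fun h => ?_
      have := hN u h.symm
      simp [this] at hu1
    refine ⟨N u, hpos, fun v => ?_⟩
    by_cases hv : v = 0
    · simp [hv]
    have hv' : 0 < ‖v‖ := norm_pos_iff.2 hv
    have h1 : N u ≤ N (‖v‖⁻¹ • v) := hmin (by simp [norm_smul, hv'.ne'])
    rw [map_smul_eq_mul, norm_inv, norm_norm, inv_mul_eq_div, le_div_iff₀ hv'] at h1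
    exact h1
  · refine ⟨1, one_pos, fun v => ?_⟩
    by_cases hv : v = 0
    · simp [hv]
    exact absurd ⟨‖v‖⁻¹ • v, by simp [norm_smul, hv]⟩ hne

/-- Without this bound the real supremum in `dualNorm` could take its default value `0`. -/
lemma bddAbove_inner_image (hN : ∀ v, N v = 0 → v = 0) (ζ : Vec n) :
    BddAbove ((fun v => inner ℝ ζ v) '' {v | N v ≤ 1}) := by
  obtain ⟨c, hc, h⟩ := exists_pos_mul_norm_le hN
  refine ⟨‖ζ‖ * c⁻¹, ?_⟩
  rintro _ ⟨v, hv, rfl⟩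
  refine (real_inner_le_norm ζ v).trans ?_
  gcongr
  rw [← one_div, le_div_iff₀ hc, mul_comm]
  exact (h v).trans hv

lemma dualNorm_nonneg (hN : ∀ v, N v = 0 → v = 0) (ζ : Vec n) : 0 ≤ dualNorm N ζ :=
  le_csSup (bddAbove_inner_image hN ζ) ⟨0, by simp, by simp⟩

lemma dualNorm_le {ζ : Vec n} {C : ℝ} (h : ∀ v, N v ≤ 1 → inner ℝ ζ v ≤ C) :
    dualNorm N ζ ≤ C := by
  refine csSup_le ⟨0, 0, by simp, by simp⟩ ?_
  rintro _ ⟨v, hv, rfl⟩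
  exact h v hv

lemma inner_le_dualNorm (hN : ∀ v, N v = 0 → v = 0) (ζ : Vec n) {v : Vec n} (hv : N v ≤ 1) :
    inner ℝ ζ v ≤ dualNorm N ζ :=
  le_csSup (bddAbove_inner_image hN ζ) ⟨v, hv, rfl⟩

lemma inner_le_dualNorm_mul (hN : ∀ v, N v = 0 → v = 0) (ζ v : Vec n) :
    inner ℝ ζ v ≤ dualNorm N ζ * N v := by
  by_cases hv : N v = 0
  · simp [hN v hv]
  have hv' : 0 < N v := lt_of_le_of_ne (apply_nonneg N v) (Ne.symm hv)
  have h := inner_le_dualNorm hN ζ (v := (N v)⁻¹ • v)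
    (by rw [map_smul_eq_mul, norm_inv, Real.norm_of_nonneg hv'.le, inv_mul_cancel₀ hv])
  rw [inner_smul_right, inv_mul_le_iff₀ hv', mul_comm] at h
  exact h

lemma dualNorm_smul_le (hN : ∀ v, N v = 0 → v = 0) (a : ℝ) (ζ : Vec n) :
    dualNorm N (a • ζ) ≤ |a| * dualNorm N ζ := by
  refine dualNorm_le fun v hv => ?_
  have h : inner ℝ (a • ζ) v = inner ℝ ζ (a • v) := by
    rw [inner_smul_left, inner_smul_right]; rfl
  rw [h]
  refine (inner_le_dualNorm_mul hN ζ (a • v)).trans ?_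
  rw [map_smul_eq_mul, Real.norm_eq_abs, mul_comm, mul_assoc]
  refine mul_le_mul_of_nonneg_left ?_ (abs_nonneg a)
  exact mul_le_of_le_one_left (dualNorm_nonneg hN ζ) hv

lemma dualNorm_add_le (hN : ∀ v, N v = 0 → v = 0) (ζ ζ' : Vec n) :
    dualNorm N (ζ + ζ') ≤ dualNorm N ζ + dualNorm N ζ' := by
  refine dualNorm_le fun v hv => ?_
  rw [inner_add_left]
  exact add_le_add (inner_le_dualNorm hN ζ hv) (inner_le_dualNorm hN ζ' hv)

lemma dualNorm_continuous (hN : ∀ v, N v = 0 → v = 0) : Continuous (dualNorm N) := by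
  refine continuousOn_univ.1 (ConvexOn.continuousOn isOpen_univ ⟨convex_univ, ?_⟩)
  intro x _ y _ a b ha hb _
  refine (dualNorm_add_le hN _ _).trans ?_
  have h1 := dualNorm_smul_le hN a x
  have h2 := dualNorm_smul_le hN b y
  rw [abs_of_nonneg ha] at h1
  rw [abs_of_nonneg hb] at h2
  exact add_le_add h1 h2

lemma dualNorm_smul_sq_le (hN : ∀ v, N v = 0 → v = 0) (a : ℝ) (ζ : Vec n) :
    dualNorm N (a • ζ) ^ 2 ≤ a ^ 2 * dualNorm N ζ ^ 2 := by
  have h := pow_le_pow_left₀ (dualNorm_nonneg hN _) (dualNorm_smul_le hN a ζ) 2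
  rwa [mul_pow, sq_abs] at h

end DualNorm

/-! ### Distance-generating functions and mirror maps -/

/-- The Bregman divergence of `ω` with gradient `gradω`. -/
noncomputable def bregDiv {n : ℕ} (ω : Vec n → ℝ) (gradω : Vec n → Vec n) (x u : Vec n) : ℝ :=
  ω u - ω x - inner ℝ (gradω x) (u - x)

/-- The minimizer over `S` of `ηᵀ x + ω(x)`. -/
noncomputable def mirrorMap {n : ℕ} (S : Set (Vec n)) (ω : Vec n → ℝ) (η : Vec n) : Vec n :=
  argminOn (fun x => inner ℝ η x + ω x) S

lemma argminOn_spec {X : Type*} [Nonempty X] {g : X → ℝ} {S : Set X}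
    (h : ∃ z ∈ S, IsMinOn g S z) : argminOn g S ∈ S ∧ IsMinOn g S (argminOn g S) :=
  Classical.epsilon_spec (p := fun z => z ∈ S ∧ IsMinOn g S z) h

section DGF

variable {n : ℕ} {S : Set (Vec n)} {N : Seminorm ℝ (Vec n)} {α : ℝ} {ω : Vec n → ℝ}
  {gradω : Vec n → Vec n}

/-- Strong convexity on the segment from `x0` to a far point pushes `ω`, at distance one from `x0`,
below the chord by an amount that grows linearly with the length of the segment. Near `x0`
compactness bounds `ω` from below, so an upper bound for `ω` bounds `S`. -/
lemma IsDGF.isCompact (h : IsDGF S N α ω gradω) (hc : IsClosed S) (hS : Convex ℝ S)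
    (hb : BddAbove (ω '' S)) : IsCompact S := by
  rcases S.eq_empty_or_nonempty with rfl | ⟨x0, hx0⟩
  · exact isCompact_empty
  obtain ⟨B, hB⟩ := hb
  obtain ⟨c, hc0, hcN⟩ := exists_pos_mul_norm_le h.norm_definite
  have hα := h.modulus_pos
  have hcomp : IsCompact (S ∩ Metric.closedBall x0 1) :=
    (isCompact_closedBall x0 1).inter_left hc
  obtain ⟨p0, hp0, hmin⟩ := hcomp.exists_isMinOn ⟨x0, hx0, by simp⟩
    (h.continuousOn.mono Set.inter_subset_left)
  refine Metric.isCompact_of_isClosed_isBounded hc ?_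
  refine (Metric.isBounded_closedBall (x := x0)
    (r := 1 + 2 * (B - ω p0) / (α * c ^ 2))).subset fun x hx => ?_
  rw [Metric.mem_closedBall, dist_eq_norm]
  have hαc : 0 < α * c ^ 2 := by positivity
  have hp0B : ω p0 ≤ B := hB ⟨p0, hp0.1, rfl⟩
  rcases le_or_gt ‖x - x0‖ 1 with h1 | h1
  · have : 0 ≤ 2 * (B - ω p0) / (α * c ^ 2) :=
      div_nonneg (by linarith) hαc.le
    linarith
  set ρ := ‖x - x0‖ with hρ
  have hρ0 : 0 < ρ := by linarith
  have hinv : ρ⁻¹ ≤ 1 := inv_le_one_of_one_le₀ h1.le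
  have hinv0 : 0 < ρ⁻¹ := inv_pos.2 hρ0
  have hsc := h.strongConvex x hx x0 hx0 ρ⁻¹ (1 - ρ⁻¹) hinv0.le (by linarith) (by ring)
  have hmem : ρ⁻¹ • x + (1 - ρ⁻¹) • x0 ∈ S ∩ Metric.closedBall x0 1 := by
    refine ⟨hS hx hx0 hinv0.le (by linarith) (by ring), ?_⟩
    rw [Metric.mem_closedBall, dist_eq_norm]
    have : ρ⁻¹ • x + (1 - ρ⁻¹) • x0 - x0 = ρ⁻¹ • (x - x0) := by module
    rw [this, norm_smul, norm_inv, Real.norm_of_nonneg hρ0.le, ← hρ, inv_mul_cancel₀ hρ0.ne']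
  have h2 : ω p0 ≤ ω (ρ⁻¹ • x + (1 - ρ⁻¹) • x0) := hmin hmem
  have h3 : ω x ≤ B := hB ⟨x, hx, rfl⟩
  have h4 : ω x0 ≤ B := hB ⟨x0, hx0, rfl⟩
  have h5 : (c * ρ) ^ 2 ≤ N (x - x0) ^ 2 :=
    pow_le_pow_left₀ (by positivity) (hcN (x - x0)) 2
  have h6 : ρ⁻¹ * ω x + (1 - ρ⁻¹) * ω x0 ≤ B := by
    nlinarith
  have h7 : ρ⁻¹ * (1 - ρ⁻¹) * (α / 2 * (c * ρ) ^ 2) ≤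
      ρ⁻¹ * (1 - ρ⁻¹) * (α / 2 * N (x - x0) ^ 2) := by
    have : 0 ≤ 1 - ρ⁻¹ := by linarith
    gcongr
  have h8 : ρ⁻¹ * (1 - ρ⁻¹) * (α / 2 * (c * ρ) ^ 2) = (ρ - 1) * (α * c ^ 2) / 2 := by
    field_simp
  have h9 : (ρ - 1) * (α * c ^ 2) ≤ 2 * (B - ω p0) := by linarith
  have := (le_div_iff₀ hαc).2 h9
  linarith

/-- On the segment from `x` to `u`, the chord minus the strong convexity term dominates `ω`, with
equality at `x`. Comparing one-sided derivatives at `x` gives the bound. -/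
lemma IsDGF.growth (h : IsDGF S N α ω gradω) (hS : Convex ℝ S) {x u : Vec n}
    (hx : x ∈ subdiffDom S ω) (hu : u ∈ S) :
    α / 2 * N (u - x) ^ 2 ≤ bregDiv ω gradω x u := by
  have hxS : x ∈ S := hx.1
  set C := α / 2 * N (u - x) ^ 2 with hC
  have hgrad := (h.hasGradient x hx).hasFDerivWithinAt
  have hline : HasDerivWithinAt (fun t : ℝ => x + t • (u - x)) (u - x) (Set.Icc 0 1) 0 := by
    have : HasDerivAt (fun t : ℝ => x + t • (u - x)) ((1 : ℝ) • (u - x)) 0 :=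
      ((hasDerivAt_id (0 : ℝ)).smul_const (u - x)).const_add x
    simpa using this.hasDerivWithinAt
  have hmaps : Set.MapsTo (fun t : ℝ => x + t • (u - x)) (Set.Icc 0 1) S := by
    intro t ht
    exact hS.add_smul_sub_mem hxS hu ht
  have hcomp : HasDerivWithinAt (fun t : ℝ => ω (x + t • (u - x))) (inner ℝ (gradω x) (u - x))
      (Set.Icc 0 1) 0 := by
    have h0 : HasFDerivWithinAt ω (InnerProductSpace.toDual ℝ (Vec n) (gradω x)) S
        (x + (0 : ℝ) • (u - x)) := by simpa using hgrad
    have := h0.comp_hasDerivWithinAt (0 : ℝ) hline hmaps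
    simpa using! this
  have hk : HasDerivWithinAt
      (fun t : ℝ => (1 - t) * ω x + t * ω u - t * (1 - t) * C - ω (x + t • (u - x)))
      (ω u - ω x - C - inner ℝ (gradω x) (u - x)) (Set.Icc 0 1) 0 := by
    refine HasDerivWithinAt.sub ?_ hcomp
    have e : HasDerivAt (fun t : ℝ => (1 - t) * ω x + t * ω u - t * (1 - t) * C)
        ((0 - 1) * ω x + 1 * ω u - (1 * (1 - 0) + 0 * (0 - 1)) * C) 0 := by
      have hid := hasDerivAt_id (0 : ℝ)
      have h1 := (hasDerivAt_const (0 : ℝ) (1 : ℝ)).sub hid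
      exact ((h1.mul_const _).add (hid.mul_const _)).sub ((hid.mul h1).mul_const C)
    convert e.hasDerivWithinAt using 1
    ring
  have hmin : IsLocalMinOn
      (fun t : ℝ => (1 - t) * ω x + t * ω u - t * (1 - t) * C - ω (x + t • (u - x)))
      (Set.Icc 0 1) 0 := by
    refine IsMinOn.localize ?_
    intro t ht
    have := h.strongConvex u hu x hxS t (1 - t) ht.1 (by linarith [ht.2]) (by ring)
    have e : t • u + (1 - t) • x = x + t • (u - x) := by module
    rw [e, ← hC] at this
    simp only [Set.mem_ofPred_eq, zero_smul, add_zero]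
    linarith
  have hcone : (1 : ℝ) ∈ posTangentConeAt (Set.Icc (0 : ℝ) 1) 0 := by
    have := sub_mem_posTangentConeAt_of_segment_subset (s := Set.Icc (0 : ℝ) 1) (x := 0) (y := 1)
      (by rw [segment_eq_Icc zero_le_one])
    simpa using this
  have := hmin.hasFDerivWithinAt_nonneg hk.hasFDerivWithinAt hcone
  simp at this
  unfold bregDiv
  linarith

variable (hcp : IsCompact S) (hne : S.Nonempty) (hS : Convex ℝ S)

include hcp hne in
lemma IsDGF.mirrorMap_spec (h : IsDGF S N α ω gradω) (η : Vec n) :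
    mirrorMap S ω η ∈ S ∧ IsMinOn (fun x => inner ℝ η x + ω x) S (mirrorMap S ω η) := by
  refine argminOn_spec (hcp.exists_isMinOn hne ?_)
  exact (by fun_prop : Continuous fun x : Vec n => inner ℝ η x).continuousOn.add h.continuousOn

/-- Minimality makes `-η` a subgradient. Hence all iterates lie in `Sᵒ`, the only place where
`gradω` is known to be a gradient and to be continuous. -/
lemma mem_subdiffDom_of_isMinOn {η x : Vec n} (hx : x ∈ S)
    (hmin : IsMinOn (fun x => inner ℝ η x + ω x) S x) : x ∈ subdiffDom S ω := by
  refine ⟨hx, -η, fun y hy => ?_⟩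
  have : inner ℝ η x + ω x ≤ inner ℝ η y + ω y := hmin hy
  rw [inner_neg_left, inner_sub_right]
  linarith

include hS in
lemma IsDGF.variational (h : IsDGF S N α ω gradω) {η x u : Vec n} (hx : x ∈ S)
    (hmin : IsMinOn (fun x => inner ℝ η x + ω x) S x) (hu : u ∈ S) :
    0 ≤ inner ℝ (η + gradω x) (u - x) := by
  have hx' := mem_subdiffDom_of_isMinOn hx hmin
  have hd : HasFDerivWithinAt (fun x => inner ℝ η x + ω x)
      (InnerProductSpace.toDual ℝ (Vec n) η + InnerProductSpace.toDual ℝ (Vec n) (gradω x)) S x :=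
    (InnerProductSpace.toDual ℝ (Vec n) η).hasFDerivWithinAt.add
      (h.hasGradient x hx').hasFDerivWithinAt
  have := hmin.localize.hasFDerivWithinAt_nonneg hd
    (sub_mem_posTangentConeAt_of_segment_subset (hS.segment_subset hx hu))
  simpa [inner_add_left] using this

include hS in
lemma IsDGF.growth_of_isMinOn (h : IsDGF S N α ω gradω) {η x u : Vec n} (hx : x ∈ S)
    (hmin : IsMinOn (fun x => inner ℝ η x + ω x) S x) (hu : u ∈ S) :
    inner ℝ η x + ω x + α / 2 * N (u - x) ^ 2 ≤ inner ℝ η u + ω u := by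
  have h1 := h.variational hS hx hmin hu
  have h2 := h.growth hS (mem_subdiffDom_of_isMinOn hx hmin) hu
  rw [inner_add_left, inner_sub_right] at h1
  unfold bregDiv at h2
  linarith

include hcp hne hS in
lemma IsDGF.eq_mirrorMap (h : IsDGF S N α ω gradω) {η x : Vec n} (hx : x ∈ S)
    (hmin : IsMinOn (fun x => inner ℝ η x + ω x) S x) : x = mirrorMap S ω η := by
  obtain ⟨hm, hmin'⟩ := h.mirrorMap_spec hcp hne η
  have h1 := h.growth_of_isMinOn hS hx hmin hm
  have h2 : inner ℝ η (mirrorMap S ω η) + ω (mirrorMap S ω η) ≤ inner ℝ η x + ω x := hmin' hx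
  have hα := h.modulus_pos
  have h3 : N (mirrorMap S ω η - x) ^ 2 ≤ 0 := by nlinarith
  have h4 : N (mirrorMap S ω η - x) = 0 := pow_eq_zero_iff two_ne_zero |>.1
    (le_antisymm h3 (sq_nonneg _))
  exact (sub_eq_zero.1 (h.norm_definite _ h4)).symm

include hcp hne hS in
-- Adding the growth inequalities at the two minimizers gives the Lipschitz constant `1/(αc²)`.
-- Continuity serves to make the iterates measurable in the samples.
lemma IsDGF.mirrorMap_continuous (h : IsDGF S N α ω gradω) : Continuous (mirrorMap S ω) := by
  obtain ⟨c, hc, hcN⟩ := exists_pos_mul_norm_le h.norm_definite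
  have hα := h.modulus_pos
  have hK : 0 ≤ 1 / (α * c ^ 2) := by positivity
  refine LipschitzWith.continuous (K := ⟨1 / (α * c ^ 2), hK⟩) (LipschitzWith.of_dist_le_mul ?_)
  intro η η'
  obtain ⟨hm, hmin⟩ := h.mirrorMap_spec hcp hne η
  obtain ⟨hm', hmin'⟩ := h.mirrorMap_spec hcp hne η'
  have h1 := h.growth_of_isMinOn hS hm hmin hm'
  have h2 := h.growth_of_isMinOn hS hm' hmin' hm
  rw [map_sub_rev N] at h2
  set a := mirrorMap S ω η
  set b := mirrorMap S ω η'
  rw [dist_eq_norm, dist_eq_norm]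
  change ‖a - b‖ ≤ 1 / (α * c ^ 2) * ‖η - η'‖
  have h3 : inner ℝ (η - η') (b - a) = inner ℝ η b - inner ℝ η a - inner ℝ η' b + inner ℝ η' a := by
    simp only [inner_sub_left, inner_sub_right]; ring
  have h4 := real_inner_le_norm (η - η') (b - a)
  have h5 : (c * ‖b - a‖) ^ 2 ≤ N (b - a) ^ 2 :=
    pow_le_pow_left₀ (by positivity) (hcN _) 2
  rw [norm_sub_rev a b, one_div, le_inv_mul_iff₀ (by positivity)]
  rcases (norm_nonneg (b - a)).eq_or_lt with h0 | h0
  · rw [← h0]; simp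
  · have h6 : α * (c * ‖b - a‖) ^ 2 ≤ ‖η - η'‖ * ‖b - a‖ := by nlinarith
    refine le_of_mul_le_mul_right (le_trans (le_of_eq ?_) h6) h0
    ring

include hS in
/-- The three-point inequality for one mirror descent step. -/
lemma IsDGF.bregDiv_step (h : IsDGF S N α ω gradω) {x x' ζ u : Vec n} (hx : x ∈ subdiffDom S ω)
    (hx' : x' ∈ S) (hmin : IsMinOn (fun v => inner ℝ (ζ - gradω x) v + ω v) S x') (hu : u ∈ S) :
    bregDiv ω gradω x' u ≤
      bregDiv ω gradω x u + inner ℝ ζ (u - x) + dualNorm N ζ ^ 2 / (2 * α) := by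
  have h1 := h.variational hS hx' hmin hu
  have h2 := h.growth hS hx hx'
  have h3 := inner_le_dualNorm_mul h.norm_definite ζ (x - x')
  rw [map_sub_rev N] at h3
  have hα := h.modulus_pos
  -- Young's inequality; its quadratic term in the step is absorbed by the growth of the divergence
  -- from `x` to `x'`.
  have h4 : dualNorm N ζ * N (x' - x) ≤ dualNorm N ζ ^ 2 / (2 * α) + α / 2 * N (x' - x) ^ 2 := by
    have : dualNorm N ζ ^ 2 / (2 * α) + α / 2 * N (x' - x) ^ 2 - dualNorm N ζ * N (x' - x) =
        (dualNorm N ζ - α * N (x' - x)) ^ 2 / (2 * α) := by field_simp; ring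
    have h0 : 0 ≤ (dualNorm N ζ - α * N (x' - x)) ^ 2 / (2 * α) := by positivity
    linarith
  unfold bregDiv at *
  simp only [inner_add_left, inner_sub_left, inner_sub_right] at *
  linarith

include hcp in
lemma IsDGF.sub_le_dgfDiam_sq (h : IsDGF S N α ω gradω) {x u : Vec n} (hx : x ∈ S) (hu : u ∈ S) :
    ω u - ω x ≤ dgfDiam S ω ^ 2 := by
  have hb := hcp.bddAbove_image h.continuousOn
  have hb' := hcp.bddBelow_image h.continuousOn
  have h1 := le_csSup hb ⟨u, hu, rfl⟩
  have h2 := csInf_le hb' ⟨x, hx, rfl⟩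
  have h3 := le_csSup hb ⟨x, hx, rfl⟩
  rw [dgfDiam, Real.sq_sqrt (by linarith)]
  linarith

include hcp hS in
-- At the midpoint, strong convexity puts `ω` below the mean of its end values by `α/8` times the
-- squared norm, while `ω` varies by at most the squared diameter.
lemma IsDGF.norm_sub_sq_le (h : IsDGF S N α ω gradω) {x u : Vec n} (hx : x ∈ S) (hu : u ∈ S) :
    α / 8 * N (u - x) ^ 2 ≤ dgfDiam S ω ^ 2 := by
  have h1 := h.strongConvex u hu x hx (1 / 2) (1 / 2) (by norm_num) (by norm_num) (by norm_num)
  have hm : (1 / 2 : ℝ) • u + (1 / 2 : ℝ) • x ∈ S :=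
    hS hu hx (by norm_num) (by norm_num) (by norm_num)
  have h2 := h.sub_le_dgfDiam_sq hcp hm hu
  have h3 := h.sub_le_dgfDiam_sq hcp hm hx
  linarith

include hcp hS in
lemma IsDGF.dgfDiam_pos (h : IsDGF S N α ω gradω) {x u : Vec n} (hx : x ∈ S) (hu : u ∈ S)
    (hxu : x ≠ u) : 0 < dgfDiam S ω := by
  have h1 := h.norm_sub_sq_le hcp hS hx hu
  have hα := h.modulus_pos
  have h2 : N (u - x) ≠ 0 := fun h0 => hxu (sub_eq_zero.1 (h.norm_definite _ h0)).symm
  have h3 : 0 < N (u - x) ^ 2 := by positivity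
  have h4 : 0 < dgfDiam S ω ^ 2 := lt_of_lt_of_le (by positivity) h1
  refine lt_of_le_of_ne (Real.sqrt_nonneg _) fun h0 => ?_
  change 0 = dgfDiam S ω at h0
  rw [← h0] at h4
  simp at h4

include hcp hne hS in
/-- The regret bound of mirror descent. -/
lemma IsDGF.regret (h : IsDGF S N α ω gradω) {x ζ : ℕ → Vec n} (h0 : x 0 = mirrorMap S ω 0)
    (hstep : ∀ t, x (t + 1) = mirrorMap S ω (ζ t - gradω (x t))) {u : Vec n} (hu : u ∈ S) (k : ℕ) :
    ∑ t ∈ Finset.range k, inner ℝ (ζ t) (x t - u) ≤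
      dgfDiam S ω ^ 2 + ∑ t ∈ Finset.range k, dualNorm N (ζ t) ^ 2 / (2 * α) := by
  have hdom : ∀ t, x t ∈ subdiffDom S ω := by
    intro t
    cases t with
    | zero => rw [h0]; exact mem_subdiffDom_of_isMinOn (h.mirrorMap_spec hcp hne 0).1
                (h.mirrorMap_spec hcp hne 0).2
    | succ t => rw [hstep]; exact mem_subdiffDom_of_isMinOn (h.mirrorMap_spec hcp hne _).1
                  (h.mirrorMap_spec hcp hne _).2
  have key : ∀ k, bregDiv ω gradω (x k) u + ∑ t ∈ Finset.range k, inner ℝ (ζ t) (x t - u) ≤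
      bregDiv ω gradω (x 0) u + ∑ t ∈ Finset.range k, dualNorm N (ζ t) ^ 2 / (2 * α) := by
    intro k
    induction k with
    | zero => simp
    | succ k ih =>
      rw [Finset.sum_range_succ, Finset.sum_range_succ]
      have hs := h.bregDiv_step hS (x' := x (k + 1)) (ζ := ζ k) (hdom k) (hdom (k + 1)).1
        (by rw [hstep]; exact (h.mirrorMap_spec hcp hne _).2) hu
      rw [← neg_sub (x k) u, inner_neg_right] at hs
      linarith
  have hk := key k
  have hα := h.modulus_pos
  have h1 := h.growth hS (hdom k) hu
  have h2 : 0 ≤ α / 2 * N (u - x k) ^ 2 := by positivity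
  -- The starting point minimizes `ω`, so the gradient term has the favourable sign.
  have h3 : bregDiv ω gradω (x 0) u ≤ dgfDiam S ω ^ 2 := by
    have hspec := h.mirrorMap_spec hcp hne 0
    have hv := h.variational hS hspec.1 hspec.2 hu
    rw [← h0, zero_add] at hv
    have := h.sub_le_dgfDiam_sq hcp (hdom 0).1 hu
    unfold bregDiv
    linarith
  linarith

end DGF

/-! ### Exponential moments -/

section ExpMoments

variable {B : Type*} [MeasurableSpace B] {ν : Measure B} [IsProbabilityMeasure ν]

/-- For `|x| ≤ 1` use `exp x ≤ 1 + x + x²`; for `x ≤ -1`, `exp x ≤ 1`; for `x ≥ 1`, `x ≤ x²`. The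
linear term integrates to zero for a centred variable. -/
lemma Real.exp_le_add_exp_sq (x : ℝ) : Real.exp x ≤ x + Real.exp (x ^ 2) := by
  have h1 := Real.add_one_le_exp (x ^ 2)
  rcases le_total |x| 1 with h | h
  · have := (abs_le.1 (Real.abs_exp_sub_one_sub_id_le h)).2
    linarith
  · rcases le_abs'.1 h with h | h
    · have : Real.exp x ≤ 1 := Real.exp_le_one_iff.2 (by linarith)
      nlinarith
    · have : Real.exp x ≤ Real.exp (x ^ 2) := Real.exp_le_exp.2 (by nlinarith)
      linarith

/-- Jensen's inequality for the power `a`, made explicit: convexity of `exp` between `g - 1` and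
`0`, multiplied by `exp a`, is a pointwise bound whose integral is at most `exp a * ((1 - a) + a)`.
-/
lemma lintegral_exp_mul_le {g : B → ℝ} (hg : Measurable g)
    (h : ∫⁻ y, ENNReal.ofReal (Real.exp (g y)) ∂ν ≤ ENNReal.ofReal (Real.exp 1))
    {a : ℝ} (ha : 0 ≤ a) (ha1 : a ≤ 1) :
    ∫⁻ y, ENNReal.ofReal (Real.exp (a * g y)) ∂ν ≤ ENNReal.ofReal (Real.exp a) := by
  have hpt : ∀ y, Real.exp (a * g y) ≤
      Real.exp a * (1 - a) + Real.exp (a - 1) * a * Real.exp (g y) := by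
    intro y
    have hc := convexOn_exp.2 (Set.mem_univ (g y - 1)) (Set.mem_univ 0) ha (sub_nonneg.2 ha1)
      (by ring)
    simp only [smul_eq_mul, mul_zero, add_zero, Real.exp_zero, mul_one] at hc
    have e1 : Real.exp (a * g y) = Real.exp a * Real.exp (a * (g y - 1)) := by
      rw [← Real.exp_add]; congr 1; ring
    have e2 : Real.exp (a - 1) * Real.exp (g y) = Real.exp a * Real.exp (g y - 1) := by
      rw [← Real.exp_add, ← Real.exp_add]; congr 1; ring
    rw [e1]
    calc _ ≤ Real.exp a * (a * Real.exp (g y - 1) + (1 - a)) := by gcongr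
      _ = Real.exp a * (1 - a) + a * (Real.exp a * Real.exp (g y - 1)) := by ring
      _ = _ := by rw [← e2]; ring
  have hn : 0 ≤ Real.exp a * (1 - a) := mul_nonneg (Real.exp_pos _).le (by linarith)
  have hn' : 0 ≤ Real.exp (a - 1) * a := mul_nonneg (Real.exp_pos _).le ha
  calc ∫⁻ y, ENNReal.ofReal (Real.exp (a * g y)) ∂ν
      ≤ ∫⁻ y, (ENNReal.ofReal (Real.exp a * (1 - a)) +
          ENNReal.ofReal (Real.exp (a - 1) * a) * ENNReal.ofReal (Real.exp (g y))) ∂ν := by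
        refine lintegral_mono fun y => ?_
        rw [← ENNReal.ofReal_mul hn', ← ENNReal.ofReal_add hn (by positivity)]
        exact ENNReal.ofReal_le_ofReal (hpt y)
    _ = ENNReal.ofReal (Real.exp a * (1 - a)) +
          ENNReal.ofReal (Real.exp (a - 1) * a) * ∫⁻ y, ENNReal.ofReal (Real.exp (g y)) ∂ν := by
        rw [lintegral_add_left measurable_const, lintegral_const, measure_univ, mul_one,
          lintegral_const_mul _ (by fun_prop)]
    _ ≤ ENNReal.ofReal (Real.exp a * (1 - a)) +
          ENNReal.ofReal (Real.exp (a - 1) * a) * ENNReal.ofReal (Real.exp 1) := by gcongr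
    _ = ENNReal.ofReal (Real.exp a) := by
        rw [← ENNReal.ofReal_mul hn', ← ENNReal.ofReal_add hn (by positivity)]
        congr 1
        rw [mul_right_comm, ← Real.exp_add]
        ring_nf

omit [IsProbabilityMeasure ν] in
lemma lintegral_exp_convex_comb_le {g g' : B → ℝ} (hg : Measurable g)
    (h : ∫⁻ y, ENNReal.ofReal (Real.exp (g y)) ∂ν ≤ ENNReal.ofReal (Real.exp 1))
    (h' : ∫⁻ y, ENNReal.ofReal (Real.exp (g' y)) ∂ν ≤ ENNReal.ofReal (Real.exp 1))
    {p q : ℝ} (hp : 0 ≤ p) (hq : 0 ≤ q) (hpq : p + q = 1) :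
    ∫⁻ y, ENNReal.ofReal (Real.exp (p * g y + q * g' y)) ∂ν ≤ ENNReal.ofReal (Real.exp 1) := by
  calc ∫⁻ y, ENNReal.ofReal (Real.exp (p * g y + q * g' y)) ∂ν
      ≤ ∫⁻ y, (ENNReal.ofReal p * ENNReal.ofReal (Real.exp (g y)) +
          ENNReal.ofReal q * ENNReal.ofReal (Real.exp (g' y))) ∂ν := by
        refine lintegral_mono fun y => ?_
        rw [← ENNReal.ofReal_mul hp, ← ENNReal.ofReal_mul hq,
          ← ENNReal.ofReal_add (by positivity) (by positivity)]
        exact ENNReal.ofReal_le_ofReal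
          (convexOn_exp.2 (Set.mem_univ (g y)) (Set.mem_univ (g' y)) hp hq hpq)
    _ = ENNReal.ofReal p * ∫⁻ y, ENNReal.ofReal (Real.exp (g y)) ∂ν +
          ENNReal.ofReal q * ∫⁻ y, ENNReal.ofReal (Real.exp (g' y)) ∂ν := by
        rw [lintegral_add_left (by fun_prop), lintegral_const_mul _ (by fun_prop),
          lintegral_const_mul' _ _ ENNReal.ofReal_ne_top]
    _ ≤ ENNReal.ofReal p * ENNReal.ofReal (Real.exp 1) +
          ENNReal.ofReal q * ENNReal.ofReal (Real.exp 1) := by gcongr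
    _ = ENNReal.ofReal (Real.exp 1) := by
        rw [← add_mul, ← ENNReal.ofReal_add hp hq, hpq, ENNReal.ofReal_one, one_mul]

omit [IsProbabilityMeasure ν] in
lemma integrable_of_lintegral_exp_sq_le {Z : B → ℝ} (hZ : Measurable Z)
    (h : ∫⁻ y, ENNReal.ofReal (Real.exp (Z y ^ 2)) ∂ν ≤ ENNReal.ofReal (Real.exp 1)) :
    Integrable Z ν ∧ Integrable (fun y => Z y ^ 2) ν ∧ ∫ y, Z y ^ 2 ∂ν ≤ 1 := by
  have hI : Integrable (fun y => Real.exp (Z y ^ 2)) ν := by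
    refine ⟨by fun_prop, ?_⟩
    rw [hasFiniteIntegral_iff_ofReal (ae_of_all _ fun y => (Real.exp_pos _).le)]
    exact h.trans_lt ENNReal.ofReal_lt_top
  have hI2 : Integrable (fun y => Z y ^ 2) ν := by
    refine hI.mono (by fun_prop) (ae_of_all _ fun y => ?_)
    rw [Real.norm_of_nonneg (sq_nonneg _), Real.norm_of_nonneg (Real.exp_pos _).le]
    linarith [Real.add_one_le_exp (Z y ^ 2)]
  refine ⟨?_, hI2, ?_⟩
  · refine hI.mono (by fun_prop) (ae_of_all _ fun y => ?_)
    rw [Real.norm_of_nonneg (Real.exp_pos _).le, Real.norm_eq_abs]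
    have := Real.add_one_le_exp (Z y ^ 2)
    nlinarith [sq_abs (Z y), sq_nonneg (|Z y| - 1), abs_nonneg (Z y)]
  · have hle : ∫ y, Real.exp (Z y ^ 2) ∂ν ≤ Real.exp 1 := by
      rw [integral_eq_lintegral_of_nonneg_ae (ae_of_all _ fun y => (Real.exp_pos _).le)
        (by fun_prop)]
      exact ENNReal.toReal_le_of_le_ofReal (Real.exp_pos _).le h
    calc ∫ y, Z y ^ 2 ∂ν ≤ ∫ y, Real.exp (-1) * Real.exp (Z y ^ 2) ∂ν := by
          refine integral_mono hI2 (hI.const_mul _) fun y => ?_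
          change Z y ^ 2 ≤ Real.exp (-1) * Real.exp (Z y ^ 2)
          rw [← Real.exp_add]
          linarith [Real.add_one_le_exp (-1 + Z y ^ 2)]
      _ = Real.exp (-1) * ∫ y, Real.exp (Z y ^ 2) ∂ν := integral_const_mul _ _
      _ ≤ Real.exp (-1) * Real.exp 1 := by gcongr
      _ = 1 := by rw [← Real.exp_add]; simp

/-- Integrate `exp x ≤ x + exp (x²)` at `x = tZ`: the linear term vanishes, and the light tail
raised to the power `t² ≤ 1` bounds the rest. -/
lemma lintegral_exp_mul_le_of_integral_eq_zero {Z : B → ℝ} (hZ : Measurable Z)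
    (h0 : ∫ y, Z y ∂ν = 0)
    (h : ∫⁻ y, ENNReal.ofReal (Real.exp (Z y ^ 2)) ∂ν ≤ ENNReal.ofReal (Real.exp 1))
    {t : ℝ} (ht : t ^ 2 ≤ 1) :
    ∫⁻ y, ENNReal.ofReal (Real.exp (t * Z y)) ∂ν ≤ ENNReal.ofReal (Real.exp (t ^ 2)) := by
  have hIZ := (integrable_of_lintegral_exp_sq_le hZ h).1
  have hle := lintegral_exp_mul_le (hZ.pow_const 2) h (sq_nonneg t) ht
  have hI : Integrable (fun y => Real.exp (t ^ 2 * Z y ^ 2)) ν := by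
    refine ⟨by fun_prop, ?_⟩
    rw [hasFiniteIntegral_iff_ofReal (ae_of_all _ fun y => (Real.exp_pos _).le)]
    exact hle.trans_lt ENNReal.ofReal_lt_top
  have hpt : ∀ y, Real.exp (t * Z y) ≤ t * Z y + Real.exp (t ^ 2 * Z y ^ 2) := fun y => by
    simpa [mul_pow] using Real.exp_le_add_exp_sq (t * Z y)
  calc ∫⁻ y, ENNReal.ofReal (Real.exp (t * Z y)) ∂ν
      ≤ ∫⁻ y, ENNReal.ofReal (t * Z y + Real.exp (t ^ 2 * Z y ^ 2)) ∂ν :=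
        lintegral_mono fun y => ENNReal.ofReal_le_ofReal (hpt y)
    _ = ENNReal.ofReal (∫ y, (t * Z y + Real.exp (t ^ 2 * Z y ^ 2)) ∂ν) := by
        exact (ofReal_integral_eq_lintegral_ofReal ((hIZ.const_mul t).add hI)
          (ae_of_all _ fun y => (Real.exp_pos _).le.trans (hpt y))).symm
    _ = ENNReal.ofReal (∫ y, Real.exp (t ^ 2 * Z y ^ 2) ∂ν) := by
        rw [integral_add (hIZ.const_mul t) hI, integral_const_mul, h0, mul_zero, zero_add]
    _ = ∫⁻ y, ENNReal.ofReal (Real.exp (t ^ 2 * Z y ^ 2)) ∂ν :=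
        ofReal_integral_eq_lintegral_ofReal hI (ae_of_all _ fun y => (Real.exp_pos _).le)
    _ ≤ _ := hle

end ExpMoments

/-! ### An exponential supermartingale bound -/

/-- Samples `Y t` of law `ν`, each independent of the past `𝓕 t`. -/
structure SampleFiltration {Ω B : Type*} [mΩ : MeasurableSpace Ω] [mB : MeasurableSpace B]
    (Pr : Measure Ω) (ν : Measure B) (𝓕 : ℕ → MeasurableSpace Ω) (Y : ℕ → Ω → B) : Prop where
  le : ∀ t, 𝓕 t ≤ mΩ
  mono : Monotone 𝓕
  measurable : ∀ t, Measurable[𝓕 (t + 1)] (Y t)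
  law : ∀ t, Measure.map (Y t) Pr = ν
  indep : ∀ t, Indep (𝓕 t) (mB.comap (Y t)) Pr

section Supermartingale

variable {Ω A B : Type*} [mΩ : MeasurableSpace Ω] [MeasurableSpace A] [MeasurableSpace B]
  {Pr : Measure Ω} [IsProbabilityMeasure Pr] {ν : Measure B} {𝓕 : ℕ → MeasurableSpace Ω}
  {Y : ℕ → Ω → B}

omit [IsProbabilityMeasure Pr] in
lemma SampleFiltration.measurable_sample (hF : SampleFiltration Pr ν 𝓕 Y) (t : ℕ) :
    Measurable (Y t) := (hF.measurable t).mono (hF.le _) le_rfl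

omit [IsProbabilityMeasure Pr] in
lemma SampleFiltration.measurable_sum (hF : SampleFiltration Pr ν 𝓕 Y) {h : ℕ → Ω → A}
    (hh : ∀ t, Measurable[𝓕 t] (h t)) {g : ℕ → A → B → ℝ}
    (hg : ∀ t, Measurable (Function.uncurry (g t))) (k : ℕ) :
    Measurable[𝓕 k] (fun ω => ∑ t ∈ Finset.range k, g t (h t ω) (Y t ω)) := by
  refine Finset.measurable_fun_sum _ fun t ht => ?_
  have ht' : t + 1 ≤ k := Finset.mem_range.1 ht
  have h1 : Measurable[𝓕 k] (h t) := (hh t).mono (hF.mono (by omega)) le_rfl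
  have h2 : Measurable[𝓕 k] (Y t) := (hF.measurable t).mono (hF.mono ht') le_rfl
  exact (hg t).comp (h1.prodMk h2)

/-- The partial sum and `h k` are determined by the past, of which `Y k` is independent. The joint
law is therefore a product, and the new factor can be integrated with the past frozen, where `hb`
applies. -/
lemma SampleFiltration.lintegral_exp_sum_le (hF : SampleFiltration Pr ν 𝓕 Y) {h : ℕ → Ω → A}
    (hh : ∀ t, Measurable[𝓕 t] (h t)) {g : ℕ → A → B → ℝ}
    (hg : ∀ t, Measurable (Function.uncurry (g t))) {c : ℕ → ℝ}
    (hb : ∀ t ω, ∫⁻ y, ENNReal.ofReal (Real.exp (g t (h t ω) y)) ∂ν ≤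
      ENNReal.ofReal (Real.exp (c t))) (k : ℕ) :
    ∫⁻ ω, ENNReal.ofReal (Real.exp (∑ t ∈ Finset.range k, g t (h t ω) (Y t ω))) ∂Pr ≤
      ENNReal.ofReal (Real.exp (∑ t ∈ Finset.range k, c t)) := by
  induction k with
  | zero => simp
  | succ k ih =>
    set S : Ω → ℝ := fun ω => ∑ t ∈ Finset.range k, g t (h t ω) (Y t ω) with hS
    have hSm : Measurable[𝓕 k] S := hF.measurable_sum hh hg k
    have hpm : Measurable[𝓕 k] (fun ω => (S ω, h k ω)) := hSm.prodMk (hh k)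
    have hpm' : Measurable (fun ω => (S ω, h k ω)) := hpm.mono (hF.le k) le_rfl
    have hYm := hF.measurable_sample k
    have hν : IsProbabilityMeasure ν := by
      rw [← hF.law k]; exact Measure.isProbabilityMeasure_map hYm.aemeasurable
    have hind : IndepFun (fun ω => (S ω, h k ω)) (Y k) Pr := by
      rw [IndepFun_iff_Indep]
      exact indep_of_indep_of_le_left (hF.indep k) hpm.comap_le
    have hmap := (indepFun_iff_map_prod_eq_prod_map_map hpm'.aemeasurable hYm.aemeasurable).1 hind
    let G : (ℝ × A) × B → ENNReal := fun q =>
      ENNReal.ofReal (Real.exp q.1.1) * ENNReal.ofReal (Real.exp (g k q.1.2 q.2))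
    have hgm : Measurable (fun q : (ℝ × A) × B => g k q.1.2 q.2) :=
      (hg k).comp ((measurable_snd.comp measurable_fst).prodMk measurable_snd)
    have hG : Measurable G := by fun_prop
    calc ∫⁻ ω, ENNReal.ofReal (Real.exp (∑ t ∈ Finset.range (k + 1), g t (h t ω) (Y t ω))) ∂Pr
        = ∫⁻ ω, G ((S ω, h k ω), Y k ω) ∂Pr := by
          refine lintegral_congr fun ω => ?_
          rw [Finset.sum_range_succ, Real.exp_add, ENNReal.ofReal_mul (Real.exp_pos _).le]
      _ = ∫⁻ q, G q ∂(Measure.map (fun ω => ((S ω, h k ω), Y k ω)) Pr) :=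
          (lintegral_map hG (hpm'.prodMk hYm)).symm
      _ = ∫⁻ p, ∫⁻ y, G (p, y) ∂ν ∂(Measure.map (fun ω => (S ω, h k ω)) Pr) := by
          rw [hmap, hF.law k, lintegral_prod _ hG.aemeasurable]
      _ = ∫⁻ ω, ∫⁻ y, G ((S ω, h k ω), y) ∂ν ∂Pr :=
          lintegral_map hG.lintegral_prod_right' hpm'
      _ ≤ ∫⁻ ω, ENNReal.ofReal (Real.exp (S ω)) * ENNReal.ofReal (Real.exp (c k)) ∂Pr := by
          refine lintegral_mono fun ω => ?_
          simp only [G]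
          rw [lintegral_const_mul' _ _ ENNReal.ofReal_ne_top]
          gcongr
          exact hb k ω
      _ = (∫⁻ ω, ENNReal.ofReal (Real.exp (S ω)) ∂Pr) * ENNReal.ofReal (Real.exp (c k)) :=
          lintegral_mul_const' _ _ ENNReal.ofReal_ne_top
      _ ≤ ENNReal.ofReal (Real.exp (∑ t ∈ Finset.range k, c t)) *
            ENNReal.ofReal (Real.exp (c k)) := by gcongr
      _ = _ := by rw [← ENNReal.ofReal_mul (Real.exp_pos _).le, ← Real.exp_add,
                    Finset.sum_range_succ]

lemma SampleFiltration.measure_sum_ge_le (hF : SampleFiltration Pr ν 𝓕 Y) {h : ℕ → Ω → A}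
    (hh : ∀ t, Measurable[𝓕 t] (h t)) {g : ℕ → A → B → ℝ}
    (hg : ∀ t, Measurable (Function.uncurry (g t))) {c : ℕ → ℝ}
    (hb : ∀ t ω, ∫⁻ y, ENNReal.ofReal (Real.exp (g t (h t ω) y)) ∂ν ≤
      ENNReal.ofReal (Real.exp (c t))) (k : ℕ) (lam : ℝ) :
    Pr {ω | ∑ t ∈ Finset.range k, c t + lam ≤ ∑ t ∈ Finset.range k, g t (h t ω) (Y t ω)} ≤
      ENNReal.ofReal (Real.exp (-lam)) := by
  have hm : Measurable (fun ω => ∑ t ∈ Finset.range k, g t (h t ω) (Y t ω)) :=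
    (hF.measurable_sum hh hg k).mono (hF.le k) le_rfl
  have hpos : 0 < Real.exp (∑ t ∈ Finset.range k, c t + lam) := Real.exp_pos _
  have h1 := meas_ge_le_lintegral_div (μ := Pr)
    (f := fun ω => ENNReal.ofReal (Real.exp (∑ t ∈ Finset.range k, g t (h t ω) (Y t ω))))
    (Real.measurable_exp.comp hm).ennreal_ofReal.aemeasurable (ε := ENNReal.ofReal (Real.exp (∑ t ∈ Finset.range k, c t + lam)))
    (by simpa using hpos) ENNReal.ofReal_ne_top
  refine le_trans (measure_mono fun ω hω => ?_) (h1.trans ?_)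
  · exact ENNReal.ofReal_le_ofReal (Real.exp_le_exp.2 hω)
  · refine (ENNReal.div_le_div_right (hF.lintegral_exp_sum_le hh hg hb k) _).trans ?_
    rw [← ENNReal.ofReal_div_of_pos hpos, ← Real.exp_sub]
    refine ENNReal.ofReal_le_ofReal (Real.exp_le_exp.2 ?_)
    linarith

end Supermartingale

/-! ### The filtration of a doubly indexed family of samples -/

section DoubleFamily

variable {Ω B : Type*} [mB : MeasurableSpace B]

/-- The events determined by the samples of the rounds before `k` and by the samples
`0, …, t - 1` of round `k`. -/
abbrev pastSigma (ξ : ℕ → ℕ → Ω → B) (k t : ℕ) : MeasurableSpace Ω :=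
  ⨆ p ∈ {p : ℕ × ℕ | p.1 < k ∨ (p.1 = k ∧ p.2 < t)}, mB.comap (ξ p.1 p.2)

lemma measurable_pastSigma {ξ : ℕ → ℕ → Ω → B} {k t j s : ℕ} (h : j < k ∨ (j = k ∧ s < t)) :
    Measurable[pastSigma ξ k t] (ξ j s) := by
  refine (comap_measurable (ξ j s)).mono ?_ le_rfl
  exact le_iSup₂_of_le (f := fun (p : ℕ × ℕ)
    (_ : p ∈ {p : ℕ × ℕ | p.1 < k ∨ (p.1 = k ∧ p.2 < t)}) => mB.comap (ξ p.1 p.2))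
    (j, s) h le_rfl

lemma pastSigma_mono (ξ : ℕ → ℕ → Ω → B) {k t k' t' : ℕ} (h : k < k' ∨ (k = k' ∧ t ≤ t')) :
    pastSigma ξ k t ≤ pastSigma ξ k' t' := by
  refine iSup₂_le fun p hp => ?_
  refine le_iSup₂_of_le (f := fun (p : ℕ × ℕ)
    (_ : p ∈ {p : ℕ × ℕ | p.1 < k' ∨ (p.1 = k' ∧ p.2 < t')}) => mB.comap (ξ p.1 p.2)) p ?_ le_rfl
  simp only [Set.mem_ofPred_eq] at hp ⊢
  omega

/-- Samples are ordered lexicographically. The past of round `k` at time `0` contains all samples of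
the earlier rounds, so the level of round `k` is known when the round starts. -/
lemma sampleFiltration_pastSigma [mΩ : MeasurableSpace Ω] {Pr : Measure Ω} {ν : Measure B} {ξ : ℕ → ℕ → Ω → B}
    (hm : ∀ k t, Measurable (ξ k t)) (hlaw : ∀ k t, Measure.map (ξ k t) Pr = ν)
    (hind : iIndepFun (fun p : ℕ × ℕ => ξ p.1 p.2) Pr) (k : ℕ) :
    SampleFiltration Pr ν (pastSigma ξ k) (ξ k) where
  le t := iSup₂_le fun p _ => (hm p.1 p.2).comap_le
  mono _ _ h := pastSigma_mono ξ (Or.inr ⟨rfl, h⟩)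
  measurable t := measurable_pastSigma (Or.inr ⟨rfl, Nat.lt_succ_self t⟩)
  law t := hlaw k t
  indep t := by
    have h := indep_iSup_of_disjoint (m := fun p : ℕ × ℕ => mB.comap (ξ p.1 p.2))
      (fun p => (hm p.1 p.2).comap_le) hind.iIndep
      (S := {p : ℕ × ℕ | p.1 < k ∨ (p.1 = k ∧ p.2 < t)}) (T := {(k, t)})
      (by simp)
    rwa [iSup_singleton] at h

end DoubleFamily

/-! ### The simplex -/

section Simplex

variable {m : ℕ}

lemma single_mem_simplexSet (i : Fin (m + 1)) : EuclideanSpace.single i (1 : ℝ) ∈ simplexSet m := by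
  change (EuclideanSpace.single i (1 : ℝ)).ofLp ∈ stdSimplex ℝ (Fin (m + 1))
  simpa using single_mem_stdSimplex ℝ i

lemma simplexSet_nonempty : (simplexSet m).Nonempty := ⟨_, single_mem_simplexSet 0⟩

lemma isCompact_simplexSet : IsCompact (simplexSet m) := by
  have h : simplexSet m = WithLp.toLp 2 '' stdSimplex ℝ (Fin (m + 1)) := by
    ext y
    exact ⟨fun hy => ⟨y.ofLp, hy, rfl⟩, by rintro ⟨z, hz, rfl⟩; exact hz⟩
  rw [h]
  exact (isCompact_stdSimplex ℝ (Fin (m + 1))).image (PiLp.continuous_toLp 2 _)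

lemma convex_simplexSet : Convex ℝ (simplexSet m) := fun _ hx _ hy _ _ ha hb hab =>
  convex_stdSimplex ℝ (Fin (m + 1)) hx hy ha hb hab

lemma sum_eq_one_of_mem_simplexSet {y : Vec (m + 1)} (hy : y ∈ simplexSet m) :
    ∑ i, y i = 1 := hy.2

lemma inner_single_one (G : Vec (m + 1)) (i : Fin (m + 1)) :
    inner ℝ G (EuclideanSpace.single i (1 : ℝ)) = G i := by
  simp [EuclideanSpace.inner_single_right]

lemma inner_le_iSup_of_mem_simplexSet (G : Vec (m + 1)) {y : Vec (m + 1)} (hy : y ∈ simplexSet m) :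
    inner ℝ G y ≤ ⨆ i, G i := by
  have h : inner ℝ G y = ∑ i, y i * G i := by
    simp [PiLp.inner_apply]
  rw [h]
  calc ∑ i, y i * G i ≤ ∑ i, y i * ⨆ i, G i := by
        refine Finset.sum_le_sum fun i _ => ?_
        exact mul_le_mul_of_nonneg_left (le_ciSup (Set.finite_range _).bddAbove i) (hy.1 i)
    _ = ⨆ i, G i := by rw [← Finset.sum_mul, sum_eq_one_of_mem_simplexSet hy, one_mul]

end Simplex

/-! ### The gap function and its convexity -/

namespace SOEC

variable {d m : ℕ} {Ξ : Fin (m + 1) → Type*} [∀ i, MeasurableSpace (Ξ i)] {P : SOEC d m Ξ}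

lemma levels_zero (r : ℝ) : P.levels r 0 = r := rfl

lemma levels_succ (r : ℝ) (i : Fin m) : P.levels r i.succ = P.rhs i := rfl

lemma le_maxGap (r : ℝ) (x : Vec d) (i : Fin (m + 1)) : P.f i x - P.levels r i ≤ P.maxGap r x :=
  le_ciSup (f := fun i => P.f i x - P.levels r i) (Set.finite_range _).bddAbove i

lemma maxGap_le {r c : ℝ} {x : Vec d} (h0 : P.f 0 x - r ≤ c)
    (h : ∀ i : Fin m, P.f i.succ x - P.rhs i ≤ c) : P.maxGap r x ≤ c :=
  ciSup_le (Fin.cases h0 h)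

lemma maxGap_anti {r r' : ℝ} (h : r' ≤ r) (x : Vec d) : P.maxGap r x ≤ P.maxGap r' x :=
  maxGap_le (by linarith [P.le_maxGap r' x 0, P.levels_zero r']) fun i => by
    simpa [levels_succ] using P.le_maxGap r' x i.succ

lemma maxGap_le_add {r r' : ℝ} (h : r' ≤ r) (x : Vec d) :
    P.maxGap r' x ≤ P.maxGap r x + (r - r') :=
  maxGap_le (by linarith [P.le_maxGap r x 0, P.levels_zero r]) fun i => by
    linarith [P.le_maxGap r x i.succ, P.levels_succ r i]

lemma feasible_of_maxGap_nonpos {r : ℝ} {x : Vec d} (hx : x ∈ P.X) (h : P.maxGap r x ≤ 0) :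
    P.Feasible x ∧ P.f 0 x ≤ r := by
  refine ⟨⟨hx, fun i => ?_⟩, ?_⟩
  · linarith [P.le_maxGap r x i.succ, P.levels_succ r i]
  · linarith [P.le_maxGap r x 0, P.levels_zero r]

lemma Regular.f_convex (hR : P.Regular) (i : Fin (m + 1)) : ConvexOn ℝ P.X (P.f i) := by
  refine ⟨hR.convex, fun x hx y hy a b ha hb hab => ?_⟩
  have hz := hR.convex hx hy ha hb hab
  simp only [f, smul_eq_mul]
  rw [← integral_const_mul, ← integral_const_mul,
    ← integral_add ((hR.integrable i x hx).const_mul a) ((hR.integrable i y hy).const_mul b)]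
  exact integral_mono (hR.integrable i _ hz)
    (((hR.integrable i x hx).const_mul a).add ((hR.integrable i y hy).const_mul b))
    fun ξ => (hR.convexOn i (ξ i)).2 hx hy ha hb hab

lemma Regular.maxGap_convex_comb (hR : P.Regular) {x x' : Vec d} (hx : x ∈ P.X) (hx' : x' ∈ P.X)
    {a b : ℝ} (ha : 0 ≤ a) (hb : 0 ≤ b) (hab : a + b = 1) (r r' : ℝ) :
    P.maxGap (a * r + b * r') (a • x + b • x') ≤ a * P.maxGap r x + b * P.maxGap r' x' := by
  have key : ∀ i, P.f i (a • x + b • x') ≤ a * P.f i x + b * P.f i x' := fun i =>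
    (hR.f_convex i).2 hx hx' ha hb hab
  refine maxGap_le ?_ fun i => ?_
  · have h1 := mul_le_mul_of_nonneg_left (P.le_maxGap r x 0) ha
    have h2 := mul_le_mul_of_nonneg_left (P.le_maxGap r' x' 0) hb
    rw [levels_zero] at h1 h2
    linarith [key 0]
  · have h1 := mul_le_mul_of_nonneg_left (P.le_maxGap r x i.succ) ha
    have h2 := mul_le_mul_of_nonneg_left (P.le_maxGap r' x' i.succ) hb
    rw [levels_succ] at h1 h2
    have : P.rhs i = a * P.rhs i + b * P.rhs i := by rw [← add_mul, hab, one_mul]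
    linarith [key i.succ]

lemma Regular.measurable_f (hR : P.Regular) (i : Fin (m + 1)) : Measurable (P.f i) := by
  have := hR.prob
  have h : Measurable (Function.uncurry fun (x : Vec d) (ξ : ∀ i, Ξ i) => P.F i x (ξ i)) :=
    (hR.measurable i).comp
      (measurable_fst.prodMk ((measurable_pi_apply i).comp measurable_snd))
  exact h.stronglyMeasurable.integral_prod_right.measurable

lemma Regular.phi_eq (hR : P.Regular) (r : ℝ) {x : Vec d} (hx : x ∈ P.X) (y : Vec (m + 1)) :
    P.phi r x y = ∑ i, y i * (P.f i x - P.levels r i) := by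
  have := hR.prob
  unfold phi Phi f
  have hi : ∀ i ∈ Finset.univ,
      Integrable (fun ξ : ∀ i, Ξ i => y i * (P.F i x (ξ i) - P.levels r i)) P.law := fun i _ =>
    ((hR.integrable i x hx).sub (integrable_const _)).const_mul (y i)
  rw [integral_finsetSum _ hi]
  refine Finset.sum_congr rfl fun i _ => ?_
  rw [integral_const_mul, integral_sub (hR.integrable i x hx) (integrable_const _)]
  simp

lemma phi_le_maxGap {r : ℝ} (hR : P.Regular) {x : Vec d} (hx : x ∈ P.X) {y : Vec (m + 1)}
    (hy : y ∈ simplexSet m) : P.phi r x y ≤ P.maxGap r x := by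
  rw [hR.phi_eq r hx]
  calc _ ≤ ∑ i, y i * P.maxGap r x := Finset.sum_le_sum fun i _ =>
        mul_le_mul_of_nonneg_left (P.le_maxGap r x i) (hy.1 i)
    _ = _ := by rw [← Finset.sum_mul, sum_eq_one_of_mem_simplexSet hy, one_mul]

end SOEC

/-! ### Positive diameters, light tails, and a lower bound for the objective -/

namespace MirrorSetup

variable {d m : ℕ} {Ξ : Fin (m + 1) → Type*} [∀ i, MeasurableSpace (Ξ i)] {P : SOEC d m Ξ}
  {S : MirrorSetup P} {r0 : ℝ}

lemma ValidDGF.isCompact_X (hV : S.ValidDGF) (hR : P.Regular) : IsCompact P.X :=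
  hV.dgf_x.isCompact hR.closed hR.convex hV.bddAbove_x

/-- The strictly feasible point is not optimal, so some feasible point is better and hence
different. Positivity matters because `ωz` divides by the squared diameters. -/
lemma ValidDGF.Dx_pos (hV : S.ValidDGF) (hR : P.Regular) (hF : P.StrictlyFeasible) :
    0 < S.Dx := by
  obtain ⟨x, hx, hlt, hstar⟩ := hF
  obtain ⟨_, ⟨x', hx', rfl⟩, h⟩ := exists_lt_of_csInf_lt
    (s := P.f 0 '' {x | P.Feasible x}) ⟨_, x, ⟨hx, fun i => (hlt i).le⟩, rfl⟩ hstar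
  exact hV.dgf_x.dgfDiam_pos (hV.isCompact_X hR) hR.convex hx hx'.1
    fun e => by rw [e] at h; exact lt_irrefl _ h

lemma ValidDGF.Dy_pos (hV : S.ValidDGF) (hm : 1 ≤ m) : 0 < S.Dy := by
  refine hV.dgf_y.dgfDiam_pos isCompact_simplexSet convex_simplexSet
    (single_mem_simplexSet 0) (single_mem_simplexSet ⟨1, by omega⟩) fun e => ?_
  have := congrArg (fun v : Vec (m + 1) => v 0) e
  simp at this

lemma LightTail.Phi_sub_phi_tail (hL : S.LightTail r0) {r : ℝ} (hr : r ∈ Set.Ioc P.fstar r0)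
    {x : Vec d} (hx : x ∈ P.X) {y : Vec (m + 1)} (hy : y ∈ simplexSet m) :
    ∫⁻ ξ, ENNReal.ofReal (Real.exp (((P.Phi r x y ξ - P.phi r x y) / S.Q) ^ 2)) ∂P.law
      ≤ ENNReal.ofReal (Real.exp 1) := by
  simpa [div_pow] using hL.tail_obj r hr x hx y hy

lemma LightTail.Gy_tail (hL : S.LightTail r0) {r : ℝ} (hr : r ∈ Set.Ioc P.fstar r0)
    {x : Vec d} (hx : x ∈ P.X) :
    ∫⁻ ξ, ENNReal.ofReal (Real.exp ((dualNorm S.normY (P.Gy r x ξ) / S.My) ^ 2)) ∂P.law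
      ≤ ENNReal.ofReal (Real.exp 1) := by
  simpa [div_pow] using hL.tail_y r hr x hx

lemma LightTail.Gx_tail (hL : S.LightTail r0) {x : Vec d} (hx : x ∈ P.X) {y : Vec (m + 1)}
    (hy : y ∈ simplexSet m) :
    ∫⁻ ξ, ENNReal.ofReal (Real.exp ((dualNorm S.normX (S.Gx x y ξ) / S.Mx) ^ 2)) ∂P.law
      ≤ ENNReal.ofReal (Real.exp 1) := by
  simpa [div_pow] using hL.tail_x x hx y hy

lemma measurable_Gy_uncurry (hR : P.Regular) :
    Measurable fun q : (ℝ × Vec d) × (∀ i, Ξ i) => P.Gy q.1.1 q.1.2 q.2 := by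
  refine (WithLp.measurable_toLp 2 _).comp (measurable_pi_lambda _ fun i => ?_)
  refine Measurable.sub ?_ ?_
  · exact (hR.measurable i).comp ((measurable_snd.comp measurable_fst).prodMk
      ((measurable_pi_apply i).comp measurable_snd))
  · refine Fin.cases ?_ (fun j => ?_) i
    · exact measurable_fst.comp measurable_fst
    · exact measurable_const

lemma measurable_Gy (hR : P.Regular) (r : ℝ) (x : Vec d) : Measurable (P.Gy r x) :=
  (measurable_Gy_uncurry hR).comp (measurable_prodMk_left (x := (r, x)))

lemma LightTail.measurable_Gx_uncurry (hL : S.LightTail r0) :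
    Measurable fun q : (Vec d × Vec (m + 1)) × (∀ i, Ξ i) => S.Gx q.1.1 q.1.2 q.2 := by
  have h1 : ∀ i, Measurable fun q : (Vec d × Vec (m + 1)) × (∀ i, Ξ i) =>
      S.subgrad i q.1.1 (q.2 i) := fun i =>
    (hL.measurable_subgrad i).comp ((measurable_fst.comp measurable_fst).prodMk
      ((measurable_pi_apply i).comp measurable_snd))
  have h2 : ∀ i, Measurable fun q : (Vec d × Vec (m + 1)) × (∀ i, Ξ i) => q.1.2 i := fun i => by
    fun_prop
  exact Finset.measurable_fun_sum _ fun i _ => (h2 i).smul (h1 i)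

lemma LightTail.measurable_Gx (hL : S.LightTail r0) (x : Vec d) (y : Vec (m + 1)) :
    Measurable (S.Gx x y) :=
  hL.measurable_Gx_uncurry.comp (measurable_prodMk_left (x := (x, y)))

lemma LightTail.measurable_dualNorm_Gx_div (hL : S.LightTail r0) (hV : S.ValidDGF) (x : Vec d)
    (y : Vec (m + 1)) : Measurable fun ξ => dualNorm S.normX (S.Gx x y ξ) / S.Mx :=
  ((dualNorm_continuous hV.dgf_x.norm_definite).measurable.comp
    (hL.measurable_Gx x y)).div_const _

lemma ValidDGF.measurable_dualNorm_Gy_div (hV : S.ValidDGF) (hR : P.Regular) (r : ℝ) (x : Vec d) :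
    Measurable fun ξ => dualNorm S.normY (P.Gy r x ξ) / S.My :=
  ((dualNorm_continuous hV.dgf_y.norm_definite).measurable.comp
    (measurable_Gy hR r x)).div_const _

/-- The mean of a nonnegative variable with second moment at most one is at most one. -/
lemma integral_le_one_of_exp_sq {B : Type*} [MeasurableSpace B] {ν : Measure B}
    [IsProbabilityMeasure ν] {Z : B → ℝ} (hZ : Measurable Z)
    (h : ∫⁻ y, ENNReal.ofReal (Real.exp (Z y ^ 2)) ∂ν ≤ ENNReal.ofReal (Real.exp 1)) :
    ∫ y, Z y ∂ν ≤ 1 := by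
  obtain ⟨h1, h2, h3⟩ := integrable_of_lintegral_exp_sq_le hZ h
  have h4 : ∫ y, Z y ∂ν ≤ ∫ y, (1 / 2 * Z y ^ 2 + 1 / 2) ∂ν :=
    integral_mono h1 ((h2.const_mul _).add (integrable_const _)) fun y => by
      change Z y ≤ 1 / 2 * Z y ^ 2 + 1 / 2
      nlinarith [sq_nonneg (Z y - 1)]
  rw [integral_add (h2.const_mul _) (integrable_const _), integral_const_mul] at h4
  simp at h4
  linarith

/-- A stochastic subgradient at a single point minorizes `F₀`, and its dual norm is integrable;
taking means leaves a continuous lower bound on the compact set `X`. This makes the real infima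
defining `f*` and `H` genuine instead of default values. -/
lemma LightTail.bddBelow_f (hL : S.LightTail r0) (hV : S.ValidDGF) (hR : P.Regular) :
    BddBelow (P.f 0 '' P.X) := by
  have := hR.prob
  obtain ⟨x0, hx0⟩ := hR.nonempty
  -- At this vertex `G_x` is the subgradient of `F₀` alone, so the tail bound for `G_x` applies to
  -- it.
  have hy := single_mem_simplexSet (m := m) 0
  set g : (∀ i, Ξ i) → Vec d := fun ξ => S.Gx x0 (EuclideanSpace.single 0 1) ξ
  have hg : ∀ ξ, g ξ = S.subgrad 0 x0 (ξ 0) := by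
    intro ξ
    change ∑ i, (EuclideanSpace.single (0 : Fin (m + 1)) (1 : ℝ)) i • S.subgrad i x0 (ξ i) = _
    rw [Finset.sum_eq_single 0]
    · simp
    · intro i _ hi; simp [hi]
    · simp
  set Z : (∀ i, Ξ i) → ℝ := fun ξ => dualNorm S.normX (g ξ) / S.Mx
  have hZm : Measurable Z := hL.measurable_dualNorm_Gx_div hV x0 _
  have hZi := (integrable_of_lintegral_exp_sq_le hZm (hL.Gx_tail hx0 hy)).1
  have hcont : Continuous fun x => P.f 0 x0 - S.Mx * (∫ ξ, Z ξ ∂P.law) * S.normX (x0 - x) := by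
    have := S.normX.continuous_vec
    fun_prop
  obtain ⟨b, hb⟩ := (hV.isCompact_X hR).bddBelow_image hcont.continuousOn
  refine ⟨b, ?_⟩
  rintro _ ⟨x, hx, rfl⟩
  refine le_trans (hb ⟨x, hx, rfl⟩) ?_
  have hpt : ∀ ξ, P.F 0 x0 (ξ 0) - (S.Mx * S.normX (x0 - x)) * Z ξ ≤ P.F 0 x (ξ 0) := by
    intro ξ
    have h1 := hL.subgrad_mem 0 x0 hx0 (ξ 0) x hx
    have h2 := inner_le_dualNorm_mul hV.dgf_x.norm_definite (g ξ) (x0 - x)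
    rw [← hg ξ, ← neg_sub x0 x, inner_neg_right] at h1
    have h3 : (S.Mx * S.normX (x0 - x)) * Z ξ = dualNorm S.normX (g ξ) * S.normX (x0 - x) := by
      simp only [Z]
      have := hL.Mx_pos.ne'
      field_simp
    linarith
  have := integral_mono ((hR.integrable 0 x0 hx0).sub (hZi.const_mul _)) (hR.integrable 0 x hx) hpt
  simp only [Pi.sub_apply] at this
  rw [integral_sub (hR.integrable 0 x0 hx0) (hZi.const_mul _), integral_const_mul] at this
  change _ ≤ P.f 0 x at this
  refine le_trans (le_of_eq ?_) this
  simp only [SOEC.f]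
  ring

end MirrorSetup

/-! ### The level-set function `H` -/

namespace SOEC

variable {d m : ℕ} {Ξ : Fin (m + 1) → Type*} [∀ i, MeasurableSpace (Ξ i)] {P : SOEC d m Ξ}

lemma fstar_le (hb : BddBelow (P.f 0 '' P.X)) {x : Vec d} (hx : P.Feasible x) :
    P.fstar ≤ P.f 0 x :=
  csInf_le (hb.mono (Set.image_mono fun _ h => h.1)) ⟨x, hx, rfl⟩

lemma StrictlyFeasible.exists_feasible_lt (hF : P.StrictlyFeasible) {c : ℝ} (hc : P.fstar < c) :
    ∃ x, P.Feasible x ∧ P.f 0 x < c := by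
  obtain ⟨x, hx, hlt, -⟩ := hF
  obtain ⟨_, ⟨x', hx', rfl⟩, h⟩ := exists_lt_of_csInf_lt
    (s := P.f 0 '' {x | P.Feasible x}) ⟨_, x, ⟨hx, fun i => (hlt i).le⟩, rfl⟩ hc
  exact ⟨x', hx', h⟩

/-- A feasible point has `f₀ ≥ f*`; an infeasible point of `X` has a positive constraint gap. -/
lemma neg_le_maxGap (hb : BddBelow (P.f 0 '' P.X)) {r : ℝ} (hr : P.fstar ≤ r) {x : Vec d}
    (hx : x ∈ P.X) : -(r - P.fstar) ≤ P.maxGap r x := by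
  by_cases hf : P.Feasible x
  · linarith [P.fstar_le hb hf, P.le_maxGap r x 0, P.levels_zero r]
  · have : ∃ i : Fin m, P.rhs i < P.f i.succ x := by
      by_contra! h
      exact hf ⟨hx, h⟩
    obtain ⟨i, hi⟩ := this
    linarith [P.le_maxGap r x i.succ, P.levels_succ r i]

lemma bddBelow_maxGap (hb : BddBelow (P.f 0 '' P.X)) {r : ℝ} (hr : P.fstar ≤ r) :
    BddBelow (P.maxGap r '' P.X) := by
  refine ⟨-(r - P.fstar), ?_⟩
  rintro _ ⟨x, hx, rfl⟩
  exact P.neg_le_maxGap hb hr hx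

lemma H_le (hb : BddBelow (P.f 0 '' P.X)) {r : ℝ} (hr : P.fstar ≤ r) {x : Vec d} (hx : x ∈ P.X) :
    P.H r ≤ P.maxGap r x := csInf_le (bddBelow_maxGap hb hr) ⟨x, hx, rfl⟩

lemma Regular.exists_maxGap_lt (hR : P.Regular) {r c : ℝ} (h : P.H r < c) :
    ∃ x ∈ P.X, P.maxGap r x < c := by
  obtain ⟨_, ⟨x, hx, rfl⟩, h⟩ := exists_lt_of_csInf_lt (hR.nonempty.image _) h
  exact ⟨x, hx, h⟩

lemma Regular.le_H (hR : P.Regular) {r c : ℝ} (h : ∀ x ∈ P.X, c ≤ P.maxGap r x) : c ≤ P.H r := by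
  refine le_csInf (hR.nonempty.image _) ?_
  rintro _ ⟨x, hx, rfl⟩
  exact h x hx

lemma Regular.neg_le_H (hR : P.Regular) (hb : BddBelow (P.f 0 '' P.X)) {r : ℝ}
    (hr : P.fstar ≤ r) : -(r - P.fstar) ≤ P.H r :=
  hR.le_H fun _ hx => neg_le_maxGap hb hr hx

lemma Regular.H_le_add (hR : P.Regular) (hb : BddBelow (P.f 0 '' P.X)) {r r' : ℝ}
    (hr : P.fstar ≤ r') (h : r' ≤ r) : P.H r' ≤ P.H r + (r - r') := by
  have := hR.le_H (r := r) (c := P.H r' - (r - r')) fun x hx => by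
    linarith [H_le hb hr hx, P.maxGap_le_add h x]
  linarith

/-- The gap is jointly convex in level and point. Interpolating between a near minimizer at level
`r0` and a nearly optimal feasible point at level `f*`, where the gap is at most `η`, puts `H` below
a chord of slope `-β`, up to `η`. -/
lemma Regular.H_le_neg_beta (hR : P.Regular) (hb : BddBelow (P.f 0 '' P.X))
    (hF : P.StrictlyFeasible) {r r0 : ℝ} (h0 : P.fstar < r0) (hr : P.fstar ≤ r) (hr0 : r ≤ r0) :
    P.H r ≤ -(P.beta r0 * (r - P.fstar)) := by
  refine le_of_forall_pos_le_add fun η hη => ?_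
  obtain ⟨x1, hx1, h1⟩ := hR.exists_maxGap_lt (lt_add_of_pos_right (P.H r0) hη)
  obtain ⟨x2, hx2, h2⟩ := hF.exists_feasible_lt (lt_add_of_pos_right P.fstar hη)
  have hgap2 : P.maxGap P.fstar x2 ≤ η :=
    maxGap_le (by linarith) fun i => by linarith [hx2.2 i]
  have hd : 0 < r0 - P.fstar := sub_pos.2 h0
  set τ := (r - P.fstar) / (r0 - P.fstar) with hτ
  have hτ0 : 0 ≤ τ := div_nonneg (by linarith) hd.le
  have hτ1 : τ ≤ 1 := (div_le_one hd).2 (by linarith)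
  have hmul : τ * (r0 - P.fstar) = r - P.fstar := div_mul_cancel₀ _ hd.ne'
  have hc := hR.maxGap_convex_comb hx1 hx2.1 hτ0 (sub_nonneg.2 hτ1) (by ring) r0 P.fstar
  have hle := H_le hb hr (hR.convex hx1 hx2.1 hτ0 (sub_nonneg.2 hτ1) (by ring))
  have e : τ * r0 + (1 - τ) * P.fstar = r := by linarith
  rw [e] at hc
  have hβ : P.beta r0 * (r - P.fstar) = -(τ * P.H r0) := by
    rw [beta, hτ]
    ring
  rw [hβ]
  have h3 := mul_le_mul_of_nonneg_left h1.le hτ0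
  have h4 := mul_le_mul_of_nonneg_left hgap2 (sub_nonneg.2 hτ1)
  linarith

/-- Mixing a little of the strictly feasible point into a feasible point with `f₀ < r0` makes all
constraints strict and keeps the objective below `r0`. -/
lemma Regular.H_neg (hR : P.Regular) (hb : BddBelow (P.f 0 '' P.X)) (hF : P.StrictlyFeasible)
    {r0 : ℝ} (h0 : P.fstar < r0) : P.H r0 < 0 := by
  obtain ⟨x2, hx2, h2⟩ := hF.exists_feasible_lt h0
  obtain ⟨x1, hx1, hlt, -⟩ := hF
  set A := |P.f 0 x1 - r0|
  set B := r0 - P.f 0 x2 with hB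
  have hA : 0 ≤ A := abs_nonneg _
  have hB0 : 0 < B := sub_pos.2 h2
  -- This weight makes the objective gap of the mixture at most `τA - (1 - τ)B = -B/2`.
  set τ := B / (2 * (A + B)) with hτ
  have hτ0 : 0 < τ := by positivity
  have hmul : τ * (A + B) = B / 2 := by rw [hτ]; field_simp
  have hτ1 : τ < 1 := by
    rw [hτ, div_lt_one (by positivity)]; linarith
  have hz := hR.convex hx1 hx2.1 hτ0.le (sub_nonneg.2 hτ1.le) (by ring)
  have key : ∀ i, P.f i (τ • x1 + (1 - τ) • x2) ≤ τ * P.f i x1 + (1 - τ) * P.f i x2 := fun i =>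
    (hR.f_convex i).2 hx1 hx2.1 hτ0.le (sub_nonneg.2 hτ1.le) (by ring)
  refine lt_of_le_of_lt (H_le hb h0.le hz) ?_
  obtain ⟨i0, hi0⟩ := exists_eq_ciSup_of_finite
    (f := fun i => P.f i (τ • x1 + (1 - τ) • x2) - P.levels r0 i)
  rw [maxGap, ← hi0]
  clear hi0
  revert i0
  refine Fin.cases ?_ fun i => ?_
  · rw [levels_zero]
    have h3 : τ * (P.f 0 x1 - r0) ≤ τ * A := mul_le_mul_of_nonneg_left (le_abs_self _) hτ0.le
    have h4 : (1 - τ) * (P.f 0 x2 - r0) = -(1 - τ) * B := by rw [hB]; ring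
    nlinarith [key 0]
  · rw [levels_succ]
    have h3 : τ * (P.f i.succ x1 - P.rhs i) < 0 :=
      mul_neg_of_pos_of_neg hτ0 (sub_neg.2 (hlt i))
    have h4 : (1 - τ) * (P.f i.succ x2 - P.rhs i) ≤ 0 :=
      mul_nonpos_of_nonneg_of_nonpos (by linarith) (sub_nonpos.2 (hx2.2 i))
    linarith [key i.succ]

/-- The level is rounded down to a grid of mesh `η/2` and a near minimizer is chosen at the grid
point. Raising the level again only lowers the gap and costs at most `η/2` in `H`. Being piecewise
constant, the choice is measurable, as the random levels require. -/
lemma Regular.exists_measurable_near_minimizer (hR : P.Regular) (hb : BddBelow (P.f 0 '' P.X))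
    {η : ℝ} (hη : 0 < η) :
    ∃ xs : ℝ → Vec d, Measurable xs ∧ (∀ r, xs r ∈ P.X) ∧
      ∀ r, P.fstar ≤ r → P.maxGap r (xs r) ≤ P.H r + η := by
  have hex : ∀ j : ℤ, ∃ x ∈ P.X,
      P.maxGap (P.fstar + j * (η / 2)) x < P.H (P.fstar + j * (η / 2)) + η / 2 := fun j =>
    hR.exists_maxGap_lt (by linarith)
  choose xj hxj hgap using hex
  refine ⟨fun r => xj ⌊(r - P.fstar) / (η / 2)⌋, ?_, fun r => hxj _, fun r hr => ?_⟩
  · exact (measurable_of_countable xj).comp (Int.measurable_floor.comp (by fun_prop))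
  · set j := ⌊(r - P.fstar) / (η / 2)⌋ with hj
    have hη2 : 0 < η / 2 := by linarith
    have h1 : (j : ℝ) * (η / 2) ≤ r - P.fstar := (le_div_iff₀ hη2).1 (Int.floor_le _)
    have h2 : r - P.fstar < (j + 1) * (η / 2) := (div_lt_iff₀ hη2).1 (Int.lt_floor_add_one _)
    have h3 : (0 : ℝ) ≤ j := by
      exact_mod_cast Int.floor_nonneg.2 (div_nonneg (by linarith) hη2.le)
    have h4 : P.fstar ≤ P.fstar + j * (η / 2) := by
      have : 0 ≤ (j : ℝ) * (η / 2) := by positivity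
      linarith
    have h5 := hR.H_le_add hb h4 (r := r) (by linarith)
    have h6 := P.maxGap_anti (r := r) (r' := P.fstar + j * (η / 2)) (by linarith) (xj j)
    change P.maxGap r (xj j) ≤ P.H r + η
    linarith [hgap j]

end SOEC

/-! ### The range of levels, bounded by `M` -/

namespace MirrorSetup

variable {d m : ℕ} {Ξ : Fin (m + 1) → Type*} [∀ i, MeasurableSpace (Ξ i)] {P : SOEC d m Ξ}
  {S : MirrorSetup P} {r0 : ℝ}

lemma ValidDGF.M_sq (hV : S.ValidDGF) :
    S.M ^ 2 = 2 * S.Dx ^ 2 / S.αx * S.Mx ^ 2 + 2 * S.Dy ^ 2 / S.αy * S.My ^ 2 := by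
  have h1 := hV.dgf_x.modulus_pos
  have h2 := hV.dgf_y.modulus_pos
  rw [M, Real.sq_sqrt (by positivity)]

lemma ValidDGF.M_pos (hV : S.ValidDGF) (hL : S.LightTail r0) (hm : 1 ≤ m) : 0 < S.M := by
  have h1 := hV.dgf_x.modulus_pos
  have h2 := hV.dgf_y.modulus_pos
  have h3 := hV.Dy_pos hm
  have h4 := hL.My_pos
  exact Real.sqrt_pos.2 (by positivity)

/-- `G_y` at the levels `r` and `r0` differs only in coordinate `0`, by `r0 - r`. Pairing with a
difference `v` of two vertices and using that the dual norm of `G_y` has mean at most `M_y` at both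
levels gives `r0 - r ≤ 2 M_y ‖v‖ ≤ 4M`. Then `r` tends to `f*`, a level at which no tail bound is
assumed. -/
lemma LightTail.sub_fstar_le (hL : S.LightTail r0) (hV : S.ValidDGF) (hR : P.Regular)
    (hm : 1 ≤ m) (h0 : P.fstar < r0) : r0 - P.fstar ≤ 4 * S.M := by
  have := hR.prob
  have hM := hV.M_pos hL hm
  have hMy := hL.My_pos
  obtain ⟨x, hx⟩ := hR.nonempty
  let i1 : Fin (m + 1) := ⟨1, by omega⟩
  set v : Vec (m + 1) := EuclideanSpace.single 0 1 - EuclideanSpace.single i1 1 with hv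
  have hN : S.My * S.normY v ≤ 2 * S.M := by
    have h1 := hV.dgf_y.norm_sub_sq_le isCompact_simplexSet convex_simplexSet
      (single_mem_simplexSet i1) (single_mem_simplexSet 0)
    change S.αy / 8 * S.normY v ^ 2 ≤ S.Dy ^ 2 at h1
    have hα := hV.dgf_y.modulus_pos
    have hα' := hV.dgf_x.modulus_pos
    have h2 : S.normY v ^ 2 ≤ 4 * (2 * S.Dy ^ 2 / S.αy) := by
      have : 4 * (2 * S.Dy ^ 2 / S.αy) = 8 * S.Dy ^ 2 / S.αy := by ring
      rw [this, le_div_iff₀ hα]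
      linarith
    refine le_of_sq_le_sq ?_ (by positivity)
    rw [mul_pow, mul_pow, hV.M_sq]
    have h3 : 0 ≤ 2 * S.Dx ^ 2 / S.αx * S.Mx ^ 2 := by positivity
    have h4 := mul_le_mul_of_nonneg_left h2 (sq_nonneg S.My)
    linarith
  have key : ∀ r ∈ Set.Ioc P.fstar r0, r0 - r ≤ 4 * S.M := by
    intro r hr
    set Z : ℝ → (∀ i, Ξ i) → ℝ := fun r ξ => dualNorm S.normY (P.Gy r x ξ) / S.My with hZ
    have hZm : ∀ r, Measurable (Z r) := fun r => hV.measurable_dualNorm_Gy_div hR r x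
    have hr0 : r0 ∈ Set.Ioc P.fstar r0 := ⟨h0, le_rfl⟩
    have hI := (integrable_of_lintegral_exp_sq_le (hZm r) (hL.Gy_tail hr hx)).1
    have hI0 := (integrable_of_lintegral_exp_sq_le (hZm r0) (hL.Gy_tail hr0 hx)).1
    have hE := integral_le_one_of_exp_sq (hZm r) (hL.Gy_tail hr hx)
    have hE0 := integral_le_one_of_exp_sq (hZm r0) (hL.Gy_tail hr0 hx)
    have hpt : ∀ ξ, r0 - r ≤ (S.My * S.normY v) * (Z r ξ + Z r0 ξ) := by
      intro ξ
      have h1 := inner_le_dualNorm_mul hV.dgf_y.norm_definite (P.Gy r x ξ) v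
      have h2 := inner_le_dualNorm_mul hV.dgf_y.norm_definite (P.Gy r0 x ξ) (-v)
      rw [map_neg_eq_map, inner_neg_right] at h2
      have h3 : inner ℝ (P.Gy r x ξ) v - inner ℝ (P.Gy r0 x ξ) v = r0 - r := by
        have hi : i1 = Fin.succ ⟨0, by omega⟩ := rfl
        rw [hv, inner_sub_right, inner_sub_right, inner_single_one, inner_single_one,
          inner_single_one, inner_single_one]
        simp only [SOEC.Gy, SOEC.levels_zero]
        rw [hi, SOEC.levels_succ, SOEC.levels_succ]
        ring
      have h4 : (S.My * S.normY v) * (Z r ξ + Z r0 ξ) = dualNorm S.normY (P.Gy r x ξ) * S.normY v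
          + dualNorm S.normY (P.Gy r0 x ξ) * S.normY v := by
        simp only [hZ]
        field_simp
      linarith
    have := integral_mono (integrable_const (r0 - r)) ((hI.add hI0).const_mul _) hpt
    rw [integral_const_mul] at this
    simp only [Pi.add_apply] at this
    rw [integral_add hI hI0] at this
    simp only [integral_const, probReal_univ, smul_eq_mul, one_mul] at this
    have hnn : 0 ≤ S.My * S.normY v := by positivity
    nlinarith
  have : r0 - 4 * S.M ≤ P.fstar := by
    refine le_of_forall_gt_imp_ge_of_dense fun r hr => ?_
    rcases le_total r r0 with h | h
    · linarith [key r ⟨hr, h⟩]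
    · linarith
  linarith

end MirrorSetup

/-! ### The iterates of mirror descent in terms of mirror maps -/

/-- The objective is separable, so each component of a minimizer minimizes its own term; strong
convexity makes these minimizers unique. -/
lemma IsDGF.argminOn_prod {d n : ℕ} {X : Set (Vec d)} {Y : Set (Vec n)} {N : Seminorm ℝ (Vec d)}
    {N' : Seminorm ℝ (Vec n)} {α α' : ℝ} {ω : Vec d → ℝ} {ω' : Vec n → ℝ} {gω : Vec d → Vec d}
    {gω' : Vec n → Vec n} (h : IsDGF X N α ω gω) (h' : IsDGF Y N' α' ω' gω')
    (hX : IsCompact X) (hXne : X.Nonempty) (hXc : Convex ℝ X)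
    (hY : IsCompact Y) (hYne : Y.Nonempty) (hYc : Convex ℝ Y)
    {a b : ℝ} (ha : 0 < a) (hb : 0 < b) (c : ℝ) (η : Vec d) (η' : Vec n) :
    argminOn (fun z : Vec d × Vec n =>
      (inner ℝ η z.1 + ω z.1) / a + (inner ℝ η' z.2 + ω' z.2) / b + c) (X ×ˢ Y) =
      (mirrorMap X ω η, mirrorMap Y ω' η') := by
  obtain ⟨hx, hxm⟩ := h.mirrorMap_spec hX hXne η
  obtain ⟨hy, hym⟩ := h'.mirrorMap_spec hY hYne η'
  obtain ⟨hz, hzm⟩ := argminOn_spec (g := fun z : Vec d × Vec n =>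
      (inner ℝ η z.1 + ω z.1) / a + (inner ℝ η' z.2 + ω' z.2) / b + c) (S := X ×ˢ Y)
    ⟨(mirrorMap X ω η, mirrorMap Y ω' η'), ⟨hx, hy⟩, fun z hz => by
      have h1 : inner ℝ η (mirrorMap X ω η) + ω (mirrorMap X ω η) ≤ inner ℝ η z.1 + ω z.1 :=
        hxm hz.1
      have h2 : inner ℝ η' (mirrorMap Y ω' η') + ω' (mirrorMap Y ω' η') ≤
        inner ℝ η' z.2 + ω' z.2 := hym hz.2
      simp only [Set.mem_ofPred_eq]
      gcongr⟩
  set z := argminOn (fun z : Vec d × Vec n =>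
      (inner ℝ η z.1 + ω z.1) / a + (inner ℝ η' z.2 + ω' z.2) / b + c) (X ×ˢ Y)
  refine Prod.ext (h.eq_mirrorMap hX hXne hXc hz.1 fun x hx => ?_)
    (h'.eq_mirrorMap hY hYne hYc hz.2 fun y hy => ?_)
  · have : (inner ℝ η z.1 + ω z.1) / a + (inner ℝ η' z.2 + ω' z.2) / b + c ≤
        (inner ℝ η x + ω x) / a + (inner ℝ η' z.2 + ω' z.2) / b + c :=
      hzm (show (x, z.2) ∈ X ×ˢ Y from ⟨hx, hz.2⟩)
    exact (div_le_div_iff_of_pos_right ha).1 (by linarith)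
  · have : (inner ℝ η z.1 + ω z.1) / a + (inner ℝ η' z.2 + ω' z.2) / b + c ≤
        (inner ℝ η z.1 + ω z.1) / a + (inner ℝ η' y + ω' y) / b + c :=
      hzm (show (z.1, y) ∈ X ×ˢ Y from ⟨hz.1, hy⟩)
    exact (div_le_div_iff_of_pos_right hb).1 (by linarith)

lemma measurable_comp_of_continuousOn {n k : ℕ} {Ω : Type*} {m0 : MeasurableSpace Ω}
    {D : Set (Vec n)} {g : Vec n → Vec k} (hg : ContinuousOn g D) {u : Ω → Vec n}
    (hu : Measurable u) (hmem : ∀ ω, u ω ∈ D) : Measurable fun ω => g (u ω) :=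
  (continuousOn_iff_continuous_domRestrict.1 hg).measurable.comp (hu.subtype_mk (h := hmem))

namespace SOEC

variable {d m : ℕ} {Ξ : Fin (m + 1) → Type*} [∀ i, MeasurableSpace (Ξ i)] {P : SOEC d m Ξ}

/-- The vector `(f₀(x) - r, f₁(x) - r₁, …, fₘ(x) - rₘ)`. -/
noncomputable def gapVec (P : SOEC d m Ξ) (r : ℝ) (x : Vec d) : Vec (m + 1) :=
  WithLp.toLp 2 fun i => P.f i x - P.levels r i

/-- The deviation `∑ᵢ yᵢ (Fᵢ(x, ξᵢ) - fᵢ(x))`. -/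
noncomputable def noise (P : SOEC d m Ξ) (x : Vec d) (y : Vec (m + 1)) (ξ : ∀ i, Ξ i) : ℝ :=
  ∑ i, y i * (P.F i x (ξ i) - P.f i x)

lemma inner_Gy (r : ℝ) (x : Vec d) (y : Vec (m + 1)) (ξ : ∀ i, Ξ i) :
    inner ℝ (P.Gy r x ξ) y = P.Phi r x y ξ := by
  simp [PiLp.inner_apply, Gy, Phi]

lemma inner_gapVec (r : ℝ) (x : Vec d) (y : Vec (m + 1)) :
    inner ℝ (P.gapVec r x) y = ∑ i, y i * (P.f i x - P.levels r i) := by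
  simp [PiLp.inner_apply, gapVec]

lemma Phi_sub_inner_gapVec (r : ℝ) (x : Vec d) (y : Vec (m + 1)) (ξ : ∀ i, Ξ i) :
    P.Phi r x y ξ - inner ℝ (P.gapVec r x) y = P.noise x y ξ := by
  rw [inner_gapVec, Phi, noise, ← Finset.sum_sub_distrib]
  exact Finset.sum_congr rfl fun i _ => by ring

lemma Regular.inner_gapVec_eq_phi (hR : P.Regular) (r : ℝ) {x : Vec d} (hx : x ∈ P.X)
    (y : Vec (m + 1)) : inner ℝ (P.gapVec r x) y = P.phi r x y := by
  rw [inner_gapVec, hR.phi_eq r hx]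

lemma Regular.integral_noise (hR : P.Regular) {x : Vec d} (hx : x ∈ P.X) (y : Vec (m + 1)) :
    ∫ ξ, P.noise x y ξ ∂P.law = 0 := by
  have := hR.prob
  have hi : ∀ i ∈ Finset.univ,
      Integrable (fun ξ : ∀ i, Ξ i => y i * (P.F i x (ξ i) - P.f i x)) P.law := fun i _ =>
    ((hR.integrable i x hx).sub (integrable_const _)).const_mul (y i)
  unfold noise
  rw [integral_finsetSum _ hi]
  refine Finset.sum_eq_zero fun i _ => ?_
  rw [integral_const_mul, integral_sub (hR.integrable i x hx) (integrable_const _)]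
  simp [f]

lemma Regular.measurable_noise_uncurry (hR : P.Regular) :
    Measurable fun q : (Vec d × Vec (m + 1)) × (∀ i, Ξ i) => P.noise q.1.1 q.1.2 q.2 := by
  have h1 : ∀ i, Measurable fun q : (Vec d × Vec (m + 1)) × (∀ i, Ξ i) =>
      P.F i q.1.1 (q.2 i) := fun i =>
    (hR.measurable i).comp ((measurable_fst.comp measurable_fst).prodMk
      ((measurable_pi_apply i).comp measurable_snd))
  have h2 : ∀ i, Measurable fun q : (Vec d × Vec (m + 1)) × (∀ i, Ξ i) => q.1.2 i := fun i => by
    fun_prop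
  have h3 : ∀ i, Measurable fun q : (Vec d × Vec (m + 1)) × (∀ i, Ξ i) => P.f i q.1.1 := fun i =>
    (hR.measurable_f i).comp (measurable_fst.comp measurable_fst)
  exact Finset.measurable_fun_sum _ fun i _ => (h2 i).mul ((h1 i).sub (h3 i))

lemma Regular.measurable_gapVec_uncurry (hR : P.Regular) :
    Measurable fun q : ℝ × Vec d => P.gapVec q.1 q.2 := by
  refine (WithLp.measurable_toLp 2 _).comp (measurable_pi_lambda _ fun i => ?_)
  refine ((hR.measurable_f i).comp measurable_snd).sub ?_
  refine Fin.cases ?_ (fun j => ?_) i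
  · exact measurable_fst
  · exact measurable_const

end SOEC

namespace MirrorSetup

variable {d m : ℕ} {Ξ : Fin (m + 1) → Type*} [∀ i, MeasurableSpace (Ξ i)] {P : SOEC d m Ξ}
  {S : MirrorSetup P} {r0 : ℝ}

/-- What the analysis of one mirror descent run needs. -/
structure Valid (S : MirrorSetup P) (r0 : ℝ) : Prop where
  regular : P.Regular
  dgf : S.ValidDGF
  tail : S.LightTail r0
  Dx_pos : 0 < S.Dx
  Dy_pos : 0 < S.Dy
  M_pos : 0 < S.M

lemma Valid.isCompact_X (h : S.Valid r0) : IsCompact P.X := h.dgf.isCompact_X h.regular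

lemma Valid.argminOn_eq (h : S.Valid r0) (c : ℝ) (η : Vec d) (η' : Vec (m + 1)) :
    argminOn (fun z : Vec d × Vec (m + 1) => (inner ℝ η z.1 + S.ωx z.1) / (2 * S.Dx ^ 2) +
      (inner ℝ η' z.2 + S.ωy z.2) / (2 * S.Dy ^ 2) + c) (P.X ×ˢ simplexSet m) =
      (mirrorMap P.X S.ωx η, mirrorMap (simplexSet m) S.ωy η') :=
  h.dgf.dgf_x.argminOn_prod h.dgf.dgf_y h.isCompact_X h.regular.nonempty h.regular.convex
    isCompact_simplexSet simplexSet_nonempty convex_simplexSet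
    (by have := h.Dx_pos; positivity) (by have := h.Dy_pos; positivity) c η η'

lemma Valid.iter_zero (h : S.Valid r0) (r : ℝ) (ξ : ℕ → ∀ i, Ξ i) :
    S.iter r ξ 0 = (mirrorMap P.X S.ωx 0, mirrorMap (simplexSet m) S.ωy 0) := by
  rw [← h.argminOn_eq 0]
  simp only [iter, inner_zero_left, zero_add, add_zero]
  rfl

/-- After expanding the divergence, the terms free of the new point form the constant `c` and the
rest separates. Clearing the denominators `2D²` puts the factor `2D²` on `ζ`. -/
lemma Valid.prox_eq (h : S.Valid r0) (z ζ : Vec d × Vec (m + 1)) :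
    S.prox z ζ = (mirrorMap P.X S.ωx ((2 * S.Dx ^ 2) • ζ.1 - S.gradωx z.1),
      mirrorMap (simplexSet m) S.ωy ((2 * S.Dy ^ 2) • ζ.2 - S.gradωy z.2)) := by
  have h1 := h.Dx_pos
  have h2 := h.Dy_pos
  rw [← h.argminOn_eq (- inner ℝ ζ.1 z.1 - inner ℝ ζ.2 z.2 - S.ωz z +
    inner ℝ (S.gradωx z.1) z.1 / (2 * S.Dx ^ 2) + inner ℝ (S.gradωy z.2) z.2 / (2 * S.Dy ^ 2))]
  unfold prox
  congr 1
  funext v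
  simp only [bregman, ωz, inner_sub_left, inner_sub_right, real_inner_smul_left]
  field_simp
  ring

lemma Valid.iter_succ (h : S.Valid r0) (r : ℝ) (ξ : ℕ → ∀ i, Ξ i) (t : ℕ) :
    S.iter r ξ (t + 1) =
      (mirrorMap P.X S.ωx ((2 * S.Dx ^ 2 * S.gamma t) • S.Gx (S.iter r ξ t).1 (S.iter r ξ t).2 (ξ t)
        - S.gradωx (S.iter r ξ t).1),
      mirrorMap (simplexSet m) S.ωy ((-(2 * S.Dy ^ 2 * S.gamma t)) • P.Gy r (S.iter r ξ t).1 (ξ t)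
        - S.gradωy (S.iter r ξ t).2)) := by
  rw [iter, h.prox_eq]
  simp only [Prod.smul_fst, Prod.smul_snd, smul_smul, smul_neg, neg_smul]

/-- The auxiliary mirror descent sequence on the simplex driven by the deviations of `G_y`. -/
noncomputable def auxIter (S : MirrorSetup P) (r : ℝ) (ξ : ℕ → ∀ i, Ξ i) : ℕ → Vec (m + 1)
  | 0 => mirrorMap (simplexSet m) S.ωy 0
  | t + 1 => mirrorMap (simplexSet m) S.ωy ((2 * S.Dy ^ 2 * S.gamma t) •
      (P.Gy r (S.iter r ξ t).1 (ξ t) - P.gapVec r (S.iter r ξ t).1) - S.gradωy (auxIter S r ξ t))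

lemma Valid.mirrorMap_X_mem (h : S.Valid r0) (η : Vec d) :
    mirrorMap P.X S.ωx η ∈ subdiffDom P.X S.ωx := by
  have := h.dgf.dgf_x.mirrorMap_spec h.isCompact_X h.regular.nonempty η
  exact mem_subdiffDom_of_isMinOn this.1 this.2

lemma Valid.mirrorMap_Y_mem (h : S.Valid r0) (η : Vec (m + 1)) :
    mirrorMap (simplexSet m) S.ωy η ∈ subdiffDom (simplexSet m) S.ωy := by
  have := h.dgf.dgf_y.mirrorMap_spec isCompact_simplexSet simplexSet_nonempty η
  exact mem_subdiffDom_of_isMinOn this.1 this.2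

lemma Valid.iter_mem (h : S.Valid r0) (r : ℝ) (ξ : ℕ → ∀ i, Ξ i) (t : ℕ) :
    (S.iter r ξ t).1 ∈ subdiffDom P.X S.ωx ∧
      (S.iter r ξ t).2 ∈ subdiffDom (simplexSet m) S.ωy := by
  cases t with
  | zero => rw [h.iter_zero]; exact ⟨h.mirrorMap_X_mem _, h.mirrorMap_Y_mem _⟩
  | succ t => rw [h.iter_succ]; exact ⟨h.mirrorMap_X_mem _, h.mirrorMap_Y_mem _⟩

lemma Valid.auxIter_mem (h : S.Valid r0) (r : ℝ) (ξ : ℕ → ∀ i, Ξ i) (t : ℕ) :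
    S.auxIter r ξ t ∈ subdiffDom (simplexSet m) S.ωy := by
  cases t <;> exact h.mirrorMap_Y_mem _

/-- The level and the iterates that enter step `t`. -/
noncomputable def history (S : MirrorSetup P) (r : ℝ) (ξ : ℕ → ∀ i, Ξ i) (t : ℕ) :
    ℝ × Vec d × Vec (m + 1) × Vec (m + 1) :=
  (r, (S.iter r ξ t).1, (S.iter r ξ t).2, S.auxIter r ξ t)

section Measurability

variable {Ω : Type*} [mΩ : MeasurableSpace Ω] {Pr : Measure Ω} {𝓕 : ℕ → MeasurableSpace Ω}
  {Y : ℕ → Ω → ∀ i, Ξ i} {ρ : Ω → ℝ}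

lemma Valid.measurable_history (h : S.Valid r0) (hF : SampleFiltration Pr P.law 𝓕 Y)
    (hρ : Measurable[𝓕 0] ρ) (t : ℕ) :
    Measurable[𝓕 t] fun ω => S.history (ρ ω) (fun s => Y s ω) t := by
  have hcx := h.dgf.dgf_x.mirrorMap_continuous h.isCompact_X h.regular.nonempty h.regular.convex
  have hcy := h.dgf.dgf_y.mirrorMap_continuous isCompact_simplexSet simplexSet_nonempty
    convex_simplexSet
  suffices hs : Measurable[𝓕 t] (fun ω => (S.iter (ρ ω) (fun s => Y s ω) t).1) ∧
      Measurable[𝓕 t] (fun ω => (S.iter (ρ ω) (fun s => Y s ω) t).2) ∧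
      Measurable[𝓕 t] (fun ω => S.auxIter (ρ ω) (fun s => Y s ω) t) from
    (hρ.mono (hF.mono (Nat.zero_le t)) le_rfl).prodMk (hs.1.prodMk (hs.2.1.prodMk hs.2.2))
  induction t with
  | zero =>
    simp only [h.iter_zero, auxIter]
    exact ⟨measurable_const, measurable_const, measurable_const⟩
  | succ t ih =>
    have hle : 𝓕 t ≤ 𝓕 (t + 1) := hF.mono (Nat.le_succ t)
    have hx := ih.1.mono hle le_rfl
    have hy := ih.2.1.mono hle le_rfl
    have hv := ih.2.2.mono hle le_rfl
    have hρ' : Measurable[𝓕 (t + 1)] ρ := hρ.mono (hF.mono (Nat.zero_le _)) le_rfl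
    have hY := hF.measurable t
    have hgx := measurable_comp_of_continuousOn h.dgf.dgf_x.gradient_continuousOn hx
      fun ω => (h.iter_mem (ρ ω) (fun s => Y s ω) t).1
    have hgy := measurable_comp_of_continuousOn h.dgf.dgf_y.gradient_continuousOn hy
      fun ω => (h.iter_mem (ρ ω) (fun s => Y s ω) t).2
    have hgv := measurable_comp_of_continuousOn h.dgf.dgf_y.gradient_continuousOn hv
      fun ω => h.auxIter_mem (ρ ω) (fun s => Y s ω) t
    have hGx : Measurable[𝓕 (t + 1)] fun ω => S.Gx (S.iter (ρ ω) (fun s => Y s ω) t).1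
        (S.iter (ρ ω) (fun s => Y s ω) t).2 (Y t ω) :=
      h.tail.measurable_Gx_uncurry.comp ((hx.prodMk hy).prodMk hY)
    have hGy : Measurable[𝓕 (t + 1)] fun ω => P.Gy (ρ ω) (S.iter (ρ ω) (fun s => Y s ω) t).1
        (Y t ω) :=
      (measurable_Gy_uncurry h.regular).comp ((hρ'.prodMk hx).prodMk hY)
    have hgap : Measurable[𝓕 (t + 1)] fun ω =>
        P.gapVec (ρ ω) (S.iter (ρ ω) (fun s => Y s ω) t).1 :=
      h.regular.measurable_gapVec_uncurry.comp (hρ'.prodMk hx)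
    simp only [h.iter_succ, auxIter]
    refine ⟨?_, ?_, ?_⟩
    · have h1 := hGx.const_smul (2 * S.Dx ^ 2 * S.gamma t)
      have h2 := h1.sub hgx
      exact hcx.measurable.comp h2
    · have h1 := hGy.const_smul (-(2 * S.Dy ^ 2 * S.gamma t))
      have h2 := h1.sub hgy
      exact hcy.measurable.comp h2
    · have h1 := (hGy.sub hgap).const_smul (2 * S.Dy ^ 2 * S.gamma t)
      have h2 := h1.sub hgv
      exact hcy.measurable.comp h2

end Measurability

end MirrorSetup

/-- The normalized step lengths `1 / √(s + 1)`. -/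
noncomputable def stepWeight (s : ℕ) : ℝ := 1 / √((s : ℝ) + 1)

lemma stepWeight_pos (s : ℕ) : 0 < stepWeight s := by unfold stepWeight; positivity

lemma stepWeight_sq (s : ℕ) : stepWeight s ^ 2 = 1 / ((s : ℝ) + 1) := by
  rw [stepWeight, div_pow, Real.sq_sqrt (by positivity), one_pow]

lemma stepWeight_sq_le_one (s : ℕ) : stepWeight s ^ 2 ≤ 1 := by
  rw [stepWeight_sq, div_le_one (by positivity)]
  linarith [(Nat.cast_nonneg s : (0 : ℝ) ≤ s)]

lemma sqrt_le_sum_stepWeight (n : ℕ) : √(n : ℝ) ≤ ∑ s ∈ Finset.range n, stepWeight s := by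
  rcases Nat.eq_zero_or_pos n with rfl | hn
  · simp
  have hn' : (0 : ℝ) < n := by exact_mod_cast hn
  calc √(n : ℝ) = ∑ s ∈ Finset.range n, 1 / √(n : ℝ) := by
        rw [Finset.sum_const, Finset.card_range, nsmul_eq_mul, mul_one_div, Real.div_sqrt]
    _ ≤ _ := by
        refine Finset.sum_le_sum fun s hs => ?_
        have : (s : ℝ) + 1 ≤ n := by exact_mod_cast Finset.mem_range.1 hs
        exact one_div_le_one_div_of_le (by positivity) (Real.sqrt_le_sqrt this)

lemma sum_stepWeight_sq_le (n : ℕ) :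
    ∑ s ∈ Finset.range n, stepWeight s ^ 2 ≤ 1 + Real.log n := by
  have h := harmonic_le_one_add_log n
  refine le_trans (le_of_eq ?_) h
  simp [harmonic, stepWeight_sq]

lemma sum_stepWeight_pos {n : ℕ} (hn : 0 < n) : 0 < ∑ s ∈ Finset.range n, stepWeight s :=
  Finset.sum_pos (fun s _ => stepWeight_pos s) ⟨0, Finset.mem_range.2 hn⟩

/-! ### Pathwise error bounds for one run -/

namespace SOEC

variable {d m : ℕ} {Ξ : Fin (m + 1) → Type*} [∀ i, MeasurableSpace (Ξ i)] {P : SOEC d m Ξ}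

/-- This is the subgradient inequality for each realization, weighted by `y ≥ 0`. Being pathwise, it
spares a separate martingale for the noise of `G_x`. -/
lemma Phi_add_inner_Gx_le {S : MirrorSetup P} {r0 : ℝ} (hL : S.LightTail r0) {x x' : Vec d}
    (hx : x ∈ P.X) (hx' : x' ∈ P.X) {y : Vec (m + 1)} (hy : y ∈ simplexSet m) (r : ℝ)
    (ξ : ∀ i, Ξ i) : P.Phi r x y ξ + inner ℝ (S.Gx x y ξ) (x' - x) ≤ P.Phi r x' y ξ := by
  unfold Phi MirrorSetup.Gx
  rw [sum_inner, ← Finset.sum_add_distrib]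
  refine Finset.sum_le_sum fun i _ => ?_
  rw [real_inner_smul_left, ← mul_add]
  refine mul_le_mul_of_nonneg_left ?_ (hy.1 i)
  have := hL.subgrad_mem i x hx (ξ i) x' hx'
  linarith

end SOEC

namespace MirrorSetup

variable {d m : ℕ} {Ξ : Fin (m + 1) → Type*} [∀ i, MeasurableSpace (Ξ i)] {P : SOEC d m Ξ}
  {S : MirrorSetup P} {r0 : ℝ}

lemma gamma_eq (S : MirrorSetup P) (s : ℕ) : S.gamma s = stepWeight s / S.M := by
  rw [gamma, stepWeight, mul_comm, div_div]

/-- The normalized squared dual norm of `(G_x, G_y)`. -/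
noncomputable def sqNorm (S : MirrorSetup P) (r : ℝ) (x : Vec d) (y : Vec (m + 1))
    (ξ : ∀ i, Ξ i) : ℝ :=
  (2 * S.Dx ^ 2 / S.αx * dualNorm S.normX (S.Gx x y ξ) ^ 2 +
    2 * S.Dy ^ 2 / S.αy * dualNorm S.normY (P.Gy r x ξ) ^ 2) / S.M ^ 2

lemma Valid.regret_iter (h : S.Valid r0) (r : ℝ) (ξ : ℕ → ∀ i, Ξ i) (n : ℕ) {x : Vec d}
    (hx : x ∈ P.X) {y : Vec (m + 1)} (hy : y ∈ simplexSet m) :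
    ∑ s ∈ Finset.range n, stepWeight s *
      (inner ℝ (S.Gx (S.iter r ξ s).1 (S.iter r ξ s).2 (ξ s)) ((S.iter r ξ s).1 - x) -
        inner ℝ (P.Gy r (S.iter r ξ s).1 (ξ s)) ((S.iter r ξ s).2 - y)) ≤
      S.M + S.M / 2 * ∑ s ∈ Finset.range n, stepWeight s ^ 2 *
        S.sqNorm r (S.iter r ξ s).1 (S.iter r ξ s).2 (ξ s) := by
  have hM := h.M_pos
  have hDx := h.Dx_pos
  have hDy := h.Dy_pos
  have hαx := h.dgf.dgf_x.modulus_pos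
  have hαy := h.dgf.dgf_y.modulus_pos
  set gx : ℕ → Vec d := fun s => S.Gx (S.iter r ξ s).1 (S.iter r ξ s).2 (ξ s) with hgx
  set gy : ℕ → Vec (m + 1) := fun s => P.Gy r (S.iter r ξ s).1 (ξ s) with hgy
  have Rx := h.dgf.dgf_x.regret h.isCompact_X h.regular.nonempty h.regular.convex
    (x := fun s => (S.iter r ξ s).1) (ζ := fun s => (2 * S.Dx ^ 2 * S.gamma s) • gx s)
    (by simp only [h.iter_zero]) (fun t => by simp only [h.iter_succ, hgx]) hx n
  have Ry := h.dgf.dgf_y.regret isCompact_simplexSet simplexSet_nonempty convex_simplexSet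
    (x := fun s => (S.iter r ξ s).2) (ζ := fun s => (-(2 * S.Dy ^ 2 * S.gamma s)) • gy s)
    (by simp only [h.iter_zero]) (fun t => by simp only [h.iter_succ, hgy]) hy n
  change _ ≤ S.Dx ^ 2 + _ at Rx
  change _ ≤ S.Dy ^ 2 + _ at Ry
  have Rx' : ∑ s ∈ Finset.range n, stepWeight s * inner ℝ (gx s) ((S.iter r ξ s).1 - x) ≤
      S.M / 2 + ∑ s ∈ Finset.range n, S.M / 2 * (stepWeight s ^ 2 *
        ((2 * S.Dx ^ 2 / S.αx * dualNorm S.normX (gx s) ^ 2) / S.M ^ 2)) := by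
    have h1 : ∑ s ∈ Finset.range n, dualNorm S.normX ((2 * S.Dx ^ 2 * S.gamma s) • gx s) ^ 2 /
        (2 * S.αx) ≤ ∑ s ∈ Finset.range n, (2 * S.Dx ^ 2 * S.gamma s) ^ 2 *
          dualNorm S.normX (gx s) ^ 2 / (2 * S.αx) := by
      refine Finset.sum_le_sum fun s _ => ?_
      gcongr
      exact dualNorm_smul_sq_le h.dgf.dgf_x.norm_definite _ _
    -- The mirror steps carry `2 D_x² γ_s = 2 D_x² w_s / M`; this multiplier leaves the bare weight
    -- `w_s` and turns `D_x²` into `M/2`.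
    have h2 := mul_le_mul_of_nonneg_left (Rx.trans (add_le_add_right h1 _))
      (show 0 ≤ S.M / (2 * S.Dx ^ 2) by positivity)
    rw [mul_add, Finset.mul_sum, Finset.mul_sum] at h2
    refine le_trans (le_of_eq ?_) (h2.trans (le_of_eq ?_))
    · refine Finset.sum_congr rfl fun s _ => ?_
      rw [real_inner_smul_left, gamma_eq]
      field_simp
    · congr 1
      · field_simp
      · refine Finset.sum_congr rfl fun s _ => ?_
        rw [gamma_eq]
        field_simp
  have Ry' : ∑ s ∈ Finset.range n, stepWeight s * -inner ℝ (gy s) ((S.iter r ξ s).2 - y) ≤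
      S.M / 2 + ∑ s ∈ Finset.range n, S.M / 2 * (stepWeight s ^ 2 *
        ((2 * S.Dy ^ 2 / S.αy * dualNorm S.normY (gy s) ^ 2) / S.M ^ 2)) := by
    have h1 : ∑ s ∈ Finset.range n, dualNorm S.normY ((-(2 * S.Dy ^ 2 * S.gamma s)) • gy s) ^ 2 /
        (2 * S.αy) ≤ ∑ s ∈ Finset.range n, (-(2 * S.Dy ^ 2 * S.gamma s)) ^ 2 *
          dualNorm S.normY (gy s) ^ 2 / (2 * S.αy) := by
      refine Finset.sum_le_sum fun s _ => ?_
      gcongr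
      exact dualNorm_smul_sq_le h.dgf.dgf_y.norm_definite _ _
    have h2 := mul_le_mul_of_nonneg_left (Ry.trans (add_le_add_right h1 _))
      (show 0 ≤ S.M / (2 * S.Dy ^ 2) by positivity)
    rw [mul_add, Finset.mul_sum, Finset.mul_sum] at h2
    refine le_trans (le_of_eq ?_) (h2.trans (le_of_eq ?_))
    · refine Finset.sum_congr rfl fun s _ => ?_
      rw [real_inner_smul_left, gamma_eq]
      field_simp
    · congr 1
      · field_simp
      · refine Finset.sum_congr rfl fun s _ => ?_
        rw [gamma_eq]
        field_simp
  calc _ = ∑ s ∈ Finset.range n, stepWeight s * inner ℝ (gx s) ((S.iter r ξ s).1 - x) +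
        ∑ s ∈ Finset.range n, stepWeight s * -inner ℝ (gy s) ((S.iter r ξ s).2 - y) := by
        rw [← Finset.sum_add_distrib]
        exact Finset.sum_congr rfl fun s _ => by ring
    _ ≤ _ := add_le_add Rx' Ry'
    _ = _ := by
        rw [Finset.mul_sum, add_add_add_comm, ← Finset.sum_add_distrib, add_halves]
        congr 1
        refine Finset.sum_congr rfl fun s _ => ?_
        simp only [sqNorm, hgx, hgy]
        ring

/-- Jensen: `gapVec` is the mean of `G_y`, whose dual norm has mean at most `M_y`. -/
lemma Valid.dualNorm_neg_gapVec_le (h : S.Valid r0) {r : ℝ} (hr : r ∈ Set.Ioc P.fstar r0)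
    {x : Vec d} (hx : x ∈ P.X) : dualNorm S.normY (-P.gapVec r x) ≤ S.My := by
  have := h.regular.prob
  have hMy := h.tail.My_pos
  refine dualNorm_le fun v hv => ?_
  have hZm := h.dgf.measurable_dualNorm_Gy_div h.regular r x
  have hI := (integrable_of_lintegral_exp_sq_le hZm (h.tail.Gy_tail hr hx)).1
  have hE := integral_le_one_of_exp_sq hZm (h.tail.Gy_tail hr hx)
  rw [inner_neg_left, ← inner_neg_right, h.regular.inner_gapVec_eq_phi r hx]
  have hpt : ∀ ξ, P.Phi r x (-v) ξ ≤ S.My * (dualNorm S.normY (P.Gy r x ξ) / S.My) := by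
    intro ξ
    rw [mul_div_cancel₀ _ hMy.ne', ← SOEC.inner_Gy]
    exact inner_le_dualNorm h.dgf.dgf_y.norm_definite _ (by rwa [map_neg_eq_map])
  have hPhi : Integrable (P.Phi r x (-v)) P.law := by
    unfold SOEC.Phi
    exact integrable_finsetSum _ fun i _ =>
      ((h.regular.integrable i x hx).sub (integrable_const _)).const_mul _
  calc P.phi r x (-v) ≤ ∫ ξ, S.My * (dualNorm S.normY (P.Gy r x ξ) / S.My) ∂P.law :=
        integral_mono hPhi (hI.const_mul _) hpt
    _ = S.My * ∫ ξ, dualNorm S.normY (P.Gy r x ξ) / S.My ∂P.law := integral_const_mul _ _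
    _ ≤ S.My := mul_le_of_le_one_right hMy.le hE

/-- Regret of the fictitious sequence, valid for all `y` simultaneously. The squared norm of the
noise is at most `2‖G_y‖² + 2M_y²`, which after normalization gives `sqNorm + 1`. -/
lemma Valid.regret_aux (h : S.Valid r0) {r : ℝ} (hr : r ∈ Set.Ioc P.fstar r0)
    (ξ : ℕ → ∀ i, Ξ i) (n : ℕ) {y : Vec (m + 1)} (hy : y ∈ simplexSet m) :
    ∑ s ∈ Finset.range n, stepWeight s *
      inner ℝ (P.Gy r (S.iter r ξ s).1 (ξ s) - P.gapVec r (S.iter r ξ s).1)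
        (S.auxIter r ξ s - y) ≤
      S.M / 2 + S.M * ∑ s ∈ Finset.range n, stepWeight s ^ 2 *
        (S.sqNorm r (S.iter r ξ s).1 (S.iter r ξ s).2 (ξ s) + 1) := by
  have hM := h.M_pos
  have hDx := h.Dx_pos
  have hDy := h.Dy_pos
  have hαx := h.dgf.dgf_x.modulus_pos
  have hαy := h.dgf.dgf_y.modulus_pos
  have hMy := h.tail.My_pos
  set gy : ℕ → Vec (m + 1) := fun s => P.Gy r (S.iter r ξ s).1 (ξ s) with hgy
  set gap : ℕ → Vec (m + 1) := fun s => P.gapVec r (S.iter r ξ s).1 with hgap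
  set X : ℕ → ℝ := fun s => S.sqNorm r (S.iter r ξ s).1 (S.iter r ξ s).2 (ξ s) with hX
  have R := h.dgf.dgf_y.regret isCompact_simplexSet simplexSet_nonempty convex_simplexSet
    (x := S.auxIter r ξ) (ζ := fun s => (2 * S.Dy ^ 2 * S.gamma s) • (gy s - gap s))
    rfl (fun t => rfl) hy n
  change _ ≤ S.Dy ^ 2 + _ at R
  have hterm : ∀ s, dualNorm S.normY ((2 * S.Dy ^ 2 * S.gamma s) • (gy s - gap s)) ^ 2 /
      (2 * S.αy) ≤ 2 * S.Dy ^ 2 * (stepWeight s ^ 2 * (X s + 1)) := by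
    intro s
    have h1 := dualNorm_smul_sq_le h.dgf.dgf_y.norm_definite (2 * S.Dy ^ 2 * S.gamma s)
      (gy s - gap s)
    have h2 : dualNorm S.normY (gy s - gap s) ≤ dualNorm S.normY (gy s) + S.My := by
      rw [sub_eq_add_neg]
      refine (dualNorm_add_le h.dgf.dgf_y.norm_definite _ _).trans ?_
      gcongr
      exact h.dualNorm_neg_gapVec_le hr (h.iter_mem r ξ s).1.1
    have h3 : dualNorm S.normY (gy s - gap s) ^ 2 ≤
        2 * dualNorm S.normY (gy s) ^ 2 + 2 * S.My ^ 2 := by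
      have := pow_le_pow_left₀ (dualNorm_nonneg h.dgf.dgf_y.norm_definite _) h2 2
      nlinarith [sq_nonneg (dualNorm S.normY (gy s) - S.My)]
    have h4 : 2 * S.Dy ^ 2 / S.αy * dualNorm S.normY (gy s) ^ 2 ≤ S.M ^ 2 * X s := by
      have e : S.M ^ 2 * X s = 2 * S.Dx ^ 2 / S.αx *
          dualNorm S.normX (S.Gx (S.iter r ξ s).1 (S.iter r ξ s).2 (ξ s)) ^ 2 +
          2 * S.Dy ^ 2 / S.αy * dualNorm S.normY (gy s) ^ 2 := by
        simp only [hX, sqNorm, hgy]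
        field_simp
      rw [e]
      have : 0 ≤ 2 * S.Dx ^ 2 / S.αx *
          dualNorm S.normX (S.Gx (S.iter r ξ s).1 (S.iter r ξ s).2 (ξ s)) ^ 2 := by positivity
      linarith
    have h5 : 2 * S.Dy ^ 2 / S.αy * S.My ^ 2 ≤ S.M ^ 2 := by
      rw [h.dgf.M_sq]
      have : 0 ≤ 2 * S.Dx ^ 2 / S.αx * S.Mx ^ 2 := by positivity
      linarith
    have h6 : dualNorm S.normY ((2 * S.Dy ^ 2 * S.gamma s) • (gy s - gap s)) ^ 2 ≤
        (2 * S.Dy ^ 2 * S.gamma s) ^ 2 *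
          (2 * dualNorm S.normY (gy s) ^ 2 + 2 * S.My ^ 2) := h1.trans (by gcongr)
    have h7 : (2 * S.Dy ^ 2 * S.gamma s) ^ 2 *
          (2 * dualNorm S.normY (gy s) ^ 2 + 2 * S.My ^ 2) / (2 * S.αy) =
        2 * S.Dy ^ 2 * S.gamma s ^ 2 * (2 * S.Dy ^ 2 / S.αy * dualNorm S.normY (gy s) ^ 2 +
          2 * S.Dy ^ 2 / S.αy * S.My ^ 2) := by
      field_simp
    calc _ ≤ (2 * S.Dy ^ 2 * S.gamma s) ^ 2 *
          (2 * dualNorm S.normY (gy s) ^ 2 + 2 * S.My ^ 2) / (2 * S.αy) := by gcongr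
      _ ≤ 2 * S.Dy ^ 2 * S.gamma s ^ 2 * (S.M ^ 2 * X s + S.M ^ 2) := by
          rw [h7]; gcongr
      _ = _ := by rw [gamma_eq]; field_simp
  have h2 := mul_le_mul_of_nonneg_left
    (R.trans (add_le_add_right (Finset.sum_le_sum fun s _ => hterm s) _))
    (show 0 ≤ S.M / (2 * S.Dy ^ 2) by positivity)
  rw [mul_add, Finset.mul_sum, Finset.mul_sum] at h2
  refine le_trans (le_of_eq ?_) (h2.trans (le_of_eq ?_))
  · refine Finset.sum_congr rfl fun s _ => ?_
    rw [real_inner_smul_left, gamma_eq]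
    field_simp
    rfl
  · rw [Finset.mul_sum]
    congr 1
    · field_simp
    · refine Finset.sum_congr rfl fun s _ => ?_
      field_simp
      rfl

/-- The weighted average of `G_y` along the iterates. -/
noncomputable def avgGy (S : MirrorSetup P) (r : ℝ) (ξ : ℕ → ∀ i, Ξ i) (n : ℕ) : Vec (m + 1) :=
  (∑ s ∈ Finset.range n, stepWeight s)⁻¹ •
    ∑ s ∈ Finset.range n, stepWeight s • P.Gy r (S.iter r ξ s).1 (ξ s)

lemma inner_avgGy (r : ℝ) (ξ : ℕ → ∀ i, Ξ i) {n : ℕ} (hn : 0 < n) (y : Vec (m + 1)) :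
    (∑ s ∈ Finset.range n, stepWeight s) * inner ℝ (S.avgGy r ξ n) y =
      ∑ s ∈ Finset.range n, stepWeight s * inner ℝ (P.Gy r (S.iter r ξ s).1 (ξ s)) y := by
  rw [avgGy, real_inner_smul_left, mul_inv_cancel_left₀ (sum_stepWeight_pos hn).ne', sum_inner]
  exact Finset.sum_congr rfl fun s _ => real_inner_smul_left _ _ _

/-- Since `⟨G_y, y_s⟩ = Φ`, the terms with `y_s` cancel. What remains is linear in `y`, hence
maximal at a vertex. -/
lemma uhat_eq (hM : 0 < S.M) (r : ℝ) (ξ : ℕ → ∀ i, Ξ i) (t : ℕ) :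
    S.uhat r ξ t = ⨆ i, S.avgGy r ξ (t + 1) i := by
  have hW := sum_stepWeight_pos (Nat.succ_pos t)
  have hγ : ∑ s ∈ Finset.range (t + 1), S.gamma s =
      (∑ s ∈ Finset.range (t + 1), stepWeight s) / S.M := by
    rw [Finset.sum_div]
    exact Finset.sum_congr rfl fun s _ => gamma_eq S s
  have hfun : ∀ y : Vec (m + 1), (∑ s ∈ Finset.range (t + 1), S.gamma s)⁻¹ *
      ∑ s ∈ Finset.range (t + 1), S.gamma s *
        (P.Phi r (S.iter r ξ s).1 (S.iter r ξ s).2 (ξ s)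
          + inner ℝ (P.Gy r (S.iter r ξ s).1 (ξ s)) (y - (S.iter r ξ s).2)) =
      inner ℝ (S.avgGy r ξ (t + 1)) y := by
    intro y
    have h1 := inner_avgGy (S := S) r ξ (Nat.succ_pos t) y
    have h2 : ∑ s ∈ Finset.range (t + 1), S.gamma s *
        (P.Phi r (S.iter r ξ s).1 (S.iter r ξ s).2 (ξ s)
          + inner ℝ (P.Gy r (S.iter r ξ s).1 (ξ s)) (y - (S.iter r ξ s).2)) =
        (∑ s ∈ Finset.range (t + 1), stepWeight s *
          inner ℝ (P.Gy r (S.iter r ξ s).1 (ξ s)) y) / S.M := by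
      rw [Finset.sum_div]
      refine Finset.sum_congr rfl fun s _ => ?_
      rw [inner_sub_right, SOEC.inner_Gy, SOEC.inner_Gy, gamma_eq]
      ring
    rw [h2, hγ, ← h1]
    field_simp
  unfold uhat
  simp only [hfun]
  refine le_antisymm (csSup_le (simplexSet_nonempty.image _) ?_) (ciSup_le fun i => ?_)
  · rintro _ ⟨y, hy, rfl⟩
    exact inner_le_iSup_of_mem_simplexSet _ hy
  · refine le_csSup ⟨⨆ i, S.avgGy r ξ (t + 1) i, ?_⟩
      ⟨_, single_mem_simplexSet i, inner_single_one _ i⟩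
    rintro _ ⟨y, hy, rfl⟩
    exact inner_le_iSup_of_mem_simplexSet _ hy

lemma xbar_eq (hM : 0 < S.M) (r : ℝ) (ξ : ℕ → ∀ i, Ξ i) (t : ℕ) :
    S.xbar r ξ t = (∑ s ∈ Finset.range (t + 1), stepWeight s)⁻¹ •
      ∑ s ∈ Finset.range (t + 1), stepWeight s • (S.iter r ξ s).1 := by
  have h1 : ∀ s, S.gamma s = S.M⁻¹ * stepWeight s := fun s => by rw [gamma_eq]; ring
  unfold xbar
  simp only [h1, mul_smul, ← Finset.smul_sum, ← Finset.mul_sum]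
  rw [smul_smul, mul_inv, inv_inv]
  congr 1
  field_simp

lemma Valid.xbar_mem (h : S.Valid r0) (r : ℝ) (ξ : ℕ → ∀ i, Ξ i) (t : ℕ) :
    S.xbar r ξ t ∈ P.X := by
  rw [xbar_eq h.M_pos]
  exact h.regular.convex.centerMass_mem (fun s _ => (stepWeight_pos s).le)
    (sum_stepWeight_pos (Nat.succ_pos t)) fun s _ => (h.iter_mem r ξ s).1.1

lemma Valid.mul_f_xbar_le (h : S.Valid r0) (r : ℝ) (ξ : ℕ → ∀ i, Ξ i) (t : ℕ) (i : Fin (m + 1)) :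
    (∑ s ∈ Finset.range (t + 1), stepWeight s) * (P.f i (S.xbar r ξ t) - P.levels r i) ≤
      ∑ s ∈ Finset.range (t + 1), stepWeight s *
        inner ℝ (P.gapVec r (S.iter r ξ s).1) (EuclideanSpace.single i 1) := by
  have hW := sum_stepWeight_pos (Nat.succ_pos t)
  have h1 := (h.regular.f_convex i).map_centerMass_le (t := Finset.range (t + 1))
    (w := stepWeight) (p := fun s => (S.iter r ξ s).1) (fun s _ => (stepWeight_pos s).le) hW
    fun s _ => (h.iter_mem r ξ s).1.1
  rw [Finset.centerMass, ← xbar_eq h.M_pos, Finset.centerMass, smul_eq_mul,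
    ← div_eq_inv_mul, le_div_iff₀ hW] at h1
  simp only [inner_single_one, SOEC.gapVec, mul_sub, Finset.sum_sub_distrib, ← Finset.sum_mul]
  simp only [Function.comp, smul_eq_mul] at h1
  linarith

/-- A bound for the errors of a run, up to the normalization by the total weight. -/
noncomputable def errBound (S : MirrorSetup P) (n : ℕ) (lam : ℝ) : ℝ :=
  (S.Q + 2 * S.M) * (∑ s ∈ Finset.range n, stepWeight s ^ 2 + lam) + S.M

/-- The regret is taken against `x` and a vertex. Replacing `Φ` at the iterate by `Φ` at `x` leaves
a mean of at most the gap at `x`, plus the noise at `(x, y_s)`, which `h1` bounds; `h2` bounds the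
regret. -/
lemma Valid.uhat_le (h : S.Valid r0) (r : ℝ) (ξ : ℕ → ∀ i, Ξ i) (t : ℕ) {lam : ℝ}
    (hlam : 0 ≤ lam) {x : Vec d} (hx : x ∈ P.X)
    (h1 : ∑ s ∈ Finset.range (t + 1), stepWeight s * (P.noise x (S.iter r ξ s).2 (ξ s) / S.Q) ≤
      ∑ s ∈ Finset.range (t + 1), stepWeight s ^ 2 + lam)
    (h2 : ∑ s ∈ Finset.range (t + 1), stepWeight s ^ 2 *
        S.sqNorm r (S.iter r ξ s).1 (S.iter r ξ s).2 (ξ s) ≤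
      ∑ s ∈ Finset.range (t + 1), stepWeight s ^ 2 + lam) :
    S.uhat r ξ t ≤ P.maxGap r x +
      S.errBound (t + 1) lam / ∑ s ∈ Finset.range (t + 1), stepWeight s := by
  have hM := h.M_pos
  have hQ := h.tail.Q_pos
  have hW := sum_stepWeight_pos (Nat.succ_pos t)
  rw [uhat_eq hM]
  refine ciSup_le fun i => ?_
  rw [← inner_single_one (S.avgGy r ξ (t + 1)) i, ← sub_le_iff_le_add', le_div_iff₀ hW, sub_mul,
    mul_comm, inner_avgGy r ξ (Nat.succ_pos t)]
  set y : Vec (m + 1) := EuclideanSpace.single i (1 : ℝ) with hy_def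
  have hy : y ∈ simplexSet m := single_mem_simplexSet i
  have hreg := h.regret_iter r ξ (t + 1) hx hy
  have hpt : ∀ s ∈ Finset.range (t + 1),
      stepWeight s * inner ℝ (P.Gy r (S.iter r ξ s).1 (ξ s)) y ≤
      stepWeight s * P.maxGap r x + S.Q * (stepWeight s *
        (P.noise x (S.iter r ξ s).2 (ξ s) / S.Q)) + stepWeight s *
      (inner ℝ (S.Gx (S.iter r ξ s).1 (S.iter r ξ s).2 (ξ s)) ((S.iter r ξ s).1 - x) -
        inner ℝ (P.Gy r (S.iter r ξ s).1 (ξ s)) ((S.iter r ξ s).2 - y)) := by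
    intro s _
    have hmem := h.iter_mem r ξ s
    have e1 := SOEC.Phi_add_inner_Gx_le h.tail hmem.1.1 hx hmem.2.1 r (ξ s)
    have e2 := P.Phi_sub_inner_gapVec r x (S.iter r ξ s).2 (ξ s)
    have e3 := SOEC.phi_le_maxGap (r := r) h.regular hx hmem.2.1
    rw [h.regular.inner_gapVec_eq_phi r hx] at e2
    have e4 : S.Q * (stepWeight s * (P.noise x (S.iter r ξ s).2 (ξ s) / S.Q)) =
      stepWeight s * P.noise x (S.iter r ξ s).2 (ξ s) := by field_simp
    rw [e4, ← mul_add, ← mul_add]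
    refine mul_le_mul_of_nonneg_left ?_ (stepWeight_pos s).le
    rw [inner_sub_right (P.Gy r _ _), SOEC.inner_Gy r _ (S.iter r ξ s).2,
      ← neg_sub x (S.iter r ξ s).1, inner_neg_right]
    linarith
  have hsum := Finset.sum_le_sum hpt
  rw [Finset.sum_add_distrib, Finset.sum_add_distrib, ← Finset.sum_mul, ← Finset.mul_sum] at hsum
  have b1 := mul_le_mul_of_nonneg_left h1 hQ.le
  have b2 := mul_le_mul_of_nonneg_left h2 (half_pos hM).le
  have b3 : 0 ≤ ∑ s ∈ Finset.range (t + 1), stepWeight s ^ 2 + lam :=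
    add_nonneg (Finset.sum_nonneg fun s _ => sq_nonneg _) hlam
  have b4 := mul_nonneg hM.le b3
  unfold errBound
  linarith

/-- At a vertex the mean gap is the observed `G_y` minus noise. The noise is tested against the
auxiliary iterate, where `h3` applies, and against its difference from the vertex, where
`regret_aux` applies. The same hypotheses serve every vertex, so no union over coordinates is
needed. -/
lemma Valid.maxGap_xbar_le (h : S.Valid r0) {r : ℝ} (hr : r ∈ Set.Ioc P.fstar r0)
    (ξ : ℕ → ∀ i, Ξ i) (t : ℕ) {lam : ℝ} (hlam : 0 ≤ lam)
    (h2 : ∑ s ∈ Finset.range (t + 1), stepWeight s ^ 2 *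
        S.sqNorm r (S.iter r ξ s).1 (S.iter r ξ s).2 (ξ s) ≤
      ∑ s ∈ Finset.range (t + 1), stepWeight s ^ 2 + lam)
    (h3 : ∑ s ∈ Finset.range (t + 1), -stepWeight s *
        (P.noise (S.iter r ξ s).1 (S.auxIter r ξ s) (ξ s) / S.Q) ≤
      ∑ s ∈ Finset.range (t + 1), stepWeight s ^ 2 + lam) :
    P.maxGap r (S.xbar r ξ t) ≤ S.uhat r ξ t +
      S.errBound (t + 1) lam / ∑ s ∈ Finset.range (t + 1), stepWeight s := by
  have hM := h.M_pos
  have hQ := h.tail.Q_pos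
  have hW := sum_stepWeight_pos (Nat.succ_pos t)
  refine ciSup_le fun i => ?_
  have hu : inner ℝ (S.avgGy r ξ (t + 1)) (EuclideanSpace.single i (1 : ℝ)) ≤ S.uhat r ξ t := by
    rw [uhat_eq hM, inner_single_one]
    exact le_ciSup (Set.finite_range fun i => S.avgGy r ξ (t + 1) i).bddAbove i
  refine le_trans ?_ (add_le_add_left hu _)
  rw [← sub_le_iff_le_add', le_div_iff₀ hW, sub_mul]
  have hJ := h.mul_f_xbar_le r ξ t i
  set y : Vec (m + 1) := EuclideanSpace.single i (1 : ℝ) with hy_def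
  have hy : y ∈ simplexSet m := single_mem_simplexSet i
  have hinner := inner_avgGy (S := S) r ξ (Nat.succ_pos t) y
  have hreg := h.regret_aux hr ξ (t + 1) hy
  have hpt : ∀ s ∈ Finset.range (t + 1),
      stepWeight s * inner ℝ (P.gapVec r (S.iter r ξ s).1) y =
      stepWeight s * inner ℝ (P.Gy r (S.iter r ξ s).1 (ξ s)) y + stepWeight s *
      inner ℝ (P.Gy r (S.iter r ξ s).1 (ξ s) - P.gapVec r (S.iter r ξ s).1)
        (S.auxIter r ξ s - y) + S.Q * (-stepWeight s *
        (P.noise (S.iter r ξ s).1 (S.auxIter r ξ s) (ξ s) / S.Q)) := by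
    intro s _
    have e2 := P.Phi_sub_inner_gapVec r (S.iter r ξ s).1 (S.auxIter r ξ s) (ξ s)
    have e4 : S.Q * (-stepWeight s * (P.noise (S.iter r ξ s).1 (S.auxIter r ξ s) (ξ s) / S.Q)) =
      -stepWeight s * P.noise (S.iter r ξ s).1 (S.auxIter r ξ s) (ξ s) := by field_simp
    rw [e4, ← e2, ← SOEC.inner_Gy]
    simp only [inner_sub_left, inner_sub_right]
    ring
  have hsum := Finset.sum_congr (rfl : Finset.range (t + 1) = _) hpt
  rw [Finset.sum_add_distrib, Finset.sum_add_distrib, ← Finset.mul_sum] at hsum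
  simp only [mul_add, mul_one, Finset.sum_add_distrib] at hreg
  have b1 := mul_le_mul_of_nonneg_left h3 hQ.le
  have b2 := mul_le_mul_of_nonneg_left h2 hM.le
  have b4 := mul_nonneg hM.le hlam
  unfold errBound
  linarith

end MirrorSetup

/-! ### Failure probability of one oracle call -/

namespace MirrorSetup

variable {d m : ℕ} {Ξ : Fin (m + 1) → Type*} [∀ i, MeasurableSpace (Ξ i)] {P : SOEC d m Ξ}
  {S : MirrorSetup P} {r0 : ℝ}

lemma Valid.lintegral_exp_noise_le (h : S.Valid r0) (h0 : P.fstar < r0) {x : Vec d}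
    (hx : x ∈ P.X) {y : Vec (m + 1)} (hy : y ∈ simplexSet m) {t : ℝ} (ht : t ^ 2 ≤ 1) :
    ∫⁻ ξ, ENNReal.ofReal (Real.exp (t * (P.noise x y ξ / S.Q))) ∂P.law ≤
      ENNReal.ofReal (Real.exp (t ^ 2)) := by
  have := h.regular.prob
  have hm : Measurable (P.noise x y) :=
    h.regular.measurable_noise_uncurry.comp (measurable_prodMk_left (x := (x, y)))
  refine lintegral_exp_mul_le_of_integral_eq_zero (hm.div_const _) ?_ ?_ ht
  · rw [integral_div, h.regular.integral_noise hx, zero_div]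
  · have := h.tail.Phi_sub_phi_tail ⟨h0, le_rfl⟩ hx hy
    simpa only [← P.Phi_sub_inner_gapVec r0, h.regular.inner_gapVec_eq_phi r0 hx] using this

lemma Valid.measurable_sqNorm_uncurry (h : S.Valid r0) :
    Measurable fun q : (ℝ × Vec d × Vec (m + 1)) × (∀ i, Ξ i) =>
      S.sqNorm q.1.1 q.1.2.1 q.1.2.2 q.2 := by
  have h1 : Measurable fun q : (ℝ × Vec d × Vec (m + 1)) × (∀ i, Ξ i) =>
      dualNorm S.normX (S.Gx q.1.2.1 q.1.2.2 q.2) :=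
    (dualNorm_continuous h.dgf.dgf_x.norm_definite).measurable.comp
      (h.tail.measurable_Gx_uncurry.comp
        ((measurable_snd.comp measurable_fst).prodMk measurable_snd))
  have h2 : Measurable fun q : (ℝ × Vec d × Vec (m + 1)) × (∀ i, Ξ i) =>
      dualNorm S.normY (P.Gy q.1.1 q.1.2.1 q.2) :=
    (dualNorm_continuous h.dgf.dgf_y.norm_definite).measurable.comp
      ((measurable_Gy_uncurry h.regular).comp
        (((measurable_fst.comp measurable_fst).prodMk
          (measurable_fst.comp (measurable_snd.comp measurable_fst))).prodMk measurable_snd))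
  exact (((h1.pow_const 2).const_mul _).add ((h2.pow_const 2).const_mul _)).div_const _

/-- By the formula for `M²`, `sqNorm` is a convex combination of the two normalized squared norms,
and convexity of `exp` passes their light tails on to it. -/
lemma Valid.lintegral_exp_sqNorm_le (h : S.Valid r0) {r : ℝ} (hr : r ∈ Set.Ioc P.fstar r0)
    {x : Vec d} (hx : x ∈ P.X) {y : Vec (m + 1)} (hy : y ∈ simplexSet m) {a : ℝ} (ha : 0 ≤ a)
    (ha1 : a ≤ 1) :
    ∫⁻ ξ, ENNReal.ofReal (Real.exp (a * S.sqNorm r x y ξ)) ∂P.law ≤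
      ENNReal.ofReal (Real.exp a) := by
  have := h.regular.prob
  have hM := h.M_pos
  have hMx := h.tail.Mx_pos
  have hMy := h.tail.My_pos
  have hαx := h.dgf.dgf_x.modulus_pos
  have hαy := h.dgf.dgf_y.modulus_pos
  set Zx : (∀ i, Ξ i) → ℝ := fun ξ => dualNorm S.normX (S.Gx x y ξ) / S.Mx with hZx
  set Zy : (∀ i, Ξ i) → ℝ := fun ξ => dualNorm S.normY (P.Gy r x ξ) / S.My with hZy
  have hZxm : Measurable Zx := h.tail.measurable_dualNorm_Gx_div h.dgf x y
  have hZym : Measurable Zy := h.dgf.measurable_dualNorm_Gy_div h.regular r x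
  have e : ∀ ξ, S.sqNorm r x y ξ = 2 * S.Dx ^ 2 / S.αx * S.Mx ^ 2 / S.M ^ 2 * Zx ξ ^ 2 +
      2 * S.Dy ^ 2 / S.αy * S.My ^ 2 / S.M ^ 2 * Zy ξ ^ 2 := by
    intro ξ
    rw [sqNorm, hZx, hZy]
    field_simp
  simp only [e]
  refine lintegral_exp_mul_le
    (((hZxm.pow_const 2).const_mul _).add ((hZym.pow_const 2).const_mul _)) ?_ ha ha1
  exact lintegral_exp_convex_comb_le (hZxm.pow_const 2) (h.tail.Gx_tail hx hy)
    (h.tail.Gy_tail hr hx) (by positivity) (by positivity)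
    (by rw [← add_div, ← h.dgf.M_sq, div_self (by positivity)])

section Call

variable {Ω : Type*} [mΩ : MeasurableSpace Ω] {Pr : Measure Ω} [IsProbabilityMeasure Pr]
  {𝓕 : ℕ → MeasurableSpace Ω} {Y : ℕ → Ω → ∀ i, Ξ i} {ρ : Ω → ℝ}

/-- The failure probability of one oracle call at a random level that is determined by the past. -/
lemma Valid.measure_call_failure_le (h : S.Valid r0) (h0 : P.fstar < r0)
    (hF : SampleFiltration Pr P.law 𝓕 Y) (hρ : Measurable[𝓕 0] ρ)
    (hρm : ∀ ω, ρ ω ∈ Set.Ioc P.fstar r0) {xs : ℝ → Vec d} (hxs : Measurable xs)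
    (hxsX : ∀ r, xs r ∈ P.X) (t : ℕ) {lam : ℝ} (hlam : 0 ≤ lam) :
    Pr {ω | ¬ (S.uhat (ρ ω) (fun s => Y s ω) t ≤ P.maxGap (ρ ω) (xs (ρ ω)) +
          S.errBound (t + 1) lam / ∑ s ∈ Finset.range (t + 1), stepWeight s ∧
        P.maxGap (ρ ω) (S.xbar (ρ ω) (fun s => Y s ω) t) ≤ S.uhat (ρ ω) (fun s => Y s ω) t +
          S.errBound (t + 1) lam / ∑ s ∈ Finset.range (t + 1), stepWeight s)} ≤
      3 * ENNReal.ofReal (Real.exp (-lam)) := by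
  have hmem := fun ω => h.iter_mem (ρ ω) (fun s => Y s ω)
  have hmem' := fun ω => h.auxIter_mem (ρ ω) (fun s => Y s ω)
  have hH := h.measurable_history hF hρ
  have hn := h.regular.measurable_noise_uncurry
  -- Three bad events: the noise at the near minimizer (`b1`), the squared norms (`b2`), and the
  -- noise at the auxiliary iterates (`b3`).
  have b1 := hF.measure_sum_ge_le hH
    (g := fun s a ξ => stepWeight s * (P.noise (xs a.1) a.2.2.1 ξ / S.Q))
    (c := fun s => stepWeight s ^ 2)
    (fun s => ((hn.comp (((hxs.comp (measurable_fst.comp measurable_fst)).prodMk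
      (measurable_fst.comp (measurable_snd.comp (measurable_snd.comp measurable_fst)))).prodMk
        measurable_snd)).div_const _).const_mul _)
    (fun s ω => h.lintegral_exp_noise_le h0 (hxsX _) (hmem ω s).2.1 (stepWeight_sq_le_one s))
    (t + 1) lam
  have b2 := hF.measure_sum_ge_le hH
    (g := fun s a ξ => stepWeight s ^ 2 * S.sqNorm a.1 a.2.1 a.2.2.1 ξ)
    (c := fun s => stepWeight s ^ 2)
    (fun s => (h.measurable_sqNorm_uncurry.comp (((measurable_fst.comp measurable_fst).prodMk
      ((measurable_fst.comp (measurable_snd.comp measurable_fst)).prodMk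
        (measurable_fst.comp (measurable_snd.comp (measurable_snd.comp measurable_fst))))).prodMk
        measurable_snd)).const_mul _)
    (fun s ω => h.lintegral_exp_sqNorm_le (hρm ω) (hmem ω s).1.1 (hmem ω s).2.1 (sq_nonneg _)
      (stepWeight_sq_le_one s))
    (t + 1) lam
  have b3 := hF.measure_sum_ge_le hH
    (g := fun s a ξ => -stepWeight s * (P.noise a.2.1 a.2.2.2 ξ / S.Q))
    (c := fun s => stepWeight s ^ 2)
    (fun s => ((hn.comp (((measurable_fst.comp (measurable_snd.comp measurable_fst)).prodMk
      (measurable_snd.comp (measurable_snd.comp (measurable_snd.comp measurable_fst)))).prodMk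
        measurable_snd)).div_const _).const_mul _)
    (fun s ω => by
      rw [← neg_sq]
      exact h.lintegral_exp_noise_le h0 (hmem ω s).1.1 (hmem' ω s).1
        (by rw [neg_sq]; exact stepWeight_sq_le_one s))
    (t + 1) lam
  refine le_trans (measure_mono ?_) (((measure_union_le _ _).trans
    (add_le_add ((measure_union_le _ _).trans (add_le_add b1 b2)) b3)).trans (le_of_eq (by ring)))
  intro ω hω
  by_contra hcon
  simp only [Set.mem_union, Set.mem_ofPred_eq, not_or, not_le, history] at hcon
  exact hω ⟨h.uhat_le (ρ ω) (fun s => Y s ω) t hlam (hxsX _) hcon.1.1.le hcon.1.2.le,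
    h.maxGap_xbar_le (hρm ω) (fun s => Y s ω) t hlam hcon.1.2.le hcon.2.le⟩

omit [IsProbabilityMeasure Pr] in
lemma Valid.measurable_uhat (h : S.Valid r0) (hF : SampleFiltration Pr P.law 𝓕 Y)
    (hρ : Measurable[𝓕 0] ρ) (t : ℕ) :
    Measurable[𝓕 (t + 1)] fun ω => S.uhat (ρ ω) (fun s => Y s ω) t := by
  simp only [uhat_eq h.M_pos]
  refine Measurable.iSup fun i => ?_
  have hs : ∀ s ∈ Finset.range (t + 1), Measurable[𝓕 (t + 1)] fun ω =>
      stepWeight s * (P.Gy (ρ ω) (S.iter (ρ ω) (fun s => Y s ω) s).1 (Y s ω)) i := by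
    intro s hs
    have hs' : s + 1 ≤ t + 1 := Finset.mem_range.1 hs
    have hH := (h.measurable_history hF hρ s).mono (hF.mono (by omega : s ≤ t + 1)) le_rfl
    have hY := (hF.measurable s).mono (hF.mono hs') le_rfl
    have hG : Measurable[𝓕 (t + 1)] fun ω =>
        P.Gy (ρ ω) (S.iter (ρ ω) (fun s => Y s ω) s).1 (Y s ω) :=
      (measurable_Gy_uncurry h.regular).comp (((measurable_fst.comp hH).prodMk
        (measurable_fst.comp (measurable_snd.comp hH))).prodMk hY)
    have he : Measurable fun v : Vec (m + 1) => v i := by fun_prop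
    exact (he.comp hG).const_mul _
  have h2 := (Finset.measurable_fun_sum _ hs).const_mul
    (∑ s ∈ Finset.range (t + 1), stepWeight s)⁻¹
  convert h2 using 2 with ω
  simp [avgGy]

end Call

end MirrorSetup

/-! ### The level-set recursion with an accurate oracle -/

/-- Three terms of the series of `-log (1 - b)` suffice: their product with `1 - b/2` exceeds `b` by
`b³(1 - 2b)/12`. The gain over `b ≤ -log (1 - b)` sharpens the count of rounds from `⌈K⌉ + 1` to
`K`. -/
lemma le_neg_log_one_sub_mul {b : ℝ} (hb : 0 < b) (hb2 : b ≤ 1 / 2) :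
    b ≤ -Real.log (1 - b) * (1 - b / 2) := by
  have hs := Real.hasSum_pow_div_log_of_abs_lt_one (x := b) (by rw [abs_of_pos hb]; linarith)
  have h := sum_le_hasSum (Finset.range 3) (fun n _ => by positivity) hs
  simp only [Finset.sum_range_succ, Finset.sum_range_zero] at h
  norm_num at h
  have h1 : (b + b ^ 2 / 2 + b ^ 3 / 3) * (1 - b / 2) ≤ -Real.log (1 - b) * (1 - b / 2) :=
    mul_le_mul_of_nonneg_right h (by linarith)
  refine le_trans ?_ h1
  have : (b + b ^ 2 / 2 + b ^ 3 / 3) * (1 - b / 2) = b + b ^ 3 / 12 * (1 - 2 * b) := by ring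
  rw [this]
  have : 0 ≤ b ^ 3 / 12 * (1 - 2 * b) := mul_nonneg (by positivity) (by linarith)
  linarith

/-- The ratio of the oracle tolerance to the stopping tolerance. -/
noncomputable def tolRatio (θ : ℝ) : ℝ := (θ - 1) / (2 * θ * (θ + 1))

section TolRatio

variable {θ : ℝ}

lemma tolRatio_pos (hθ : 1 < θ) : 0 < tolRatio θ :=
  div_pos (by linarith) (by positivity)

lemma tolRatio_mul (hθ : 1 < θ) : tolRatio θ * (2 * θ * (θ + 1)) = θ - 1 :=
  div_mul_cancel₀ _ (by positivity)

/-- In a round that does not halt, this inequality gives `-U ≤ θ(-H)` and the next one `-H ≤ θ(-U)`.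
The third leaves the margin `H ≤ -ε_A` after the level has moved. -/
lemma one_le_mul_one_sub_tolRatio (hθ : 1 < θ) : 1 ≤ θ * (1 - tolRatio θ) := by
  have h := tolRatio_mul hθ
  have h0 := tolRatio_pos hθ
  nlinarith [mul_pos h0 (by linarith : 0 < θ)]

lemma one_add_tolRatio_le (hθ : 1 < θ) : 1 + tolRatio θ ≤ θ := by
  have h := tolRatio_mul hθ
  have h0 := tolRatio_pos hθ
  nlinarith [mul_pos h0 (by linarith : 0 < θ)]

lemma two_mul_tolRatio_le (hθ : 1 < θ) : 2 * tolRatio θ ≤ 1 - 1 / (2 * θ) := by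
  have h := tolRatio_mul hθ
  have h0 := tolRatio_pos hθ
  rw [le_sub_iff_add_le, ← le_sub_iff_add_le', div_le_iff₀ (by positivity)]
  nlinarith [mul_pos h0 (by linarith : 0 < θ)]

end TolRatio

/-- Here `s` is `f*` and `h` is `H`. In a round that does not halt, `-U` and `-h` agree up to the
factor `θ`, so the level drops by at least `b = β/(2θ²)` times its distance to `s` and by at most
half of it. The distance decays geometrically, whereas not halting requires it to exceed `εopt/θ`.
-/
lemma levelSet_halts {s r0 β θ ε : ℝ} {h : ℝ → ℝ} (hs : s < r0) (hβ : 0 < β) (hβ1 : β ≤ 1)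
    (hr0 : h r0 = -(β * (r0 - s))) (hlow : ∀ r ∈ Set.Ioc s r0, -(r - s) ≤ h r)
    (hup : ∀ r ∈ Set.Ioc s r0, h r ≤ -(β * (r - s)))
    (hlip : ∀ r r', s ≤ r' → r' ≤ r → h r' ≤ h r + (r - r'))
    (hθ : 1 < θ) (hε : 0 < ε) (hε1 : ε ≤ 1) {r U : ℕ → ℝ} {εopt εA K : ℝ}
    (hεopt : εopt = β * (r0 - s) * ε / θ) (hεA : εA = tolRatio θ * εopt)
    (hK : K = 2 * θ ^ 2 / β * Real.log (θ ^ 2 / (β * ε)))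
    (hrz : r 0 = r0) (hrs : ∀ k, r (k + 1) = r k + U k / (2 * θ))
    (hgood : ∀ k ≤ ⌈K⌉₊, r k ∈ Set.Ioc s r0 → |U k - h (r k)| ≤ εA) :
    ∃ k, (-εopt ≤ U k ∧ ∀ j < k, U j < -εopt) ∧ r k ∈ Set.Ioc s r0 ∧ h (r k) ≤ -εA ∧
      r k - s ≤ ε * (r0 - s) ∧ k ≤ ⌈K⌉₊ ∧
      (Real.exp 4 ≤ θ ^ 2 / (β * ε) → ((k + 1 : ℕ) : ℝ) ≤ K) := by
  have hd0 : 0 < r0 - s := sub_pos.2 hs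
  have hθ0 : 0 < θ := by linarith
  have hopt0 : 0 < εopt := by rw [hεopt]; positivity
  set c := tolRatio θ with hc
  have c0 : 0 < c := tolRatio_pos hθ
  have c1 : 1 ≤ θ * (1 - c) := one_le_mul_one_sub_tolRatio hθ
  have c2 : 1 + c ≤ θ := one_add_tolRatio_le hθ
  have c3 : 2 * c ≤ 1 - 1 / (2 * θ) := two_mul_tolRatio_le hθ
  set b := β / (2 * θ ^ 2) with hb
  have hb0 : 0 < b := by positivity
  have hb2 : b ≤ 1 / 2 := by
    rw [hb, div_le_iff₀ (by positivity)]
    linarith [one_le_pow₀ hθ.le (n := 2)]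
  set q := θ ^ 2 / (β * ε) with hq
  have hq0 : 0 < q := by positivity
  have hKb : K * b = Real.log q := by
    rw [hK, hb]; field_simp
  have hℓb : b ≤ -Real.log (1 - b) := by
    have := Real.log_le_sub_one_of_pos (by linarith : 0 < 1 - b)
    linarith
  have step : ∀ k, r k ∈ Set.Ioc s r0 → U k < -εopt → |U k - h (r k)| ≤ εA →
      r (k + 1) ∈ Set.Ioc s r0 ∧ r (k + 1) - s ≤ (r k - s) * (1 - b) ∧ h (r (k + 1)) ≤ -εA ∧
      εopt < θ * (r k - s) := by
    intro k hk hU hg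
    obtain ⟨g1, g2⟩ := abs_le.1 hg
    have l1 := hlow _ hk
    have l2 := hup _ hk
    set u := -U k with hu
    set H := -h (r k) with hH
    set D := r k - s with hD
    have hu0 : 0 < u := by linarith
    have hεAu : εA ≤ c * u := by rw [hεA]; gcongr; linarith
    have e1 : u * (1 - c) ≤ H := by linarith
    have e2 : u ≤ θ * H := by
      have h1 := mul_le_mul_of_nonneg_left e1 hθ0.le
      have h2 := mul_le_mul_of_nonneg_left c1 hu0.le
      linarith
    have e3 : H ≤ θ * u := by
      have h1 := mul_le_mul_of_nonneg_left c2 hu0.le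
      linarith
    have e4 : H ≤ D := by linarith
    have e5 : β * D ≤ H := by linarith
    have hr' : r (k + 1) - s = D - u / (2 * θ) := by rw [hrs, hD, hu]; ring
    have e6 : u / (2 * θ) ≤ H / 2 := by
      rw [div_le_iff₀ (by positivity)]; linarith
    have e7 : H / (2 * θ ^ 2) ≤ u / (2 * θ) := by
      rw [div_le_div_iff₀ (by positivity) (by positivity)]
      have h1 := mul_le_mul_of_nonneg_left e3 (by positivity : 0 ≤ 2 * θ)
      linarith
    have hD0 : 0 < D := sub_pos.2 hk.1
    have e8 : b * D ≤ H / (2 * θ ^ 2) := by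
      rw [hb, div_mul_eq_mul_div]; gcongr
    have hup0 : 0 < u / (2 * θ) := by positivity
    have hge : s < r (k + 1) := by linarith
    refine ⟨⟨hge, by linarith [hk.2]⟩, by linarith, ?_, ?_⟩
    -- With `u = -U k`, `h` at the new level is at most `-u + cu + u/(2θ) ≤ -cu ≤ -εA`.
    · have := hlip (r k) (r (k + 1)) hge.le (by linarith)
      have e9 : u / (2 * θ) = u * (1 / (2 * θ)) := by ring
      have e10 : u * (2 * c) ≤ u * (1 - 1 / (2 * θ)) := mul_le_mul_of_nonneg_left c3 hu0.le
      linarith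
    · have : θ * H ≤ θ * D := by gcongr
      linarith
  have inv : ∀ k ≤ ⌈K⌉₊, (∀ j < k, U j < -εopt) →
      r k ∈ Set.Ioc s r0 ∧ r k - s ≤ (r0 - s) * (1 - b) ^ k ∧ h (r k) ≤ -εA := by
    intro k
    induction k with
    | zero =>
      intro _ _
      rw [hrz]
      refine ⟨⟨hs, le_rfl⟩, by simp, ?_⟩
      have : εopt * θ = β * (r0 - s) * ε := by rw [hεopt]; field_simp
      have hp : β * (r0 - s) * ε ≤ β * (r0 - s) := mul_le_of_le_one_right (by positivity) hε1
      have hcθ : c * εopt ≤ θ * εopt := by gcongr; linarith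
      rw [hr0, hεA]
      linarith
    | succ k ih =>
      intro hk hj
      obtain ⟨i1, i2, i3⟩ := ih (by omega) fun j hjk => hj j (by omega)
      obtain ⟨s1, s2, s3, -⟩ := step k i1 (hj k (by omega)) (hgood k (by omega) i1)
      refine ⟨s1, s2.trans ?_, s3⟩
      rw [pow_succ, ← mul_assoc]
      exact mul_le_mul_of_nonneg_right i2 (by linarith)
  have count : ∀ k ≤ ⌈K⌉₊, (∀ j < k, U j < -εopt) → U k < -εopt →
      (k : ℝ) * -Real.log (1 - b) < Real.log q := by
    intro k hk hj hUk
    obtain ⟨i1, i2, -⟩ := inv k hk hj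
    obtain ⟨-, -, -, s4⟩ := step k i1 hUk (hgood k hk i1)
    have h1 : εopt < θ * ((r0 - s) * (1 - b) ^ k) := s4.trans_le (by gcongr)
    have h2 : 1 / q < (1 - b) ^ k := by
      have e : εopt = θ * ((r0 - s) * (1 / q)) := by
        rw [hεopt, hq]; field_simp
      rw [e] at h1
      exact lt_of_mul_lt_mul_left (lt_of_mul_lt_mul_left h1 hθ0.le) hd0.le
    have h3 := Real.log_lt_log (by positivity) h2
    rw [Real.log_pow, one_div, Real.log_inv] at h3
    linarith
  -- `K b = log q` and `b ≤ -log (1 - b)`, so `count` cannot hold at `⌈K⌉₊`, the last round in which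
  -- accuracy is assumed.
  have hex : ∃ k, -εopt ≤ U k := by
    by_contra! hno
    have h1 := count ⌈K⌉₊ le_rfl (fun j _ => hno j) (hno _)
    have h2 : (⌈K⌉₊ : ℝ) * b ≤ ⌈K⌉₊ * -Real.log (1 - b) := by gcongr
    have h3 := mul_le_mul_of_nonneg_right (Nat.le_ceil K) hb0.le
    linarith
  classical
  set k := Nat.find hex with hkdef
  have hk1 : -εopt ≤ U k := Nat.find_spec hex
  have hk2 : ∀ j < k, U j < -εopt := fun j hj => not_le.1 (Nat.find_min hex hj)
  have hkK : k ≤ ⌈K⌉₊ := by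
    by_contra! hlt
    have h1 := count ⌈K⌉₊ le_rfl (fun j hj => hk2 j (by omega)) (hk2 _ hlt)
    have h2 : (⌈K⌉₊ : ℝ) * b ≤ ⌈K⌉₊ * -Real.log (1 - b) := by gcongr
    have h3 := mul_le_mul_of_nonneg_right (Nat.le_ceil K) hb0.le
    linarith
  obtain ⟨i1, i2, i3⟩ := inv k hkK hk2
  refine ⟨k, ⟨hk1, hk2⟩, i1, i3, ?_, hkK, fun hexp => ?_⟩
  · have g1 := (abs_le.1 (hgood k hkK i1)).2
    have l2 := hup _ i1
    have h1 : β * (r k - s) ≤ θ * εopt := by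
      have : (1 + c) * εopt ≤ θ * εopt := by gcongr
      linarith
    have h2 : θ * εopt = β * (ε * (r0 - s)) := by rw [hεopt]; field_simp
    rw [h2] at h1
    exact le_of_mul_le_mul_left h1 hβ
  · have hL : 4 ≤ Real.log q := by
      rw [Real.le_log_iff_exp_le hq0]; exact hexp
    refine le_of_mul_le_mul_right ?_ hb0
    rw [hKb]
    rcases Nat.eq_zero_or_pos k with h0 | hpos
    · rw [h0]; push_cast; linarith
    -- Round `j = k - 1` did not halt, hence `j b ≤ (1 - b/2) log q`. As `log q ≥ 4`, the saving is
    -- at least `2b`, so `(k + 1) b = (j + 2) b ≤ log q = K b`.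
    · obtain ⟨j, hj⟩ : ∃ j, k = j + 1 := ⟨k - 1, by omega⟩
      have h1 := count j (by omega) (fun i hi => hk2 i (by omega)) (hk2 j (by omega))
      have h2 := le_neg_log_one_sub_mul hb0 hb2
      have h3 : (j : ℝ) * b ≤ j * (-Real.log (1 - b) * (1 - b / 2)) := by gcongr
      have h4 : (j : ℝ) * -Real.log (1 - b) * (1 - b / 2) ≤ Real.log q * (1 - b / 2) :=
        mul_le_mul_of_nonneg_right h1.le (by linarith)
      have h5 : 4 * b ≤ Real.log q * b := by gcongr
      rw [hj]
      push_cast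
      linarith

/-! ### Numerical bounds for the iteration limit -/

section Numeric

variable {δ : ℝ}

lemma three_le_log_div (hδ : 0 < δ) (hδ1 : δ < 1) : 3 ≤ Real.log (24 / δ) := by
  rw [Real.le_log_iff_exp_le (by positivity)]
  have h1 : Real.exp 3 ≤ 24 := by
    have := Real.exp_one_lt_d9
    have e : Real.exp 3 = Real.exp 1 ^ 3 := by rw [← Real.exp_nat_mul]; norm_num
    rw [e]
    calc Real.exp 1 ^ 3 ≤ 2.7182818286 ^ 3 := by gcongr
      _ ≤ 24 := by norm_num
  have h2 : 24 ≤ 24 / δ := by rw [le_div_iff₀ hδ]; linarith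
  linarith

lemma six_le_OmegaFun (hδ : 0 < δ) (hδ1 : δ < 1) : 6 ≤ OmegaFun δ := by
  refine le_trans ?_ (le_max_left _ _)
  refine Real.le_sqrt_of_sq_le ?_
  linarith [three_le_log_div hδ hδ1]

lemma log_le_OmegaFun (hδ : 0 < δ) (hδ1 : δ < 1) : Real.log (3 / δ) ≤ OmegaFun δ := by
  have h : Real.log (3 / δ) ≤ Real.log (24 / δ) :=
    Real.log_le_log (by positivity) (by gcongr; norm_num)
  exact le_trans (by linarith [three_le_log_div hδ hδ1]) (le_max_right _ _)

lemma OmegaFun_le (hδ : 0 < δ) (hδ2 : δ ≤ 1 / 2) : OmegaFun δ ≤ 12 * Real.log (1 / δ) := by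
  have h3 := three_le_log_div hδ (by linarith)
  have h1 : Real.log (24 / δ) ≤ 6 * Real.log (1 / δ) := by
    have e : Real.log (24 / δ) = Real.log 24 + Real.log (1 / δ) := by
      rw [← Real.log_mul (by norm_num) (by positivity)]; ring_nf
    have e2 : Real.log 24 ≤ 5 * Real.log 2 := by
      have : Real.log 24 ≤ Real.log (2 ^ 5) := Real.log_le_log (by norm_num) (by norm_num)
      rwa [Real.log_pow] at this
    have e3 : Real.log 2 ≤ Real.log (1 / δ) :=
      Real.log_le_log (by norm_num) (by rw [le_div_iff₀ hδ]; linarith)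
    linarith
  refine max_le ?_ (by linarith)
  refine (Real.sqrt_le_sqrt (y := (2 * Real.log (24 / δ)) ^ 2) (by nlinarith)).trans ?_
  rw [Real.sqrt_sq (by linarith)]
  linarith

lemma five_le_log {a : ℝ} (ha : 30 ≤ a) : 5 ≤ Real.log (8 * a) := by
  rw [Real.le_log_iff_exp_le (by linarith)]
  have := Real.exp_one_lt_d9
  have e : Real.exp 5 = Real.exp 1 ^ 5 := by rw [← Real.exp_nat_mul]; norm_num
  rw [e]
  calc Real.exp 1 ^ 5 ≤ 2.7182818286 ^ 5 := by gcongr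
    _ ≤ 8 * 30 := by norm_num
    _ ≤ 8 * a := by linarith

/-- The logarithm of `√n` lies below its tangent at `8al` with `l = log (8a)`. The factor `16` in
the hypothesis leaves room for `8al ≤ √n`, after which every term is a small fraction of `w√n`. In
the application `x` is `log (3/δ)` and `y` is the logarithm of the number of calls. -/
lemma log_growth_le {a w n x y : ℝ} (ha : 30 ≤ a) (hw : 6 ≤ w) (hx : x ≤ w)
    (hy : y ≤ 2 * Real.log a) (hn : (16 * a * Real.log (8 * a)) ^ 2 ≤ n + 1) :
    a * (1 + Real.log n + x + y) ≤ w / 4 * √n := by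
  set l := Real.log (8 * a) with hl
  have hl5 : 5 ≤ l := five_le_log ha
  have hR : 0 < 8 * a * l := by positivity
  have hal : 1 ≤ 8 * a * l := by nlinarith
  have hn' : (8 * a * l) ^ 2 ≤ n := by nlinarith
  have hn0 : 0 < n := lt_of_lt_of_le (by positivity) hn'
  set σ := √n with hσ
  have hσR : 8 * a * l ≤ σ := Real.le_sqrt_of_sq_le hn'
  have hσ0 : 0 < σ := lt_of_lt_of_le hR hσR
  have hlogn : Real.log n = 2 * Real.log σ := by
    rw [hσ, Real.log_sqrt hn0.le]; ring
  have h1 : Real.log σ ≤ Real.log (8 * a * l) + σ / (8 * a * l) - 1 := by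
    have := Real.log_le_sub_one_of_pos (div_pos hσ0 hR)
    rw [Real.log_div hσ0.ne' hR.ne'] at this
    linarith
  have h2 : Real.log (8 * a * l) ≤ 2 * l := by
    rw [Real.log_mul (by positivity) (by positivity)]
    have := Real.log_le_sub_one_of_pos (by linarith : 0 < l)
    linarith
  have h3 : Real.log a ≤ l := Real.log_le_log (by linarith) (by linarith)
  have h4 : a * (σ / (8 * a * l)) = σ / (8 * l) := by field_simp
  have h5 : σ / (8 * l) ≤ σ / 40 := by gcongr; linarith
  have h6 : a * (1 + Real.log n + x + y) ≤ a * (6 * l + w) + 2 * (a * (σ / (8 * a * l))) := by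
    have : 1 + Real.log n + x + y ≤ 6 * l + w + 2 * (σ / (8 * a * l)) := by linarith
    have := mul_le_mul_of_nonneg_left this (by linarith : 0 ≤ a)
    linarith
  rw [h4] at h6
  have h7 : a * w ≤ σ / 40 * w := by
    gcongr
    nlinarith
  nlinarith

end Numeric

namespace MirrorSetup

variable {d m : ℕ} {Ξ : Fin (m + 1) → Type*} [∀ i, MeasurableSpace (Ξ i)] {P : SOEC d m Ξ}
  {S : MirrorSetup P}

/-- The constant `A_δ` of the iteration limit. -/
noncomputable def iterConst (S : MirrorSetup P) (δ : ℝ) : ℝ :=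
  S.Q * OmegaFun δ + 10 * S.M * OmegaFun δ + 4.5 * S.M

lemma iterLimit_eq (S : MirrorSetup P) (δ ε : ℝ) :
    S.iterLimit δ ε =
      max 6 ((16 * (S.iterConst δ / ε) * Real.log (8 * (S.iterConst δ / ε))) ^ 2 - 2) := by
  simp only [iterLimit, iterConst, mul_div_assoc]

/-- Past the iteration limit the error of a run is at most a quarter of the tolerance. -/
lemma errBound_div_le (hM : 0 < S.M) (hQ : 0 < S.Q) {δ ε : ℝ} (hδ : 0 < δ) (hδ1 : δ < 1)
    (hε : 0 < ε) (ha : 30 ≤ S.iterConst δ / ε) {N : ℝ} (hN : 1 ≤ N)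
    (hNa : N ≤ (S.iterConst δ / ε) ^ 2) {t : ℕ} (ht : S.iterLimit δ ε ≤ t) :
    S.errBound (t + 1) (Real.log (3 * N / δ)) / ∑ s ∈ Finset.range (t + 1), stepWeight s ≤
      ε / 4 := by
  set a := S.iterConst δ / ε with ha_def
  have hw := six_le_OmegaFun hδ hδ1
  set w := OmegaFun δ with hw_def
  rw [iterLimit_eq, max_le_iff] at ht
  -- With `n = t + 1` samples, the `- 2` in the iteration limit gives exactly the hypothesis on `n +
  -- 1`.
  have hgrow := log_growth_le (n := ((t + 1 : ℕ) : ℝ)) (y := Real.log N) ha hw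
    (log_le_OmegaFun hδ hδ1)
    (by rw [← Nat.cast_ofNat, ← Real.log_pow]; exact Real.log_le_log (by linarith) hNa)
    (by push_cast; linarith [ht.2])
  have hlogn : 0 ≤ Real.log ((t + 1 : ℕ) : ℝ) := Real.log_natCast_nonneg _
  have hlog3 : 0 ≤ Real.log (3 / δ) :=
    Real.log_nonneg (by rw [le_div_iff₀ hδ]; linarith)
  have hlogN : 0 ≤ Real.log N := Real.log_nonneg hN
  have hsplit : Real.log (3 * N / δ) = Real.log (3 / δ) + Real.log N := by
    rw [← Real.log_mul (by positivity) (by positivity)]; ring_nf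
  have hsq := sum_stepWeight_sq_le (t + 1)
  set L := 1 + Real.log ((t + 1 : ℕ) : ℝ) + Real.log (3 / δ) + Real.log N with hL
  have hL1 : 1 ≤ L := by linarith
  have herr : S.errBound (t + 1) (Real.log (3 * N / δ)) ≤ (S.Q + 3 * S.M) * L := by
    unfold errBound
    have h1 : ∑ s ∈ Finset.range (t + 1), stepWeight s ^ 2 + Real.log (3 * N / δ) ≤ L := by
      rw [hsplit]; linarith
    have h2 : (S.Q + 2 * S.M) * (∑ s ∈ Finset.range (t + 1), stepWeight s ^ 2 +
      Real.log (3 * N / δ)) ≤ (S.Q + 2 * S.M) * L := by gcongr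
    nlinarith
  have hA : (S.Q + 3 * S.M) * w ≤ a * ε := by
    rw [ha_def, div_mul_cancel₀ _ hε.ne', iterConst, ← hw_def]
    nlinarith
  rw [div_le_iff₀ (sum_stepWeight_pos (Nat.succ_pos t))]
  have hW := sqrt_le_sum_stepWeight (t + 1)
  refine le_of_mul_le_mul_left ?_ (by linarith : 0 < w)
  calc w * S.errBound (t + 1) (Real.log (3 * N / δ)) ≤ w * ((S.Q + 3 * S.M) * L) := by gcongr
    _ = (S.Q + 3 * S.M) * w * L := by ring
    _ ≤ a * ε * L := by gcongr
    _ = ε * (a * L) := by ring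
    _ ≤ ε * (w / 4 * √((t + 1 : ℕ) : ℝ)) := by gcongr
    _ ≤ ε * (w / 4 * ∑ s ∈ Finset.range (t + 1), stepWeight s) := by gcongr
    _ = _ := by ring

/-- The factor in the bound for the iteration limit. -/
noncomputable def limitFactor (p : ℕ) (M Q κ : ℝ) : ℝ :=
  128 + (16 * (12 * (Q + 15 * M) / κ) *
    (2 * |Real.log (8 * (12 * (Q + 15 * M) / κ))| + (p + 1))) ^ 2

/-- `A_δ` is at most linear in `log (1/δ)`, and `hp` bounds `log (1/δ)/ε` by `ε^{-(p+1)}`, so the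
logarithm in the limit is of order `log (1/ε)`. Both logarithms are at least `1/2`, which absorbs
additive constants: `8` becomes `128 = 8 * 16`. -/
lemma ceil_iterLimit_le (hM : 0 < S.M) (hQ : 0 < S.Q) {δ ε κ : ℝ} {p : ℕ} (hδ : 0 < δ)
    (hδ2 : δ ≤ 1 / 2) (hε : 0 < ε) (hε2 : ε ≤ 1 / 2) (hκ : 0 < κ)
    (ha : 1 ≤ S.iterConst δ / (κ * ε)) (hp : Real.log (1 / δ) ≤ (1 / ε) ^ p) :
    (⌈S.iterLimit δ (κ * ε)⌉₊ : ℝ) + 1 ≤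
      limitFactor p S.M S.Q κ * (Real.log (1 / δ) ^ 2 * Real.log (1 / ε) ^ 2 / ε ^ 2) := by
  have hlog2 : (1 : ℝ) / 2 ≤ Real.log 2 := by linarith [Real.log_two_gt_d9]
  set Ld := Real.log (1 / δ) with hLd
  set Le := Real.log (1 / ε) with hLe
  have hLd2 : 1 / 2 ≤ Ld := hlog2.trans
    (Real.log_le_log (by norm_num) (by rw [le_div_iff₀ hδ]; linarith))
  have hLe2 : 1 / 2 ≤ Le := hlog2.trans
    (Real.log_le_log (by norm_num) (by rw [le_div_iff₀ hε]; linarith))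
  set a1 := 12 * (S.Q + 15 * S.M) / κ with ha1
  have ha10 : 0 < a1 := by positivity
  set a := S.iterConst δ / (κ * ε) with ha_def
  have hA : S.iterConst δ ≤ 12 * (S.Q + 15 * S.M) * Ld := by
    have h6 := six_le_OmegaFun hδ (by linarith)
    have h12 := OmegaFun_le hδ hδ2
    have : (S.Q + 15 * S.M) * OmegaFun δ ≤ (S.Q + 15 * S.M) * (12 * Ld) := by gcongr
    unfold iterConst
    nlinarith
  have haa : a ≤ a1 * (Ld / ε) := by
    rw [ha_def, div_le_iff₀ (by positivity), ha1]
    refine hA.trans (le_of_eq ?_)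
    field_simp
  set c2 := 2 * |Real.log (8 * a1)| + ((p : ℝ) + 1) with hc2
  have hlog : Real.log (8 * a) ≤ c2 * Le := by
    have h1 : 8 * a ≤ (8 * a1) * (1 / ε) ^ (p + 1) := by
      have : Ld / ε ≤ (1 / ε) ^ (p + 1) := by
        rw [pow_succ, div_eq_mul_one_div Ld ε]; gcongr
      calc 8 * a ≤ 8 * (a1 * (Ld / ε)) := by gcongr
        _ ≤ 8 * (a1 * (1 / ε) ^ (p + 1)) := by gcongr
        _ = _ := by ring
    have h2 := Real.log_le_log (by linarith) h1
    rw [Real.log_mul (x := 8 * a1) (by positivity) (by positivity), Real.log_pow, ← hLe] at h2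
    push_cast at h2
    have h3 : Real.log (8 * a1) ≤ 2 * |Real.log (8 * a1)| * Le := by
      nlinarith [le_abs_self (Real.log (8 * a1)), abs_nonneg (Real.log (8 * a1))]
    rw [hc2]
    linarith
  have hlog0 : 0 ≤ Real.log (8 * a) := Real.log_nonneg (by linarith)
  have hsq : (16 * a * Real.log (8 * a)) ^ 2 ≤
      (16 * a1 * c2) ^ 2 * (Ld ^ 2 * Le ^ 2 / ε ^ 2) := by
    have : (16 * a1 * c2) ^ 2 * (Ld ^ 2 * Le ^ 2 / ε ^ 2) =
        (16 * (a1 * (Ld / ε)) * (c2 * Le)) ^ 2 := by field_simp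
    rw [this]
    gcongr
  have hone : 1 ≤ 16 * (Ld ^ 2 * Le ^ 2 / ε ^ 2) := by
    rw [← mul_div_assoc, le_div_iff₀ (by positivity)]
    have h1 : (1 / 2 : ℝ) ^ 2 ≤ Ld ^ 2 := by gcongr
    have h2 : (1 / 2 : ℝ) ^ 2 ≤ Le ^ 2 := by gcongr
    have h3 : (1 / 2 : ℝ) ^ 2 * (1 / 2 : ℝ) ^ 2 ≤ Ld ^ 2 * Le ^ 2 := by gcongr
    nlinarith
  have hT : S.iterLimit δ (κ * ε) + 2 ≤ 8 + (16 * a * Real.log (8 * a)) ^ 2 := by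
    rw [iterLimit_eq, ← ha_def, ← le_sub_iff_add_le]
    exact max_le (by linarith [sq_nonneg (16 * a * Real.log (8 * a))]) (by linarith)
  have hceil : (⌈S.iterLimit δ (κ * ε)⌉₊ : ℝ) < S.iterLimit δ (κ * ε) + 1 :=
    Nat.ceil_lt_add_one (by rw [iterLimit_eq]; exact le_trans (by norm_num) (le_max_left _ _))
  have hfac : limitFactor p S.M S.Q κ = 128 + (16 * a1 * c2) ^ 2 := rfl
  rw [hfac]
  linarith

end MirrorSetup

/-- The oracle output `o` at level `r` is accurate up to the error `e`, compared with the near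
minimizers `xs`. -/
def SOEC.Accurate {d m : ℕ} {Ξ : Fin (m + 1) → Type*} [∀ i, MeasurableSpace (Ξ i)]
    (P : SOEC d m Ξ) (xs : ℝ → Vec d) (r e : ℝ) (o : OracleOutput d) : Prop :=
  o.U ≤ P.maxGap r (xs r) + e ∧ P.maxGap r o.x ≤ o.U + e

/-! ### Oracle calls at the random levels -/

namespace MirrorSetup

variable {d m : ℕ} {Ξ : Fin (m + 1) → Type*} [∀ i, MeasurableSpace (Ξ i)] {P : SOEC d m Ξ}
  {S : MirrorSetup P} {r0 : ℝ} {Ω : Type*} [mΩ : MeasurableSpace Ω] {Pr : Measure Ω}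
  {ξ : ℕ → ℕ → Ω → ∀ i, Ξ i}

lemma Valid.measurable_level (h : S.Valid r0) (hm : ∀ k t, Measurable (ξ k t))
    (hlaw : ∀ k t, Measure.map (ξ k t) Pr = P.law)
    (hind : iIndepFun (fun p : ℕ × ℕ => ξ p.1 p.2) Pr) (limit : ℝ → ℝ → ℕ) (εA δ θ : ℝ) (k : ℕ) :
    Measurable[pastSigma ξ k 0]
      fun ω => SFLS.level (OVSMD S limit) r0 εA δ θ (fun k t => ξ k t ω) k := by
  induction k with
  | zero => exact measurable_const
  | succ k ih =>
    have h1 := h.measurable_uhat (sampleFiltration_pastSigma hm hlaw hind k) ih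
      (limit (δ / 2 ^ k) εA)
    have hle : ∀ t, pastSigma ξ k t ≤ pastSigma ξ (k + 1) 0 := fun t =>
      pastSigma_mono ξ (Or.inl (Nat.lt_succ_self k))
    exact (ih.mono (hle 0) le_rfl).add ((h1.mono (hle _) le_rfl).div_const _)

variable [IsProbabilityMeasure Pr]

lemma Valid.measure_inaccurate_le (h : S.Valid r0) (h0 : P.fstar < r0)
    (hm : ∀ k t, Measurable (ξ k t)) (hlaw : ∀ k t, Measure.map (ξ k t) Pr = P.law)
    (hind : iIndepFun (fun p : ℕ × ℕ => ξ p.1 p.2) Pr) (limit : ℝ → ℝ → ℕ) (εA δ θ : ℝ)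
    {xs : ℝ → Vec d} (hxs : Measurable xs) (hxsX : ∀ r, xs r ∈ P.X) {lam e : ℝ} (hlam : 0 ≤ lam)
    (k : ℕ) (he : S.errBound (limit (δ / 2 ^ k) εA + 1) lam /
      ∑ s ∈ Finset.range (limit (δ / 2 ^ k) εA + 1), stepWeight s ≤ e) :
    Pr {ω | SFLS.level (OVSMD S limit) r0 εA δ θ (fun k t => ξ k t ω) k ∈ Set.Ioc P.fstar r0 ∧
        ¬ P.Accurate xs (SFLS.level (OVSMD S limit) r0 εA δ θ (fun k t => ξ k t ω) k) e
          (SFLS.output (OVSMD S limit) r0 εA δ θ (fun k t => ξ k t ω) k)} ≤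
      3 * ENNReal.ofReal (Real.exp (-lam)) := by
  classical
  set lev : Ω → ℝ := fun ω => SFLS.level (OVSMD S limit) r0 εA δ θ (fun k t => ξ k t ω) k with hlev
  -- The tail bounds cover only levels in `(f*, r0]`. Replacing other levels by `r0` loses nothing,
  -- as the event excludes them.
  set ρ : Ω → ℝ := fun ω => if lev ω ∈ Set.Ioc P.fstar r0 then lev ω else r0 with hρ
  have hlevm : Measurable[pastSigma ξ k 0] lev :=
    h.measurable_level hm hlaw hind limit εA δ θ k
  have hρm : Measurable[pastSigma ξ k 0] ρ :=
    Measurable.ite (hlevm measurableSet_Ioc) hlevm measurable_const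
  have hρmem : ∀ ω, ρ ω ∈ Set.Ioc P.fstar r0 := by
    intro ω
    simp only [hρ]
    split_ifs with hω
    · exact hω
    · exact ⟨h0, le_rfl⟩
  refine le_trans (measure_mono fun ω hω => ?_) (h.measure_call_failure_le h0
    (sampleFiltration_pastSigma hm hlaw hind k) hρm hρmem hxs hxsX
    (limit (δ / 2 ^ k) εA) hlam)
  obtain ⟨hmem, hacc⟩ := hω
  have e1 : ρ ω = lev ω := if_pos hmem
  intro hgood
  refine hacc ?_
  rw [e1] at hgood
  exact ⟨hgood.1.trans (add_le_add_right he _), hgood.2.trans (add_le_add_right he _)⟩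

end MirrorSetup

/-- The constant in the bound for the number of gradient iterations. -/
noncomputable def iterationConst (p : ℕ) (θ M Q H : ℝ) : ℝ :=
  6 * MirrorSetup.limitFactor p M Q (-((θ - 1) / (2 * θ ^ 2 * (θ + 1))) * H)

/-! ### The number of calls, and the theorem -/

lemma one_le_ratio {θ β ε : ℝ} (hθ : 1 < θ) (hβ : 0 < β) (hβ1 : β ≤ 1) (hε : 0 < ε)
    (hε1 : ε ≤ 1) : 1 ≤ θ ^ 2 / (β * ε) := by
  rw [le_div_iff₀ (by positivity), one_mul]
  have : β * ε ≤ 1 := mul_le_one₀ hβ1 hε.le hε1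
  linarith [one_le_pow₀ hθ.le (n := 2)]

lemma numCalls_le {θ β ε : ℝ} (hθ : 1 < θ) (hβ : 0 < β) (hβ1 : β ≤ 1) (hε : 0 < ε)
    (hε1 : ε ≤ 1) {a : ℝ} (ha : 30 * (θ ^ 2 / (β * ε)) ≤ a) :
    ((⌈2 * θ ^ 2 / β * Real.log (θ ^ 2 / (β * ε))⌉₊ + 1 : ℕ) : ℝ) ≤ a ^ 2 := by
  have hq1 := one_le_ratio hθ hβ hβ1 hε hε1
  set q := θ ^ 2 / (β * ε) with hq
  have hlog0 : 0 ≤ Real.log q := Real.log_nonneg hq1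
  have hlog : Real.log q ≤ q := by
    linarith [Real.log_le_sub_one_of_pos (by linarith : 0 < q)]
  have e : 2 * θ ^ 2 / β = 2 * (q * ε) := by rw [hq]; field_simp
  have hqε : q * ε ≤ q := mul_le_of_le_one_right (by linarith) hε1
  have h1 : 2 * θ ^ 2 / β * Real.log q ≤ 2 * q * q := by
    rw [e]
    have : 2 * (q * ε) * Real.log q ≤ 2 * q * q := by gcongr
    exact this
  have h2 := Nat.ceil_lt_add_one (a := 2 * θ ^ 2 / β * Real.log q)
    (mul_nonneg (by positivity) hlog0)
  push_cast
  nlinarith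

/-- `⌈K⌉ + 1 ≤ K + 2`, and the product on the right, half of `K`, is at least `1/2` because `ε ≤
1/2`; so the `2` costs at most four more copies of it. -/
lemma succ_le_six_mul {θ β ε : ℝ} (hθ : 1 < θ) (hβ : 0 < β) (hβ1 : β ≤ 1) (hε : 0 < ε)
    (hε2 : ε ≤ 1 / 2) {k : ℕ} (hk : k ≤ ⌈2 * θ ^ 2 / β * Real.log (θ ^ 2 / (β * ε))⌉₊) :
    (k : ℝ) + 1 ≤ 6 * (θ ^ 2 / β * Real.log (θ ^ 2 / (β * ε))) := by
  have hθ2 : 1 ≤ θ ^ 2 := one_le_pow₀ hθ.le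
  have hlogq : 1 / 2 ≤ Real.log (θ ^ 2 / (β * ε)) := by
    have h2 : 2 ≤ θ ^ 2 / (β * ε) := by
      rw [le_div_iff₀ (by positivity)]
      have : β * ε ≤ 1 * (1 / 2) := by gcongr
      linarith
    have := Real.log_le_log (by norm_num) h2
    linarith [Real.log_two_gt_d9]
  have hθβ : 1 ≤ θ ^ 2 / β := by
    rw [le_div_iff₀ hβ]
    linarith
  have h1 : 1 * (1 / 2) ≤ θ ^ 2 / β * Real.log (θ ^ 2 / (β * ε)) := by gcongr
  have h2 := Nat.ceil_lt_add_one (a := 2 * θ ^ 2 / β * Real.log (θ ^ 2 / (β * ε)))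
    (by positivity)
  have h3 : (k : ℝ) ≤ (⌈2 * θ ^ 2 / β * Real.log (θ ^ 2 / (β * ε))⌉₊ : ℝ) := by exact_mod_cast hk
  have h4 : 2 * θ ^ 2 / β * Real.log (θ ^ 2 / (β * ε)) =
      2 * (θ ^ 2 / β * Real.log (θ ^ 2 / (β * ε))) := by ring
  linarith

theorem corollary1 :
    ∃ C : ℕ → ℝ → ℝ → ℝ → ℝ → ℝ,
    ∀ (d m : ℕ) (Ξ : Fin (m + 1) → Type*) [∀ i, MeasurableSpace (Ξ i)]
      (P : SOEC d m Ξ) (S : MirrorSetup P) (r0 θ : ℝ)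
      (Sample : Type*) [MeasurableSpace Sample] (Pr : Measure Sample) [IsProbabilityMeasure Pr]
      (ξ : ℕ → ℕ → Sample → ∀ i, Ξ i),
      1 ≤ m → P.Regular → P.StrictlyFeasible → S.ValidDGF →
      P.fstar < r0 → S.LightTail r0 → 1 < θ →
      -- the samples `ξ k t` (call `k`, iteration `t`) are i.i.d. with law `P.law`
      (∀ k t, Measurable (ξ k t)) → (∀ k t, Measure.map (ξ k t) Pr = P.law) →
      iIndepFun (fun p : ℕ × ℕ => ξ p.1 p.2) Pr →
      ∀ ε δ : ℝ, 0 < ε → ε ≤ 1 → 0 < δ → δ < 1 →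
      ∀ β εopt εA T K : ℝ,
      β = P.beta r0 →
      εopt = -(1 / θ) * P.H r0 * ε →
      εA = -((θ - 1) / (2 * θ ^ 2 * (θ + 1))) * P.H r0 * ε →
      T = S.iterLimit δ εA →
      K = 2 * θ ^ 2 / β * Real.log (θ ^ 2 / (β * ε)) →
      -- OVSMD is the oracle, and the iteration limit of every call is at least `T(δ, ε_A)`
      ∀ (limit : ℝ → ℝ → ℕ) (A : ℝ → ℝ → ℝ → (ℕ → ∀ i, Ξ i) → OracleOutput d),
      (∀ k : ℕ, T ≤ limit (δ / 2 ^ k) εA) →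
      A = OVSMD S limit →
      1 - δ ≤ Pr.real {ω | ∃ k : ℕ,
        SFLS.HaltsAt A r0 εopt εA δ θ (fun k t => ξ k t ω) k ∧
        -- the returned point is feasible and relative `ε`-optimal
        P.Feasible (SFLS.output A r0 εA δ θ (fun k t => ξ k t ω) k).x ∧
        (P.f 0 (SFLS.output A r0 εA δ θ (fun k t => ξ k t ω) k).x - P.fstar)
          / (r0 - P.fstar) ≤ ε ∧
        -- the number `k + 1` of oracle calls
        k + 1 ≤ ⌈K⌉₊ + 1 ∧
        (Real.exp 4 ≤ θ ^ 2 / (β * ε) → ((k + 1 : ℕ) : ℝ) ≤ K) ∧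
        -- the number of gradient iterations when the limit of every call is `T(δ, ε_A)`
        ((∀ j : ℕ, limit (δ / 2 ^ j) εA = ⌈T⌉₊) →
          ∀ p : ℕ, ε ≤ 1 / 2 → δ ≤ 1 / 2 → Real.log (1 / δ) ≤ (1 / ε) ^ p →
          (SFLS.totalGradIters A r0 εA δ θ (fun k t => ξ k t ω) k : ℝ) ≤
            C p θ S.M S.Q (P.H r0) *
              (θ ^ 2 / (β * ε ^ 2) * Real.log (θ ^ 2 / (β * ε))
                * Real.log (1 / δ) ^ 2 * Real.log (1 / ε) ^ 2))} := by
  refine ⟨iterationConst, ?_⟩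
  intro d m Ξ _ P S r0 θ Sample _ Pr _ ξ hm hR hF hV h0 hL hθ hmeas hlaw hind ε δ hε hε1 hδ hδ1
    β εopt εA T K hβ hεopt hεA hT hK limit A hlimit hA
  subst hA
  have hval : S.Valid r0 := ⟨hR, hV, hL, hV.Dx_pos hR hF, hV.Dy_pos hm, hV.M_pos hL hm⟩
  have hM := hval.M_pos
  have hQ := hL.Q_pos
  have hb := hL.bddBelow_f hV hR
  have hHneg := hR.H_neg hb hF h0
  have hd0 : 0 < r0 - P.fstar := sub_pos.2 h0
  have hH : P.H r0 = -(β * (r0 - P.fstar)) := by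
    rw [hβ, SOEC.beta, div_mul_cancel₀ _ hd0.ne', neg_neg]
  have hβ0 : 0 < β := by
    rw [hβ]; exact div_pos (neg_pos.2 hHneg) hd0
  have hβ1 : β ≤ 1 := by
    rw [hβ, SOEC.beta, div_le_one hd0]
    linarith [hR.neg_le_H hb h0.le]
  have hq1 := one_le_ratio hθ hβ0 hβ1 hε hε1
  set q := θ ^ 2 / (β * ε) with hq
  have hθ0 : 0 < θ := by linarith
  have hθ1 : 0 < θ - 1 := by linarith
  have hεopt' : εopt = β * (r0 - P.fstar) * ε / θ := by
    rw [hεopt, hH]; field_simp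
  have hεA' : εA = tolRatio θ * εopt := by
    rw [hεA, hεopt, tolRatio]; field_simp
  have hεA0 : 0 < εA := by
    rw [hεA', hεopt']; have := tolRatio_pos hθ; positivity
  set κ := -((θ - 1) / (2 * θ ^ 2 * (θ + 1))) * P.H r0 with hκ
  have hκ0 : 0 < κ := by
    rw [hκ, hH]
    have : 0 < (θ - 1) / (2 * θ ^ 2 * (θ + 1)) := by positivity
    have h2 : 0 < β * (r0 - P.fstar) := by positivity
    nlinarith [mul_pos this h2]
  -- `β` and `ε` cancel in `εA * q`, which is at most `(r0 - f*)/2 ≤ 2M`, while `A_δ ≥ 60M` because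
  -- `Ω ≥ 6`.
  have ha30 : 30 * q ≤ S.iterConst δ / εA := by
    have hrange := hL.sub_fstar_le hV hR hm h0
    have h6 := six_le_OmegaFun hδ hδ1
    have hA : 60 * S.M ≤ S.iterConst δ := by
      unfold MirrorSetup.iterConst
      nlinarith
    have hle : εA * q ≤ 2 * S.M := by
      have e : εA * q = (θ - 1) / (θ + 1) * ((r0 - P.fstar) / 2) := by
        rw [hεA, hκ, hH, hq]; field_simp
      rw [e]
      have h1 : (θ - 1) / (θ + 1) ≤ 1 := (div_le_one (by linarith)).2 (by linarith)
      calc _ ≤ 1 * ((r0 - P.fstar) / 2) := by gcongr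
        _ ≤ _ := by linarith
    rw [le_div_iff₀ hεA0]
    linarith
  -- The tolerance is split into `εA/2` for the near minimizer and `εA/4` for each of the two errors
  -- of a run.
  obtain ⟨xs, hxsm, hxsX, hxs⟩ := hR.exists_measurable_near_minimizer hb (half_pos hεA0)
  set N := ⌈K⌉₊ + 1 with hN
  have hN1 : (1 : ℝ) ≤ (N : ℝ) := by exact_mod_cast Nat.succ_pos _
  have hNa : (N : ℝ) ≤ (S.iterConst δ / εA) ^ 2 := by
    rw [hN, hK]; exact numCalls_le hθ hβ0 hβ1 hε hε1 ha30
  -- Three bad events in each of `N` calls: `3 exp (-lam) = δ/N`. The parameters `δ/2ᵏ` enter only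
  -- through the iteration limits.
  set lam := Real.log (3 * N / δ) with hlam
  have hlam0 : 0 ≤ lam := Real.log_nonneg (by rw [le_div_iff₀ hδ]; linarith)
  set lev : ℕ → Sample → ℝ := fun k ω =>
    SFLS.level (OVSMD S limit) r0 εA δ θ (fun k t => ξ k t ω) k with hlev
  set out : ℕ → Sample → OracleOutput d := fun k ω =>
    SFLS.output (OVSMD S limit) r0 εA δ θ (fun k t => ξ k t ω) k with hout
  set bad : ℕ → Set Sample := fun k =>
    {ω | lev k ω ∈ Set.Ioc P.fstar r0 ∧ ¬ P.Accurate xs (lev k ω) (εA / 4) (out k ω)} with hbad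
  have hbadle : ∀ k, Pr (bad k) ≤ ENNReal.ofReal (δ / N) := by
    intro k
    have hk := hlimit k
    rw [hT] at hk
    have := hval.measure_inaccurate_le h0 hmeas hlaw hind limit εA δ θ hxsm hxsX hlam0 k
      (MirrorSetup.errBound_div_le hM hQ hδ hδ1 hεA0 (by linarith) hN1 hNa hk)
    refine this.trans (le_of_eq ?_)
    rw [hlam, Real.exp_neg, Real.exp_log (by positivity), ← ENNReal.ofReal_ofNat,
      ← ENNReal.ofReal_mul (by norm_num)]
    congr 1
    field_simp
  have hbadU : Pr.real (⋃ k ∈ Finset.range N, bad k) ≤ δ := by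
    have h1 : Pr (⋃ k ∈ Finset.range N, bad k) ≤ ENNReal.ofReal δ := by
      refine (measure_biUnion_finset_le _ _).trans ((Finset.sum_le_sum fun k _ => hbadle k).trans ?_)
      rw [Finset.sum_const, Finset.card_range, nsmul_eq_mul, ← ENNReal.ofReal_natCast,
        ← ENNReal.ofReal_mul (by positivity)]
      refine ENNReal.ofReal_le_ofReal (le_of_eq ?_)
      field_simp
    exact ENNReal.toReal_le_of_le_ofReal hδ.le h1
  refine le_trans (b := Pr.real (⋃ k ∈ Finset.range N, bad k)ᶜ) ?_ (measureReal_mono ?_)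
  · have h1 := measureReal_union_le (μ := Pr) (⋃ k ∈ Finset.range N, bad k)
      (⋃ k ∈ Finset.range N, bad k)ᶜ
    rw [Set.union_compl_self, probReal_univ] at h1
    linarith
  intro ω hω
  have hacc : ∀ k ≤ ⌈K⌉₊, lev k ω ∈ Set.Ioc P.fstar r0 →
      P.Accurate xs (lev k ω) (εA / 4) (out k ω) := by
    intro k hk hmem
    by_contra hno
    exact hω (Set.mem_biUnion (Finset.mem_coe.2 (Finset.mem_range.2 (Nat.lt_succ_of_le hk)))
      ⟨hmem, hno⟩)
  have hxmem : ∀ k, (out k ω).x ∈ P.X := fun k => hval.xbar_mem _ _ _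
  obtain ⟨k, hhalt, hmem, hHk, hdist, hkK, hexp⟩ := levelSet_halts (h := P.H) (r := fun k => lev k ω)
    (U := fun k => (out k ω).U) h0 hβ0 hβ1 hH
    (fun r hr => hR.neg_le_H hb hr.1.le)
    (fun r hr => by rw [hβ]; exact hR.H_le_neg_beta hb hF h0 hr.1.le hr.2)
    (fun r r' h1 h2 => hR.H_le_add hb h1 h2) hθ hε hε1 hεopt' hεA' hK rfl (fun _ => rfl)
    (fun k hk hmem => by
      obtain ⟨a1, a2⟩ := hacc k hk hmem
      have a3 := hxs _ hmem.1.le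
      have a4 := SOEC.H_le hb hmem.1.le (hxmem k)
      rw [abs_le]
      constructor <;> linarith)
  obtain ⟨a1, a2⟩ := hacc k hkK hmem
  have a3 := hxs _ hmem.1.le
  -- At the halting round the three errors add up to `𝒫 ≤ H + εA ≤ 0`, so the point is feasible and
  -- its objective is at most the current level.
  obtain ⟨hfeas, hf0⟩ := SOEC.feasible_of_maxGap_nonpos (hxmem k)
    (show P.maxGap (lev k ω) (out k ω).x ≤ 0 by linarith)
  refine ⟨k, hhalt, hfeas, ?_, by omega, hexp, ?_⟩
  · rw [div_le_iff₀ hd0]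
    change P.f 0 (out k ω).x - P.fstar ≤ _
    linarith
  · intro hlim p hε2 hδ2 hp
    have htotal : (SFLS.totalGradIters (OVSMD S limit) r0 εA δ θ (fun k t => ξ k t ω) k : ℝ) =
        ((k : ℝ) + 1) * ((⌈T⌉₊ : ℝ) + 1) := by
      simp [SFLS.totalGradIters, SFLS.output, OVSMD, hlim]
    have hTle : (⌈T⌉₊ : ℝ) + 1 ≤ MirrorSetup.limitFactor p S.M S.Q κ *
        (Real.log (1 / δ) ^ 2 * Real.log (1 / ε) ^ 2 / ε ^ 2) := by
      rw [hT, hεA]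
      exact MirrorSetup.ceil_iterLimit_le hM hQ hδ hδ2 hε hε2 hκ0
        (by rw [← hεA]; linarith) hp
    have hk6 : (k : ℝ) + 1 ≤ 6 * (θ ^ 2 / β * Real.log q) := by
      rw [hK] at hkK
      exact succ_le_six_mul hθ hβ0 hβ1 hε hε2 hkK
    rw [htotal]
    calc ((k : ℝ) + 1) * ((⌈T⌉₊ : ℝ) + 1)
        ≤ 6 * (θ ^ 2 / β * Real.log q) * (MirrorSetup.limitFactor p S.M S.Q κ *
          (Real.log (1 / δ) ^ 2 * Real.log (1 / ε) ^ 2 / ε ^ 2)) :=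
          mul_le_mul hk6 hTle (by positivity) (le_trans (by positivity) hk6)
      _ = _ := by
          rw [iterationConst, ← hκ]
          field_simp
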